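/- Let $E=(E^0,E^1,r,s)$ be an arbitrary directed graph, $K$ a field and $L=L_K(E)$ the (in general non-unital) Leavitt path algebra, with its $\mathbb Z$-grading ($\deg v=0$, $\deg e=1$, $\deg e^*=-1$). All ideals are two-sided, and the intersection of an empty family of ideals is $L$. Write $u\ge v$ if there is a path (possibly of length $0$) from $u$ to $v$. A set $H\subseteq E^0$ is hereditary if $u\in H$, $u\ge v$ imply $v\in H$; it is saturated if every vertex $v$ that emits a non-empty finite set of edges, all with range in $H$, belongs to $H$. For $H$ hereditary and saturated, $B_H$ is the set of $v\in E^0\setminus H$ that emit infinitely many edges, of which only finitely many but at least one have range outside $H$; for $v\in B_H$ put $v^H=v-\sum_{s(e)=v,\,r(e)\notin H}ee^*$. For $S\subseteq B_H$ let $I(H,S)$ be the ideal generated by $H\cup\{v^H:v\in S\}$, and let $E\setminus(H,S)$ be the quotient graph with vertices $(E^0\setminus H)\cup\{v':v\in B_H\setminus S\}$ and edges $\{e:r(e)\notin H\}\cup\{e':r(e)\in B_H\setminus S\}$, where $s(e')=s(e)$ and $r(e')=r(e)'$. A graph is downward directed if it has a vertex and for all vertices $u,v$ there is a vertex $w$ with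 $u\ge w$ and $v\ge w$. It satisfies Condition (L) if every cycle has an exit. It satisfies the strong countable separation property if there is a countable set $C$ of vertices such that every vertex $u$ satisfies $u\ge v$ for some $v\in C$, and $C$ is contained in every non-empty hereditary saturated set of vertices. The graded part $\mathrm{gr}(P)$ of an ideal $P$ is the ideal generated by the homogeneous elements of $P$. The ideal $P$ is called strongly primitive if $\mathrm{gr}(P)=I(H,S)$ for some hereditary saturated $H$ and $S\subseteq B_H$ such that $E\setminus(H,S)$ is downward directed, satisfies the strong countable separation property and, in case $P$ is a graded ideal, also satisfies Condition (L). Theorem. For a prime ideal $P$ of $L$ the following are equivalent: (a) $P$ is locally closed, i.e. $P$ is not the intersection of all the prime ideals of $L$ properly containing $P$; (b) $P$ is completely irreducible, i.e. $P$ is not the intersection of all the ideals of $L$ properly containing $P$; (c) there is an element $a\in L$ such that $P$ is maximal among the ideals of $L$ that do not contain $a$; (d) $P$ is strongly primitive. -/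

import Mathlib

/-!
A directed graph `E = (E⁰, E¹, r, s)` is a `Quiver` structure on its vertex type `V = E⁰`, with no
restriction on cardinalities. `Quiver.Total V` is the set `E¹` of all edges (`e.left` is the source
`s(e)` and `e.right` the range `r(e)`), `Quiver.Star v` is the set `s⁻¹(v)` of edges emitted by `v`,
and `Quiver.Path u v` is the type of paths from `u` to `v`, those of length zero included.
-/

universe u v w

noncomputable section

namespace LPA

section Graph

variable {V : Type u} [Quiver.{v} V]

/-- `u ≥ v`: there is a path from `u` to `v`. -/
def Reaches (a b : V) : Prop := Nonempty (Quiver.Path a b)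

/-- A regular vertex emits a non-empty finite set of edges. -/
def IsRegular (a : V) : Prop := Nonempty (Quiver.Star a) ∧ Finite (Quiver.Star a)

/-- An infinite emitter emits infinitely many edges. -/
def IsInfiniteEmitter (a : V) : Prop := Infinite (Quiver.Star a)

/-- Hereditary sets of vertices. -/
def IsHereditary (H : Set V) : Prop := ∀ a ∈ H, ∀ b, Reaches a b → b ∈ H

/-- Saturated sets of vertices. -/
def IsSaturated (H : Set V) : Prop :=
  ∀ a : V, IsRegular a → (∀ e : Quiver.Star a, e.1 ∈ H) → a ∈ H

/-- A cycle `e₁ ⋯ eₙ`, `n > 0`: consecutive edges are composable, the last one ends where the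
first one starts, and the sources of the edges are pairwise distinct. -/
def IsCycle (c : List (Quiver.Total V)) : Prop :=
  c.IsChain (fun e f => e.right = f.left) ∧
    (∃ h : c ≠ [], (c.getLast h).right = (c.head h).left) ∧
    (c.map Quiver.Total.left).Nodup

/-- An exit of `e₁ ⋯ eₙ` is an edge `f` with `s(f) = s(eᵢ)` and `f ≠ eᵢ` for some `i`. -/
def HasExit (c : List (Quiver.Total V)) : Prop :=
  ∃ f : Quiver.Total V, ∃ e ∈ c, f.left = e.left ∧ f ≠ e

variable (V) in
/-- Condition (L): every cycle has an exit. -/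
def ConditionL : Prop := ∀ c : List (Quiver.Total V), IsCycle c → HasExit c

variable (V) in
/-- The vertex set is (non-empty and) downward directed. -/
def DownwardDirected : Prop :=
  Nonempty V ∧ ∀ a b : V, ∃ c : V, Reaches a c ∧ Reaches b c

/-- The countable separation property with respect to the set `S` of vertices. -/
def CSPWith (S : Set V) : Prop := S.Countable ∧ ∀ a : V, ∃ b ∈ S, Reaches a b

variable (V) in
/-- The strong countable separation property: the countable separation property holds with respect
to a countable set which is contained in every non-empty hereditary saturated set of vertices. -/
def StrongCSP : Prop :=
  ∃ S : Set V, CSPWith S ∧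
    ∀ H : Set V, H.Nonempty → IsHereditary H → IsSaturated H → S ⊆ H

/-- The set `B_H` of breaking vertices of `H`. -/
def breaking (H : Set V) : Set V :=
  {a | a ∉ H ∧ IsInfiniteEmitter a ∧
    Nonempty {e : Quiver.Star a // e.1 ∉ H} ∧ Finite {e : Quiver.Star a // e.1 ∉ H}}

/-- `(H, S)` is an admissible pair. -/
def IsAdmissible (H S : Set V) : Prop := IsHereditary H ∧ IsSaturated H ∧ S ⊆ breaking H

/-- The vertices of the quotient graph `E \ (H, S)`: the vertices of `E` outside `H` (`Sum.inl`),
and a new vertex `a'` for each `a ∈ B_H \ S` (`Sum.inr`). -/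
def QuotientGraph (H S : Set V) : Type u :=
  {a : V // a ∉ H} ⊕ {a : V // a ∈ breaking H \ S}

/-- The edges of the quotient graph `E \ (H, S)`: each edge of `E` between vertices outside `H`,
and, for each edge `e` of `E` from a vertex outside `H` to a vertex `a ∈ B_H \ S`, a new edge
`e'` from `s(e)` to `a'`. The new vertices are sinks. For hereditary `H` an edge with range
outside `H` has its source outside `H` too. -/
instance (H S : Set V) : Quiver.{v} (QuotientGraph H S) where
  Hom
    | Sum.inl a, Sum.inl b => (a : V) ⟶ (b : V)
    | Sum.inl a, Sum.inr b => (a : V) ⟶ (b : V)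
    | Sum.inr _, _ => PEmpty.{v + 1}

end Graph

section Algebra

variable (K : Type w) [Field K] (V : Type u) [Quiver.{v} V]

/-- The generators of the Leavitt path algebra: the vertices `a`, the edges `e` and the ghost
edges `e*`. -/
inductive Gen : Type (max u v)
  | vertex (a : V) : Gen
  | edge (e : Quiver.Total V) : Gen
  | ghost (e : Quiver.Total V) : Gen

variable {V} in
/-- A generator, in the free unital algebra. -/
abbrev freeGen (g : Gen V) : FreeAlgebra K (Gen V) := FreeAlgebra.ι K g

open Gen in
/-- The defining relations of the Leavitt path algebra. -/
inductive Rel : FreeAlgebra K (Gen V) → FreeAlgebra K (Gen V) → Prop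
  | idem (a : V) : Rel (freeGen K (vertex a) * freeGen K (vertex a)) (freeGen K (vertex a))
  | orth (a b : V) (h : a ≠ b) : Rel (freeGen K (vertex a) * freeGen K (vertex b)) 0
  | source_edge (e : Quiver.Total V) :
      Rel (freeGen K (vertex e.left) * freeGen K (edge e)) (freeGen K (edge e))
  | edge_range (e : Quiver.Total V) :
      Rel (freeGen K (edge e) * freeGen K (vertex e.right)) (freeGen K (edge e))
  | range_ghost (e : Quiver.Total V) :
      Rel (freeGen K (vertex e.right) * freeGen K (ghost e)) (freeGen K (ghost e))
  | ghost_source (e : Quiver.Total V) :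
      Rel (freeGen K (ghost e) * freeGen K (vertex e.left)) (freeGen K (ghost e))
  | ck1_same (e : Quiver.Total V) :
      Rel (freeGen K (ghost e) * freeGen K (edge e)) (freeGen K (vertex e.right))
  | ck1_ne (e f : Quiver.Total V) (h : e ≠ f) :
      Rel (freeGen K (ghost e) * freeGen K (edge f)) 0
  | ck2 (a : V) [Fintype (Quiver.Star a)] [Nonempty (Quiver.Star a)] :
      Rel (freeGen K (vertex a))
        (∑ e : Quiver.Star a,
          freeGen K (edge ⟨a, e.1, e.2⟩) * freeGen K (ghost ⟨a, e.1, e.2⟩))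

/-- A generator, in the unital algebra presented by the relations above. -/
def unitalGen (g : Gen V) : RingQuot (Rel K V) :=
  RingQuot.mkAlgHom K (Rel K V) (freeGen K g)

/-- The Leavitt path algebra `L_K(E)`: the (in general non-unital) associative `K`-algebra
presented by the generators and relations above. The unital algebra with the same presentation is
the unitization of `L_K(E)`, inside which `L_K(E)` is the non-unital subalgebra spanned by the
non-empty words in the generators. -/
def LeavittPathAlgebra : Type (max u v w) :=
  NonUnitalAlgebra.adjoin K (Set.range (unitalGen K V))

instance : NonUnitalRing (LeavittPathAlgebra K V) :=
  inferInstanceAs (NonUnitalRing (NonUnitalAlgebra.adjoin K (Set.range (unitalGen K V))))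

instance : Module K (LeavittPathAlgebra K V) :=
  inferInstanceAs (Module K (NonUnitalAlgebra.adjoin K (Set.range (unitalGen K V))))

instance : IsScalarTower K (LeavittPathAlgebra K V) (LeavittPathAlgebra K V) :=
  inferInstanceAs (IsScalarTower K (NonUnitalAlgebra.adjoin K (Set.range (unitalGen K V)))
    (NonUnitalAlgebra.adjoin K (Set.range (unitalGen K V))))

instance : SMulCommClass K (LeavittPathAlgebra K V) (LeavittPathAlgebra K V) :=
  inferInstanceAs (SMulCommClass K (NonUnitalAlgebra.adjoin K (Set.range (unitalGen K V)))
    (NonUnitalAlgebra.adjoin K (Set.range (unitalGen K V))))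

variable {V}

/-- A generator, in the Leavitt path algebra. -/
def gen (g : Gen V) : LeavittPathAlgebra K V :=
  (⟨unitalGen K V g, NonUnitalAlgebra.subset_adjoin K (Set.mem_range_self g)⟩ :
    NonUnitalAlgebra.adjoin K (Set.range (unitalGen K V)))

/-- The element of the Leavitt path algebra given by a path. -/
def ofPath {a : V} : ∀ {b : V}, Quiver.Path a b → LeavittPathAlgebra K V
  | _, .nil => gen K (.vertex a)
  | _, .cons p e => ofPath p * gen K (.edge ⟨_, _, e⟩)

/-- The element `β*` of the Leavitt path algebra given by a path `β`. -/
def ofGhostPath {a : V} : ∀ {b : V}, Quiver.Path a b → LeavittPathAlgebra K V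
  | _, .nil => gen K (.vertex a)
  | _, .cons p e => gen K (.ghost ⟨_, _, e⟩) * ofGhostPath p

variable (V) in
/-- The homogeneous component `L_n`: the span of the `α β*` with `r(α) = r(β)` and
`|α| - |β| = n`. -/
def component (n : ℤ) : Submodule K (LeavittPathAlgebra K V) :=
  Submodule.span K {x | ∃ (a b c : V) (α : Quiver.Path a c) (β : Quiver.Path b c),
    (α.length : ℤ) - (β.length : ℤ) = n ∧ x = ofPath K α * ofGhostPath K β}

variable {K}

/-- The set of homogeneous elements of an ideal, that is, the union of the `I ∩ L_n`. -/
def homogeneousElements (I : TwoSidedIdeal (LeavittPathAlgebra K V)) :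
    Set (LeavittPathAlgebra K V) :=
  {x | x ∈ I ∧ ∃ n : ℤ, x ∈ component K V n}

/-- A graded ideal: `I` is the sum of the `I ∩ L_n`. -/
def IsGraded (I : TwoSidedIdeal (LeavittPathAlgebra K V)) : Prop :=
  ∀ x ∈ I, x ∈ AddSubgroup.closure (homogeneousElements I)

/-- The graded part `gr(I)` of an ideal: the ideal generated by the homogeneous elements of `I`,
which is the largest graded ideal contained in `I`. -/
def gradedPart (I : TwoSidedIdeal (LeavittPathAlgebra K V)) :
    TwoSidedIdeal (LeavittPathAlgebra K V) :=
  TwoSidedIdeal.span (homogeneousElements I)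

variable (K) in
/-- The element `a^H = a - ∑ e e*`, the sum being over the edges `e` with `s(e) = a` and
`r(e) ∉ H`, which are finite in number when `a ∈ B_H`. -/
def breakingElement (H : Set V) (a : V) : LeavittPathAlgebra K V :=
  gen K (.vertex a) - ∑ᶠ e : {e : Quiver.Star a // e.1 ∉ H},
    gen K (.edge ⟨a, e.1.1, e.1.2⟩) * gen K (.ghost ⟨a, e.1.1, e.1.2⟩)

variable (K) in
/-- The ideal `I(H, S)` generated by `H ∪ {a^H : a ∈ S}`. -/
def admissibleIdeal (H S : Set V) : TwoSidedIdeal (LeavittPathAlgebra K V) :=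
  TwoSidedIdeal.span ((fun a => gen K (.vertex a)) '' H ∪ breakingElement K H '' S)

/-- An ideal `P` with graded part `I(H, S)` is strongly primitive if the quotient graph
`E \ (H, S)` is downward directed, satisfies the strong countable separation property and, in case
`P` is graded, satisfies Condition (L). (For a non-graded prime ideal `P` the quotient graph always
has a cycle without exits, and such a `P` counts as strongly primitive.) -/
def IsStronglyPrimitive (P : TwoSidedIdeal (LeavittPathAlgebra K V)) : Prop :=
  ∃ H S : Set V, IsAdmissible H S ∧ gradedPart P = admissibleIdeal K H S ∧
    DownwardDirected (QuotientGraph H S) ∧ StrongCSP (QuotientGraph H S) ∧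
    (IsGraded P → ConditionL (QuotientGraph H S))

end Algebra

section Ideals

variable {R : Type*} [NonUnitalRing R]

/-- A prime ideal of a (possibly non-unital) ring: a proper two-sided ideal `P` such that
`A B ⊆ P` implies `A ⊆ P` or `B ⊆ P`, for all two-sided ideals `A` and `B`. -/
def IsPrimeIdeal (P : TwoSidedIdeal R) : Prop :=
  P ≠ ⊤ ∧ ∀ A B : TwoSidedIdeal R, (∀ a ∈ A, ∀ b ∈ B, a * b ∈ P) → A ≤ P ∨ B ≤ P

/-- `P` is not the intersection of all the prime ideals properly containing it (the empty
intersection being the whole ring). -/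
def IsLocallyClosed (P : TwoSidedIdeal R) : Prop :=
  P ≠ sInf {Q | IsPrimeIdeal Q ∧ P < Q}

/-- `I` is not the intersection of all the ideals properly containing it. -/
def IsCompletelyIrreducible (I : TwoSidedIdeal R) : Prop :=
  I ≠ sInf {J | I < J}

end Ideals

end LPA

end

/-! Let `gr(P) = I(H, S)` and let `F` be the quotient graph `E \ (H, S)`. The algebra `L / I(H, S)`
is generated by elements indexed by `F` which satisfy the Leavitt relations of `F` and whose
vertices are nonzero (`quotientFamily`, `quotientFamily_p_ne_zero`). No isomorphism with `L_K(F)` is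
needed, since the structure theory is developed for any `CKFamily`. The image `P'` of `P` contains
no vertex of `F`, and `P' = 0` exactly when `P` is graded.

The engine is `CKFamily.reduction`: a nonzero element can be multiplied into a nonzero multiple of a
vertex, or into a nonzero element of the corner at a vertex on a closed path without exits. Such a
corner consists of Laurent polynomials in the shortest closed path, so that facts about `K[X]`
apply.

(d) implies (b). If `P' = 0`, Condition (L) puts a vertex in every nonzero ideal. The vertices in
that ideal form a nonempty hereditary saturated set, so every member of the countable set `C` lies
in all larger ideals. If `P' ≠ 0`, then `P'` meets a corner without exits, its trace on `K[X]` is a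
nonzero prime ideal, hence maximal, and the vertex of that corner lies in all larger ideals
(`CKFamily.p_mem_of_prime_lt`).

(a) implies (d). Primeness makes `F` downward directed. If `P' ≠ 0`, then `F` has a vertex on a
closed path without exits; every vertex reaches it, which settles separation. If `P' = 0`, take `y`
outside `P` in all primes properly above `P`. Zorn's lemma gives, over any nonzero ideal missing an
idempotent, a prime ideal that still misses it and contains `y`. On a closed path without exits `y`
would yield a polynomial `g`, and the ideal generated by `X * g + 1` contradicts this, as in
Euclid's proof that there are infinitely many primes. So Condition (L) holds, the ideal of `y`
contains a vertex `u`, and `u` lies in every nonempty hereditary saturated set. The vertices reached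
from `u` through regular vertices form the countable set.

The equivalence of (b) and (c), and the step from (b) to (a), are order-theoretic. -/

noncomputable section

namespace LPA

/-! ### Paths as lists of edges. -/

section Walks

variable {F : Type u} [Quiver.{v} F]

/-- The list of edges `l` is a path from `a` to `b`. -/
def IsWalk : F → List (Quiver.Total F) → F → Prop
  | a, [], b => a = b
  | a, e :: l, b => e.left = a ∧ IsWalk e.right l b

@[simp] theorem isWalk_nil {a b : F} : IsWalk a [] b ↔ a = b := Iff.rfl

@[simp] theorem isWalk_cons {a b : F} {e : Quiver.Total F} {l : List (Quiver.Total F)} :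
    IsWalk a (e :: l) b ↔ e.left = a ∧ IsWalk e.right l b := Iff.rfl

theorem isWalk_singleton (e : Quiver.Total F) : IsWalk e.left [e] e.right := ⟨rfl, rfl⟩

theorem isWalk_append {a c : F} {l l' : List (Quiver.Total F)} :
    IsWalk a (l ++ l') c ↔ ∃ b, IsWalk a l b ∧ IsWalk b l' c := by
  induction l generalizing a with
  | nil => simp
  | cons e l ih => simp [ih, and_assoc]

theorem IsWalk.append {a b c : F} {l l' : List (Quiver.Total F)} (h : IsWalk a l b)
    (h' : IsWalk b l' c) : IsWalk a (l ++ l') c :=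
  isWalk_append.2 ⟨b, h, h'⟩

theorem IsWalk.target_unique {a b c : F} {l : List (Quiver.Total F)} (h : IsWalk a l b)
    (h' : IsWalk a l c) : b = c := by
  induction l generalizing a with
  | nil => exact h.symm.trans h'
  | cons e l ih => exact ih h.2 h'.2

theorem Reaches.refl (a : F) : Reaches a a := ⟨.nil⟩

theorem Reaches.trans {a b c : F} (h : Reaches a b) (h' : Reaches b c) : Reaches a c :=
  ⟨h.some.comp h'.some⟩

theorem Reaches.of_edge (e : Quiver.Total F) : Reaches e.left e.right := ⟨e.hom.toPath⟩

theorem IsWalk.reaches {a b : F} {l : List (Quiver.Total F)} (h : IsWalk a l b) :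
    Reaches a b := by
  induction l generalizing a with
  | nil => exact h ▸ Reaches.refl a
  | cons e l ih => exact h.1 ▸ (Reaches.of_edge e).trans (ih h.2)

theorem Reaches.exists_isWalk {a b : F} (h : Reaches a b) : ∃ l, IsWalk a l b := by
  obtain ⟨p⟩ := h
  induction p with
  | nil => exact ⟨[], rfl⟩
  | cons p e ih =>
    obtain ⟨l, hl⟩ := ih
    exact ⟨l ++ [⟨_, _, e⟩], hl.append (isWalk_singleton _)⟩

end Walks

/-! ### Families satisfying the Leavitt relations: monomials, degrees, local units. -/

/-- A family of elements of a (non-unital) algebra `A` indexed by the vertices and edges of a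
graph `F`, which satisfies the defining relations of the Leavitt path algebra and generates `A`. -/
structure CKFamily (K : Type w) [Field K] (F : Type u) [Quiver.{v} F] (A : Type*)
    [NonUnitalRing A] [Module K A] [IsScalarTower K A A] [SMulCommClass K A A] where
  /-- the images of the vertices -/
  p : F → A
  /-- the images of the edges -/
  s : Quiver.Total F → A
  /-- the images of the ghost edges -/
  t : Quiver.Total F → A
  p_mul_self : ∀ a, p a * p a = p a
  p_mul_p_of_ne : ∀ a b, a ≠ b → p a * p b = 0
  p_mul_s : ∀ e, p e.left * s e = s e
  s_mul_p : ∀ e, s e * p e.right = s e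
  p_mul_t : ∀ e, p e.right * t e = t e
  t_mul_p : ∀ e, t e * p e.left = t e
  t_mul_s_self : ∀ e, t e * s e = p e.right
  t_mul_s_of_ne : ∀ e f, e ≠ f → t e * s f = 0
  finsum_s_mul_t : ∀ a, IsRegular a →
    ∑ᶠ e : Quiver.Star a, s ⟨a, e.1, e.2⟩ * t ⟨a, e.1, e.2⟩ = p a
  adjoin_eq_top :
    NonUnitalAlgebra.adjoin K (Set.range p ∪ Set.range s ∪ Set.range t) = ⊤

namespace CKFamily

set_option linter.unusedSectionVars false

variable {K : Type w} [Field K] {F : Type u} [Quiver.{v} F] {A : Type*}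
    [NonUnitalRing A] [Module K A] [IsScalarTower K A A] [SMulCommClass K A A]
    (Φ : CKFamily K F A)

theorem p_mul_s_of_ne {a : F} {e : Quiver.Total F} (h : a ≠ e.left) : Φ.p a * Φ.s e = 0 := by
  rw [← Φ.p_mul_s, ← mul_assoc, Φ.p_mul_p_of_ne _ _ h, zero_mul]

theorem t_mul_p_of_ne {a : F} {e : Quiver.Total F} (h : e.left ≠ a) : Φ.t e * Φ.p a = 0 := by
  rw [← Φ.t_mul_p, mul_assoc, Φ.p_mul_p_of_ne _ _ h, mul_zero]

/-- The product `s e₁ ⋯ s eₙ` for a path `e₁ ⋯ eₙ` ending at `b`. -/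
def real (l : List (Quiver.Total F)) (b : F) : A := l.foldr (fun e x => Φ.s e * x) (Φ.p b)

/-- The product `t eₙ ⋯ t e₁` for a path `e₁ ⋯ eₙ` ending at `b`. -/
def ghost (l : List (Quiver.Total F)) (b : F) : A := l.foldr (fun e x => x * Φ.t e) (Φ.p b)

@[simp] theorem real_nil (b : F) : Φ.real [] b = Φ.p b := rfl
@[simp] theorem ghost_nil (b : F) : Φ.ghost [] b = Φ.p b := rfl

theorem real_cons (e : Quiver.Total F) (l : List (Quiver.Total F)) (b : F) :
    Φ.real (e :: l) b = Φ.s e * Φ.real l b := rfl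

theorem ghost_cons (e : Quiver.Total F) (l : List (Quiver.Total F)) (b : F) :
    Φ.ghost (e :: l) b = Φ.ghost l b * Φ.t e := rfl

theorem p_mul_real {a b : F} {l : List (Quiver.Total F)} (h : IsWalk a l b) :
    Φ.p a * Φ.real l b = Φ.real l b := by
  cases l with
  | nil => obtain rfl := h; exact Φ.p_mul_self a
  | cons e l => rw [real_cons, ← mul_assoc, ← h.1, Φ.p_mul_s]

theorem ghost_mul_p {a b : F} {l : List (Quiver.Total F)} (h : IsWalk a l b) :
    Φ.ghost l b * Φ.p a = Φ.ghost l b := by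
  cases l with
  | nil => obtain rfl := h; exact Φ.p_mul_self a
  | cons e l => rw [ghost_cons, mul_assoc, ← h.1, Φ.t_mul_p]

theorem p_mul_real_of_ne {a b c : F} {l : List (Quiver.Total F)} (h : IsWalk a l b) (hc : c ≠ a) :
    Φ.p c * Φ.real l b = 0 := by
  rw [← Φ.p_mul_real h, ← mul_assoc, Φ.p_mul_p_of_ne _ _ hc, zero_mul]

theorem ghost_mul_p_of_ne {a b c : F} {l : List (Quiver.Total F)} (h : IsWalk a l b)
    (hc : a ≠ c) : Φ.ghost l b * Φ.p c = 0 := by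
  rw [← Φ.ghost_mul_p h, mul_assoc, Φ.p_mul_p_of_ne _ _ hc, mul_zero]

theorem real_mul_real {b c : F} {l l' : List (Quiver.Total F)} (h : IsWalk b l' c) :
    Φ.real l b * Φ.real l' c = Φ.real (l ++ l') c := by
  induction l with
  | nil => exact Φ.p_mul_real h
  | cons e l ih => rw [real_cons, mul_assoc, ih, List.cons_append, real_cons]

theorem ghost_mul_ghost {b c : F} {l l' : List (Quiver.Total F)} (h : IsWalk b l' c) :
    Φ.ghost l' c * Φ.ghost l b = Φ.ghost (l ++ l') c := by
  induction l with
  | nil => exact Φ.ghost_mul_p h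
  | cons e l ih => rw [ghost_cons, ← mul_assoc, ih, List.cons_append, ghost_cons]

theorem real_mul_p (l : List (Quiver.Total F)) (b : F) : Φ.real l b * Φ.p b = Φ.real l b := by
  simpa using Φ.real_mul_real (l := l) (l' := []) (b := b) (c := b) rfl

theorem p_mul_ghost (l : List (Quiver.Total F)) (b : F) : Φ.p b * Φ.ghost l b = Φ.ghost l b := by
  simpa using Φ.ghost_mul_ghost (l := l) (l' := []) (b := b) (c := b) rfl

theorem real_singleton (e : Quiver.Total F) : Φ.real [e] e.right = Φ.s e := Φ.s_mul_p e

theorem ghost_singleton (e : Quiver.Total F) : Φ.ghost [e] e.right = Φ.t e := Φ.p_mul_t e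

theorem real_mul_s {l : List (Quiver.Total F)} (e : Quiver.Total F) :
    Φ.real l e.left * Φ.s e = Φ.real (l ++ [e]) e.right := by
  rw [← real_singleton, Φ.real_mul_real (isWalk_singleton e)]

theorem t_mul_ghost {l : List (Quiver.Total F)} (e : Quiver.Total F) :
    Φ.t e * Φ.ghost l e.left = Φ.ghost (l ++ [e]) e.right := by
  rw [← ghost_singleton, Φ.ghost_mul_ghost (isWalk_singleton e)]

theorem t_mul_real_cons_self {a b : F} {l : List (Quiver.Total F)} {e : Quiver.Total F}
    (h : IsWalk a (e :: l) b) : Φ.t e * Φ.real (e :: l) b = Φ.real l b := by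
  rw [real_cons, ← mul_assoc, Φ.t_mul_s_self, Φ.p_mul_real h.2]

theorem t_mul_real_cons_of_ne {b : F} {l : List (Quiver.Total F)} {e f : Quiver.Total F}
    (h : e ≠ f) : Φ.t e * Φ.real (f :: l) b = 0 := by
  rw [real_cons, ← mul_assoc, Φ.t_mul_s_of_ne _ _ h, zero_mul]

theorem ghost_cons_mul_s_self {a b : F} {l : List (Quiver.Total F)} {e : Quiver.Total F}
    (h : IsWalk a (e :: l) b) : Φ.ghost (e :: l) b * Φ.s e = Φ.ghost l b := by
  rw [ghost_cons, mul_assoc, Φ.t_mul_s_self, Φ.ghost_mul_p h.2]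

theorem ghost_cons_mul_s_of_ne {b : F} {l : List (Quiver.Total F)} {e f : Quiver.Total F}
    (h : f ≠ e) : Φ.ghost (f :: l) b * Φ.s e = 0 := by
  rw [ghost_cons, mul_assoc, Φ.t_mul_s_of_ne _ _ h, mul_zero]

theorem ghost_mul_real {a b : F} {l : List (Quiver.Total F)} (h : IsWalk a l b) :
    Φ.ghost l b * Φ.real l b = Φ.p b := by
  induction l generalizing a with
  | nil => exact Φ.p_mul_self b
  | cons e l ih => rw [ghost_cons, mul_assoc, Φ.t_mul_real_cons_self h, ih h.2]

theorem mul_mem_of_mem_span {s : Set A} {N : Submodule K A} {c x : A} (h : ∀ y ∈ s, c * y ∈ N)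
    (hx : x ∈ Submodule.span K s) : c * x ∈ N :=
  (Submodule.span_le (p := N.comap (LinearMap.mulLeft K c))).2 h hx

theorem mul_mem_of_mem_span' {s : Set A} {N : Submodule K A} {c x : A} (h : ∀ y ∈ s, y * c ∈ N)
    (hx : x ∈ Submodule.span K s) : x * c ∈ N :=
  (Submodule.span_le (p := N.comap (LinearMap.mulRight K c))).2 h hx

/-- The span of the `α β*` with `|α| - |β| = n`. -/
def deg (n : ℤ) : Submodule K A :=
  Submodule.span K {x | ∃ (a b c : F) (α β : List (Quiver.Total F)), IsWalk a α c ∧ IsWalk b β c ∧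
    (α.length : ℤ) - β.length = n ∧ x = Φ.real α c * Φ.ghost β c}

theorem real_mul_ghost_mem_deg {a b c : F} {α β : List (Quiver.Total F)} (hα : IsWalk a α c)
    (hβ : IsWalk b β c) : Φ.real α c * Φ.ghost β c ∈ Φ.deg ((α.length : ℤ) - β.length) :=
  Submodule.subset_span ⟨a, b, c, α, β, hα, hβ, rfl, rfl⟩

theorem real_mem_deg {a c : F} {α : List (Quiver.Total F)} (hα : IsWalk a α c) :
    Φ.real α c ∈ Φ.deg α.length := by
  simpa [real_mul_p] using Φ.real_mul_ghost_mem_deg (β := []) hα rfl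

theorem ghost_mem_deg {a c : F} {α : List (Quiver.Total F)} (hα : IsWalk a α c) :
    Φ.ghost α c ∈ Φ.deg (-α.length) := by
  simpa [p_mul_ghost] using Φ.real_mul_ghost_mem_deg (α := []) (a := c) rfl hα

theorem p_mem_deg (a : F) : Φ.p a ∈ Φ.deg 0 := by
  simpa using Φ.real_mem_deg (α := []) (a := a) rfl

theorem s_mem_deg (e : Quiver.Total F) : Φ.s e ∈ Φ.deg 1 := by
  simpa [real_singleton] using Φ.real_mem_deg (α := [e]) ⟨rfl, rfl⟩

theorem t_mem_deg (e : Quiver.Total F) : Φ.t e ∈ Φ.deg (-1) := by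
  simpa [ghost_singleton] using Φ.ghost_mem_deg (α := [e]) ⟨rfl, rfl⟩

theorem p_mul_mem_deg (a : F) {n : ℤ} {x : A} (hx : x ∈ Φ.deg n) : Φ.p a * x ∈ Φ.deg n := by
  refine mul_mem_of_mem_span ?_ hx
  rintro _ ⟨b, b', c, α, β, hα, hβ, rfl, rfl⟩
  by_cases h : a = b
  · subst h
    rw [← mul_assoc, Φ.p_mul_real hα]
    exact Φ.real_mul_ghost_mem_deg hα hβ
  · rw [← mul_assoc, Φ.p_mul_real_of_ne hα h, zero_mul]
    exact zero_mem _

theorem s_mul_mem_deg (e : Quiver.Total F) {n : ℤ} {x : A} (hx : x ∈ Φ.deg n) :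
    Φ.s e * x ∈ Φ.deg (1 + n) := by
  refine mul_mem_of_mem_span ?_ hx
  rintro _ ⟨b, b', c, α, β, hα, hβ, rfl, rfl⟩
  by_cases h : e.right = b
  · subst h
    rw [← mul_assoc, ← real_cons]
    convert Φ.real_mul_ghost_mem_deg (a := e.left) (α := e :: α) ⟨rfl, hα⟩ hβ using 2
    push_cast [List.length_cons]
    ring
  · rw [← Φ.s_mul_p, mul_assoc, ← mul_assoc (Φ.p _), Φ.p_mul_real_of_ne hα h, zero_mul, mul_zero]
    exact zero_mem _

theorem t_mul_mem_deg (e : Quiver.Total F) {n : ℤ} {x : A} (hx : x ∈ Φ.deg n) :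
    Φ.t e * x ∈ Φ.deg (-1 + n) := by
  refine mul_mem_of_mem_span ?_ hx
  rintro _ ⟨b, b', c, α, β, hα, hβ, rfl, rfl⟩
  cases α with
  | nil =>
    obtain rfl := hα
    by_cases h : e.left = b
    · subst h
      rw [real_nil, p_mul_ghost, t_mul_ghost, ← Φ.p_mul_ghost, ← real_nil]
      convert Φ.real_mul_ghost_mem_deg (a := e.right) (α := []) rfl
        (hβ.append (isWalk_singleton e)) using 2
      push_cast [List.length_append, List.length_nil, List.length_singleton]
      ring
    · rw [real_nil, ← mul_assoc, Φ.t_mul_p_of_ne h, zero_mul]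
      exact zero_mem _
  | cons f α =>
    by_cases h : e = f
    · subst h
      rw [← mul_assoc, Φ.t_mul_real_cons_self hα]
      convert Φ.real_mul_ghost_mem_deg hα.2 hβ using 2
      push_cast [List.length_cons]
      ring
    · rw [← mul_assoc, Φ.t_mul_real_cons_of_ne h, zero_mul]
      exact zero_mem _

theorem mul_mem_deg {m n : ℤ} {x y : A} (hx : x ∈ Φ.deg m) (hy : y ∈ Φ.deg n) :
    x * y ∈ Φ.deg (m + n) := by
  refine mul_mem_of_mem_span' ?_ hx
  rintro _ ⟨a, b, c, α, β, hα, hβ, rfl, rfl⟩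
  have key : ∀ (β : List (Quiver.Total F)) (c : F) (y : A) (n : ℤ), y ∈ Φ.deg n →
      Φ.ghost β c * y ∈ Φ.deg (-β.length + n) := by
    intro β c
    induction β with
    | nil => intro y n hy; simpa using Φ.p_mul_mem_deg c hy
    | cons e β ih =>
      intro y n hy
      rw [ghost_cons, mul_assoc]
      convert ih _ _ (Φ.t_mul_mem_deg e hy) using 2
      push_cast [List.length_cons]
      ring
  have key' : ∀ (α : List (Quiver.Total F)) (c : F) (y : A) (n : ℤ), y ∈ Φ.deg n →
      Φ.real α c * y ∈ Φ.deg (α.length + n) := by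
    intro α c
    induction α with
    | nil => intro y n hy; simpa using Φ.p_mul_mem_deg c hy
    | cons e α ih =>
      intro y n hy
      rw [real_cons, mul_assoc]
      convert Φ.s_mul_mem_deg e (ih _ _ hy) using 2
      push_cast [List.length_cons]
      ring
  rw [mul_assoc]
  convert key' α c _ _ (key β c y n hy) using 2
  ring

theorem iSup_deg_eq_top : ⨆ n, Φ.deg n = ⊤ := by
  have hle : ∀ n, Φ.deg n ≤ ⨆ n, Φ.deg n := le_iSup _
  rw [eq_top_iff]
  intro x _
  have hx : x ∈ NonUnitalAlgebra.adjoin K (Set.range Φ.p ∪ Set.range Φ.s ∪ Set.range Φ.t) := by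
    rw [Φ.adjoin_eq_top]; trivial
  induction hx using NonUnitalAlgebra.adjoin_induction with
  | mem x hx =>
    rcases hx with (⟨a, rfl⟩ | ⟨e, rfl⟩) | ⟨e, rfl⟩
    · exact hle _ (Φ.p_mem_deg a)
    · exact hle _ (Φ.s_mem_deg e)
    · exact hle _ (Φ.t_mem_deg e)
  | add x y _ _ hx hy => exact add_mem (hx trivial) (hy trivial)
  | zero => exact zero_mem _
  | smul k x _ hx => exact Submodule.smul_mem _ _ (hx trivial)
  | mul x y _ _ hx hy =>
    refine Submodule.iSup_induction _ (motive := fun x => x * y ∈ ⨆ n, Φ.deg n) (hx trivial) ?_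
      (by simp) (fun x z hx hz => by rw [add_mul]; exact add_mem hx hz)
    intro m x hx
    refine Submodule.iSup_induction _ (motive := fun y => x * y ∈ ⨆ n, Φ.deg n) (hy trivial) ?_
      (by simp) (fun x z hx hz => by rw [mul_add]; exact add_mem hx hz)
    intro n y hy
    exact hle _ (Φ.mul_mem_deg hx hy)

theorem mem_span_monomials (x : A) :
    x ∈ Submodule.span K {x | ∃ (a b c : F) (α β : List (Quiver.Total F)),
      IsWalk a α c ∧ IsWalk b β c ∧ x = Φ.real α c * Φ.ghost β c} := by
  have hx : x ∈ ⨆ n, Φ.deg n := by rw [iSup_deg_eq_top]; trivial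
  refine (iSup_le fun n => Submodule.span_mono ?_ : ⨆ n, Φ.deg n ≤ _) hx
  rintro _ ⟨a, b, c, α, β, hα, hβ, -, rfl⟩
  exact ⟨a, b, c, α, β, hα, hβ, rfl⟩

/-- Finite sums of vertices are local units: on the right, such a sum fixes `α β*` as soon as it
includes the source of `β`. -/
theorem eq_zero_of_forall_mul_p {x : A} (h : ∀ a, x * Φ.p a = 0) : x = 0 := by
  suffices ∀ y, ∃ T : Finset F, y * ∑ a ∈ T, Φ.p a = y by
    obtain ⟨T, hT⟩ := this x
    rw [← hT, Finset.mul_sum, Finset.sum_eq_zero fun a _ => h a]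
  -- Stability under enlarging `T` lets a sum of two elements be handled by a union.
  suffices ∀ y, ∃ T : Finset F, ∀ T' : Finset F, T ⊆ T' → y * ∑ a ∈ T', Φ.p a = y from
    fun y => (this y).imp fun T hT => hT T subset_rfl
  classical
  intro y
  induction Φ.mem_span_monomials y using Submodule.span_induction with
  | mem y hy =>
    obtain ⟨a, b, c, α, β, hα, hβ, rfl⟩ := hy
    refine ⟨{b}, fun T' hT' => ?_⟩
    rw [mul_assoc, Finset.mul_sum, Finset.sum_eq_single b, Φ.ghost_mul_p hβ]
    · exact fun d _ hd => Φ.ghost_mul_p_of_ne hβ hd.symm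
    · exact fun hb => (hb (hT' (Finset.mem_singleton_self b))).elim
  | zero => exact ⟨∅, fun _ _ => zero_mul _⟩
  | add x y _ _ hx hy =>
    obtain ⟨T, hT⟩ := hx
    obtain ⟨T', hT'⟩ := hy
    exact ⟨T ∪ T', fun U hU => by
      rw [add_mul, hT U (Finset.union_subset_left hU), hT' U (Finset.union_subset_right hU)]⟩
  | smul k x _ hx =>
    obtain ⟨T, hT⟩ := hx
    exact ⟨T, fun U hU => by rw [smul_mul_assoc, hT U hU]⟩

theorem exists_sum_p_mul_eq (y : A) : ∃ T : Finset F, (∑ a ∈ T, Φ.p a) * y = y := by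
  suffices ∃ T : Finset F, ∀ T' : Finset F, T ⊆ T' → (∑ a ∈ T', Φ.p a) * y = y from
    this.imp fun T hT => hT T subset_rfl
  classical
  induction Φ.mem_span_monomials y using Submodule.span_induction with
  | mem y hy =>
    obtain ⟨a, b, c, α, β, hα, hβ, rfl⟩ := hy
    refine ⟨{a}, fun T' hT' => ?_⟩
    rw [← mul_assoc, Finset.sum_mul, Finset.sum_eq_single a, Φ.p_mul_real hα]
    · exact fun d _ hd => Φ.p_mul_real_of_ne hα hd
    · exact fun hb => (hb (hT' (Finset.mem_singleton_self a))).elim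
  | zero => exact ⟨∅, fun _ _ => mul_zero _⟩
  | add x y _ _ hx hy =>
    obtain ⟨T, hT⟩ := hx
    obtain ⟨T', hT'⟩ := hy
    exact ⟨T ∪ T', fun U hU => by
      rw [mul_add, hT U (Finset.union_subset_left hU), hT' U (Finset.union_subset_right hU)]⟩
  | smul k x _ hx =>
    obtain ⟨T, hT⟩ := hx
    exact ⟨T, fun U hU => by rw [mul_smul_comm, hT U hU]⟩

theorem eq_zero_of_forall_p_mul {x : A} (h : ∀ a, Φ.p a * x = 0) : x = 0 := by
  obtain ⟨T, hT⟩ := Φ.exists_sum_p_mul_eq x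
  rw [← hT, Finset.sum_mul, Finset.sum_eq_zero fun a _ => h a]

end CKFamily

/-! ### The reduction theorem. -/

section NoExit

variable {F : Type u} [Quiver.{v} F]

/-- A vertex through which there passes a closed path without exits. -/
def IsNoExit (a : F) : Prop :=
  ∃ l : List (Quiver.Total F), l ≠ [] ∧ IsWalk a l a ∧ ¬ HasExit l

end NoExit

namespace CKFamily

set_option linter.unusedSectionVars false

variable {K : Type w} [Field K] {F : Type u} [Quiver.{v} F] {A : Type*}
    [NonUnitalRing A] [Module K A] [IsScalarTower K A A] [SMulCommClass K A A]
    (Φ : CKFamily K F A)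

/-- The span of the paths of length at most `N` which end at `b` and whose edges satisfy `Q`. -/
def realSpan (Q : Quiver.Total F → Prop) (N : ℕ) (b : F) : Submodule K A :=
  Submodule.span K {x | ∃ (a : F) (α : List (Quiver.Total F)), IsWalk a α b ∧ α.length ≤ N ∧
    (∀ e ∈ α, Q e) ∧ x = Φ.real α b}

/-- The span of the `α β*` with `β` of length at most `N` and starting at `b`. -/
def ghostSpan (N : ℕ) (b : F) : Submodule K A :=
  Submodule.span K {x | ∃ (a c : F) (α β : List (Quiver.Total F)), IsWalk a α c ∧ IsWalk b β c ∧
    β.length ≤ N ∧ x = Φ.real α c * Φ.ghost β c}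

theorem realSpan_mono {Q Q' : Quiver.Total F → Prop} (h : ∀ e, Q e → Q' e) {N N' : ℕ}
    (hN : N ≤ N') (b : F) : Φ.realSpan Q N b ≤ Φ.realSpan Q' N' b := by
  refine Submodule.span_mono ?_
  rintro _ ⟨a, α, hα, hN', hQ, rfl⟩
  exact ⟨a, α, hα, hN'.trans hN, fun e he => h e (hQ e he), rfl⟩

/-- The relations `e* f = 0` for `e ≠ f` and `e* e = r(e)` make `e*` read off the coefficient at
`e`. -/
theorem t_mul_sum {g : Quiver.Total F →₀ A} (hg : ∀ e, Φ.p e.right * g e = g e)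
    (e : Quiver.Total F) : Φ.t e * g.sum (fun e y => Φ.s e * y) = g e := by
  rw [Finsupp.sum, Finset.mul_sum, Finset.sum_eq_single e]
  · rw [← mul_assoc, t_mul_s_self, hg]
  · intro f _ hf
    rw [← mul_assoc, Φ.t_mul_s_of_ne _ _ hf.symm, zero_mul]
  · intro he
    rw [Finsupp.notMem_support_iff.1 he, mul_zero, mul_zero]

theorem sum_mul_s {g : Quiver.Total F →₀ A} (hg : ∀ e, g e * Φ.p e.right = g e)
    (e : Quiver.Total F) : g.sum (fun e y => y * Φ.t e) * Φ.s e = g e := by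
  rw [Finsupp.sum, Finset.sum_mul, Finset.sum_eq_single e]
  · rw [mul_assoc, t_mul_s_self, hg]
  · intro f _ hf
    rw [mul_assoc, Φ.t_mul_s_of_ne _ _ hf, mul_zero]
  · intro he
    rw [Finsupp.notMem_support_iff.1 he, zero_mul, zero_mul]

/-- Sorts paths by their first edge, the trivial path giving the scalar. The truncated `N - 1` is
harmless at `N = 0`, where `g = 0`. -/
theorem exists_eq_smul_add_sum {Q : Quiver.Total F → Prop} {N : ℕ} {b : F} {z : A}
    (hz : z ∈ Φ.realSpan Q N b) : ∃ (k : K) (g : Quiver.Total F →₀ A),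
      (∀ e, g e ∈ Φ.realSpan Q (N - 1) b) ∧ (∀ e, Φ.p e.right * g e = g e) ∧
      (∀ e, g e ≠ 0 → Q e) ∧ (N = 0 → g = 0) ∧
      z = k • Φ.p b + g.sum fun e y => Φ.s e * y := by
  classical
  induction hz using Submodule.span_induction with
  | mem z hz =>
    obtain ⟨a, α, hα, hN, hQ, rfl⟩ := hz
    cases α with
    | nil => exact ⟨1, 0, by simp, by simp, by simp, by simp, by simp⟩
    | cons f α =>
      refine ⟨0, Finsupp.single f (Φ.real α b), fun e => ?_, fun e => ?_, fun e he => ?_, ?_, ?_⟩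
      · rw [Finsupp.single_apply]
        split_ifs with h
        · refine Submodule.subset_span ⟨f.right, α, hα.2, ?_, fun e he => hQ e (by simp [he]), rfl⟩
          simp only [List.length_cons] at hN
          omega
        · exact zero_mem _
      · rw [Finsupp.single_apply]
        split_ifs with h
        · rw [← h, Φ.p_mul_real hα.2]
        · simp
      · obtain rfl : f = e := by
          by_contra h
          simp [h] at he
        exact hQ f (by simp)
      · intro h
        simp [h] at hN
      · rw [zero_smul, zero_add, Finsupp.sum_single_index (mul_zero _), real_cons]
  | zero => exact ⟨0, 0, by simp, by simp, by simp, by simp, by simp⟩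
  | add x y _ _ hx hy =>
    obtain ⟨k, g, h1, h2, h3, h4, rfl⟩ := hx
    obtain ⟨k', g', h1', h2', h3', h4', rfl⟩ := hy
    refine ⟨k + k', g + g', fun e => add_mem (h1 e) (h1' e), fun e => ?_, fun e he => ?_,
      fun h => by simp [h4 h, h4' h], ?_⟩
    · rw [Finsupp.add_apply, mul_add, h2, h2']
    · by_cases hg : g e = 0
      · exact h3' e fun h => he (by simp [h, hg])
      · exact h3 e hg
    · rw [Finsupp.sum_add_index' (by simp) (by simp [mul_add]), add_smul]
      abel
  | smul c x _ hx =>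
    obtain ⟨k, g, h1, h2, h3, h4, rfl⟩ := hx
    refine ⟨c * k, c • g, fun e => Submodule.smul_mem _ _ (h1 e), fun e => ?_, fun e he => ?_,
      fun h => by simp [h4 h], ?_⟩
    · rw [Finsupp.smul_apply, mul_smul_comm, h2]
    · exact h3 e fun h => he (by simp [h])
    · rw [Finsupp.sum_smul_index' (by simp), smul_add, mul_smul, Finsupp.smul_sum]
      simp only [mul_smul_comm]

/-- No path in `z` starts with `f`, so applying `f*` to `z f = 0` isolates the scalar, which must
vanish. Applying `e*` then gives `g e * f = 0` with shorter paths, and induction applies. -/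
theorem eq_zero_of_mul_s_eq_zero (hp : ∀ a, Φ.p a ≠ 0) {f : Quiver.Total F} {N : ℕ} {z : A}
    (hz : z ∈ Φ.realSpan (· ≠ f) N f.left) (h : z * Φ.s f = 0) : z = 0 := by
  induction N generalizing z with
  | zero =>
    obtain ⟨k, g, -, -, -, hg, rfl⟩ := Φ.exists_eq_smul_add_sum hz
    obtain rfl := hg rfl
    have h' : Φ.t f * ((k • Φ.p f.left + 0) * Φ.s f) = 0 := by
      simpa using congrArg (Φ.t f * ·) h
    rw [add_zero, smul_mul_assoc, Φ.p_mul_s, mul_smul_comm, Φ.t_mul_s_self] at h'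
    rcases smul_eq_zero.1 h' with rfl | h'
    · simp
    · exact (hp _ h').elim
  | succ N ih =>
    obtain ⟨k, g, hN, hpg, hQ, -, rfl⟩ := Φ.exists_eq_smul_add_sum hz
    have key : ∀ e, Φ.t e * (k • Φ.p f.left * Φ.s f) + g e * Φ.s f = 0 := by
      intro e
      rw [← Φ.t_mul_sum hpg e, mul_assoc, ← mul_add, ← add_mul, h, mul_zero]
    have hgf : g f = 0 := by
      by_contra h'
      exact hQ f h' rfl
    have h' := key f
    rw [hgf, zero_mul, add_zero, smul_mul_assoc, Φ.p_mul_s, mul_smul_comm, Φ.t_mul_s_self] at h'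
    rcases smul_eq_zero.1 h' with rfl | h'
    · have : g = 0 := by
        ext e
        refine ih (hN e) ?_
        simpa using key e
      simp [this]
    · exact (hp _ h').elim

/-- Splits off the rightmost ghost factor. The ghost-free part `z` involves only finitely many edges
`T`, so that an infinite emitter has an edge outside `T`. -/
theorem exists_eq_add_sum {N : ℕ} {b : F} {x : A} (hx : x ∈ Φ.ghostSpan N b) :
    ∃ (z : A) (g : Quiver.Total F →₀ A), (∃ (M : ℕ) (T : Finset (Quiver.Total F)),
      z ∈ Φ.realSpan (· ∈ T) M b) ∧ (∀ e, g e ≠ 0 → e.left = b) ∧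
      (∀ e, g e * Φ.p e.right = g e) ∧ (N = 0 → g = 0) ∧
      x = z + g.sum fun e y => y * Φ.t e := by
  classical
  induction hx using Submodule.span_induction with
  | mem z hz =>
    obtain ⟨a, c, α, β, hα, hβ, hN, rfl⟩ := hz
    cases β with
    | nil =>
      obtain rfl := hβ
      exact ⟨Φ.real α b, 0, ⟨α.length, α.toFinset, Submodule.subset_span
        ⟨a, α, hα, le_rfl, by simp, rfl⟩⟩, by simp, by simp, by simp, by simp [real_mul_p]⟩
    | cons f β =>
      refine ⟨0, Finsupp.single f (Φ.real α c * Φ.ghost β c), ⟨0, ∅, zero_mem _⟩, fun e he => ?_,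
        fun e => ?_, fun h => by simp [h] at hN, ?_⟩
      · obtain rfl : f = e := by
          by_contra h
          simp [h] at he
        exact hβ.1
      · rw [Finsupp.single_apply]
        split_ifs with h
        · rw [← h, mul_assoc, Φ.ghost_mul_p hβ.2]
        · simp
      · rw [zero_add, Finsupp.sum_single_index (zero_mul _), ghost_cons, mul_assoc]
  | zero => exact ⟨0, 0, ⟨0, ∅, zero_mem _⟩, by simp, by simp, by simp, by simp⟩
  | add x y _ _ hx hy =>
    obtain ⟨z, g, ⟨M, T, h1⟩, h2, h3, h4, rfl⟩ := hx
    obtain ⟨z', g', ⟨M', T', h1'⟩, h2', h3', h4', rfl⟩ := hy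
    refine ⟨z + z', g + g', ⟨max M M', T ∪ T', add_mem ?_ ?_⟩, fun e he => ?_, fun e => ?_,
      fun h => by simp [h4 h, h4' h], ?_⟩
    · exact Φ.realSpan_mono (fun e he => Finset.mem_union_left _ he) (le_max_left _ _) b h1
    · exact Φ.realSpan_mono (fun e he => Finset.mem_union_right _ he) (le_max_right _ _) b h1'
    · by_cases hg : g e = 0
      · exact h2' e fun h => he (by simp [h, hg])
      · exact h2 e hg
    · rw [Finsupp.add_apply, add_mul, h3, h3']
    · rw [Finsupp.sum_add_index' (by simp) (by simp [add_mul])]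
      abel
  | smul c x _ hx =>
    obtain ⟨z, g, ⟨M, T, h1⟩, h2, h3, h4, rfl⟩ := hx
    refine ⟨c • z, c • g, ⟨M, T, Submodule.smul_mem _ _ h1⟩,
      fun e he => h2 e fun h => he (by simp [h]), fun e => ?_,
      fun h => by simp [h4 h], ?_⟩
    · rw [Finsupp.smul_apply, smul_mul_assoc, h3]
    · rw [Finsupp.sum_smul_index' (by simp), smul_add, Finsupp.smul_sum]
      simp only [smul_mul_assoc]

theorem mul_p_eq_zero_of_isRegular {a : F} (ha : IsRegular a) {x : A}
    (h : ∀ e : Quiver.Total F, e.left = a → x * Φ.s e = 0) : x * Φ.p a = 0 := by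
  have : Finite (Quiver.Star a) := ha.2
  cases nonempty_fintype (Quiver.Star a)
  rw [← Φ.finsum_s_mul_t a ha, finsum_eq_sum_of_fintype, Finset.mul_sum]
  refine Finset.sum_eq_zero fun e _ => ?_
  rw [← mul_assoc, h _ rfl, zero_mul]

theorem mul_s_mem_ghostSpan {N : ℕ} {x : A} {e : Quiver.Total F}
    (hx : x ∈ Φ.ghostSpan (N + 1) e.left) : x * Φ.s e ∈ Φ.ghostSpan N e.right := by
  refine mul_mem_of_mem_span' ?_ hx
  rintro _ ⟨a, c, α, β, hα, hβ, hN, rfl⟩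
  cases β with
  | nil =>
    obtain rfl := hβ
    rw [ghost_nil, real_mul_p, real_mul_s, ← real_mul_p, ← ghost_nil]
    exact Submodule.subset_span ⟨a, _, _, [], hα.append (isWalk_singleton e), rfl, by simp, rfl⟩
  | cons f β =>
    rw [mul_assoc]
    by_cases h : f = e
    · subst h
      rw [Φ.ghost_cons_mul_s_self hβ]
      refine Submodule.subset_span ⟨a, _, _, _, hα, hβ.2, ?_, rfl⟩
      simpa using hN
    · rw [Φ.ghost_cons_mul_s_of_ne h, mul_zero]
      exact zero_mem _

theorem mul_p_of_mem_ghostSpan {N : ℕ} {b : F} {x : A} (hx : x ∈ Φ.ghostSpan N b) :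
    x * Φ.p b = x := by
  induction hx using Submodule.span_induction with
  | mem x hx =>
    obtain ⟨a, c, α, β, hα, hβ, -, rfl⟩ := hx
    rw [mul_assoc, Φ.ghost_mul_p hβ]
  | zero => simp
  | add x y _ _ hx hy => rw [add_mul, hx, hy]
  | smul k x _ hx => rw [smul_mul_assoc, hx]

/-- Right multiplication by an edge shortens the ghost parts. The induction can only get stuck when
every `x e` vanishes, which is possible with `x ≠ 0` only at a sink, where there is no ghost part.
-/
theorem exists_mul_mem_realSpan (hp : ∀ a, Φ.p a ≠ 0) {N : ℕ} {b : F} {x : A}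
    (hx : x ∈ Φ.ghostSpan N b) (h0 : x ≠ 0) : ∃ (n : ℤ) (y : A) (c : F) (M : ℕ)
      (T : Finset (Quiver.Total F)), y ∈ Φ.deg n ∧ x * y ≠ 0 ∧
        x * y ∈ Φ.realSpan (· ∈ T) M c := by
  classical
  induction N generalizing b x with
  | zero =>
    obtain ⟨z, g, ⟨M, T, hz⟩, -, -, hg, hxz⟩ := Φ.exists_eq_add_sum hx
    obtain rfl := hg rfl
    rw [Finsupp.sum_zero_index, add_zero] at hxz
    refine ⟨0, Φ.p b, b, M, T, Φ.p_mem_deg b, ?_⟩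
    rw [Φ.mul_p_of_mem_ghostSpan hx]
    exact ⟨h0, hxz ▸ hz⟩
  | succ N ih =>
    by_cases hs : ∃ e : Quiver.Total F, e.left = b ∧ x * Φ.s e ≠ 0
    · obtain ⟨e, rfl, he⟩ := hs
      obtain ⟨n, y, c, M, T, hy, hxy, hM⟩ := ih (Φ.mul_s_mem_ghostSpan hx) he
      exact ⟨1 + n, Φ.s e * y, c, M, T, Φ.s_mul_mem_deg e hy, by rwa [← mul_assoc],
        by rwa [← mul_assoc]⟩
    -- Now all `x e` vanish, so the second Cuntz–Krieger relation rules out that `b` is regular.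
    push Not at hs
    have hreg : ¬ IsRegular b := fun hb => h0 <| by
      rw [← Φ.mul_p_of_mem_ghostSpan hx, Φ.mul_p_eq_zero_of_isRegular hb hs]
    obtain ⟨z, g, ⟨M, T, hz⟩, hg, hgp, -, hxz⟩ := Φ.exists_eq_add_sum hx
    have hxs : ∀ e, x * Φ.s e = z * Φ.s e + g e := fun e => by
      rw [hxz, add_mul, Φ.sum_mul_s hgp]
    by_cases hb : Nonempty (Quiver.Star b)
    · have : Infinite (Quiver.Star b) := not_finite_iff_infinite.1 fun h => hreg ⟨hb, h⟩
      have hinj : Function.Injective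
          fun e : Quiver.Star b => (⟨b, e.1, e.2⟩ : Quiver.Total F) := by
        rintro ⟨c, e⟩ ⟨c', e'⟩ h
        simpa using h
      -- At an infinite emitter, an edge `f` avoiding `T` and the ghost part gives `z f = 0`, hence
      -- `z = 0`; then every `g e = x e` vanishes as well.
      obtain ⟨_, ⟨f, rfl⟩, hf⟩ :=
        (Set.infinite_range_of_injective hinj).exists_notMem_finset (T ∪ g.support)
      simp only [Finset.mem_union, not_or, Finsupp.mem_support_iff, not_not] at hf
      have hzf := hxs ⟨b, f.1, f.2⟩
      rw [hs _ rfl, hf.2, add_zero] at hzf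
      have hz' : z ∈ Φ.realSpan (· ≠ (⟨b, f.1, f.2⟩ : Quiver.Total F)) M b :=
        Φ.realSpan_mono (fun e he => ne_of_mem_of_not_mem he hf.1) le_rfl _ hz
      have hz0 : z = 0 := Φ.eq_zero_of_mul_s_eq_zero hp hz' hzf.symm
      subst hz0
      have hg0 : g = 0 := by
        ext e
        by_contra h
        exact h (by simpa [hs e (hg e h)] using (hxs e).symm)
      exact (h0 (by simp [hxz, hg0])).elim
    · have hg0 : g = 0 := by
        ext e
        by_contra h
        obtain rfl := hg e h
        exact hb ⟨⟨e.right, e.hom⟩⟩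
      refine ⟨0, Φ.p b, b, M, T, Φ.p_mem_deg b, ?_⟩
      rw [Φ.mul_p_of_mem_ghostSpan hx]
      exact ⟨h0, by simpa [hxz, hg0] using hz⟩

end CKFamily

namespace CKFamily

set_option linter.unusedSectionVars false

variable {K : Type w} [Field K] {F : Type u} [Quiver.{v} F] {A : Type*}
    [NonUnitalRing A] [Module K A] [IsScalarTower K A A] [SMulCommClass K A A]
    (Φ : CKFamily K F A)

/-- The linear combination of paths ending at `b` which is given by a list of pairs. -/
def lincomb (b : F) (l : List (K × List (Quiver.Total F))) : A :=
  (l.map fun q => q.1 • Φ.real q.2 b).sum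

theorem lincomb_nil (b : F) : Φ.lincomb b [] = 0 := rfl

theorem lincomb_cons (b : F) (q : K × List (Quiver.Total F))
    (l : List (K × List (Quiver.Total F))) :
    Φ.lincomb b (q :: l) = q.1 • Φ.real q.2 b + Φ.lincomb b l := by
  simp [lincomb]

theorem lincomb_append (b : F) (l l' : List (K × List (Quiver.Total F))) :
    Φ.lincomb b (l ++ l') = Φ.lincomb b l + Φ.lincomb b l' := by
  simp [lincomb]

theorem exists_lincomb {P : List (Quiver.Total F) → Prop} {b : F} {x : A}
    (hx : x ∈ Submodule.span K {x | ∃ α, P α ∧ x = Φ.real α b}) :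
    ∃ l : List (K × List (Quiver.Total F)), (∀ q ∈ l, P q.2) ∧ x = Φ.lincomb b l := by
  induction hx using Submodule.span_induction with
  | mem x hx =>
    obtain ⟨α, hα, rfl⟩ := hx
    exact ⟨[(1, α)], by simpa using hα, by simp [lincomb]⟩
  | zero => exact ⟨[], by simp, rfl⟩
  | add x y _ _ hx hy =>
    obtain ⟨l, hl, rfl⟩ := hx
    obtain ⟨l', hl', rfl⟩ := hy
    refine ⟨l ++ l', fun q hq => ?_, by rw [lincomb_append]⟩
    exact (List.mem_append.1 hq).elim (hl q) (hl' q)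
  | smul k x _ hx =>
    obtain ⟨l, hl, rfl⟩ := hx
    refine ⟨l.map fun q => (k * q.1, q.2), ?_, ?_⟩
    · intro q hq
      obtain ⟨q', hq', rfl⟩ := List.mem_map.1 hq
      exact hl q' hq'
    · simp [lincomb, List.smul_sum, mul_smul, Function.comp_def]

open Classical in
/-- Multiply a linear combination of closed paths by `e*` on the left and by `e` on the right. -/
def rotate (e : Quiver.Total F) (l : List (K × List (Quiver.Total F))) :
    List (K × List (Quiver.Total F)) :=
  l.filterMap fun q => if q.2.head? = some e then some (q.1, q.2.tail ++ [e]) else none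

theorem mem_rotate {e : Quiver.Total F} {l : List (K × List (Quiver.Total F))}
    {q : K × List (Quiver.Total F)} :
    q ∈ rotate e l ↔ ∃ α, (q.1, e :: α) ∈ l ∧ q.2 = α ++ [e] := by
  classical
  simp only [rotate, List.mem_filterMap]
  constructor
  · rintro ⟨⟨k, α⟩, hα, h⟩
    split_ifs at h with he
    cases α with
    | nil => simp at he
    | cons f α =>
      obtain rfl : f = e := by simpa using he
      obtain rfl := (Option.some.inj h).symm
      exact ⟨α, hα, rfl⟩
  · rintro ⟨α, hα, hq⟩
    exact ⟨_, hα, by simp [← hq]⟩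

theorem length_rotate_le (e : Quiver.Total F) (l : List (K × List (Quiver.Total F))) :
    (rotate e l).length ≤ l.length := List.length_filterMap_le _ _

/-- A term beginning with `f ≠ e` is killed by `e*`; this loss drives the induction in
`exists_ghost_mul_mul_real`. -/
theorem length_rotate_lt {e f : Quiver.Total F} {l : List (K × List (Quiver.Total F))}
    {k : K} {α : List (Quiver.Total F)} (h : (k, f :: α) ∈ l) (hf : f ≠ e) :
    (rotate e l).length < l.length := by
  classical
  induction l with
  | nil => simp at h
  | cons q l ih =>
    rcases List.mem_cons.1 h with rfl | h
    · rw [rotate, List.filterMap_cons_none (by simp [hf])]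
      exact Nat.lt_succ_of_le (length_rotate_le e l)
    · have := ih h
      simp only [rotate, List.filterMap_cons] at this ⊢
      split <;> simp only [List.length_cons] <;> omega

theorem t_mul_lincomb_mul_s {e : Quiver.Total F} {l : List (K × List (Quiver.Total F))}
    (hl : ∀ q ∈ l, q.2 ≠ [] ∧ IsWalk e.left q.2 e.left) :
    Φ.t e * Φ.lincomb e.left l * Φ.s e = Φ.lincomb e.right (rotate e l) := by
  classical
  induction l with
  | nil => simp [lincomb_nil, rotate]
  | cons q l ih =>
    have ih' := ih fun q hq => hl q (List.mem_cons_of_mem _ hq)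
    obtain ⟨k, α⟩ := q
    obtain ⟨hα0, hα⟩ := hl (k, α) (by simp)
    rw [lincomb_cons, mul_add, add_mul, ih', mul_smul_comm, smul_mul_assoc]
    obtain ⟨f, α, rfl⟩ := List.exists_cons_of_ne_nil hα0
    by_cases h : e = f
    · subst h
      rw [Φ.t_mul_real_cons_self hα, real_mul_s]
      conv_rhs => rw [rotate, List.filterMap_cons_some (by simp; rfl)]
      rw [lincomb_cons]
      rfl
    · rw [Φ.t_mul_real_cons_of_ne h, zero_mul, smul_zero, zero_add]
      conv_rhs => rw [rotate, List.filterMap_cons_none (by simp [Ne.symm h])]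
      rfl

/-- Conjugation `e* (·) e` carries the scalar term to `r(e)`, rotates closed paths beginning with
`e` and kills the other ones. Rotating along a marked path up to its exit `f` and conjugating by `f`
kills that path, while no new terms appear. The hypothesis `hα` marks one term and the segment `α₁`
before its exit. -/
theorem exists_ghost_mul_mul_real (n : ℕ) (α₁ : List (Quiver.Total F)) (k : K) (b : F)
    (l : List (K × List (Quiver.Total F))) (hln : l.length ≤ n)
    (hl : ∀ q ∈ l, q.2 ≠ [] ∧ IsWalk b q.2 b ∧ HasExit q.2)
    (hα : l ≠ [] → ∃ k' e α₂ f, (k', α₁ ++ e :: α₂) ∈ l ∧ f.left = e.left ∧ f ≠ e) :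
    ∃ (i j : ℤ) (x y : A) (c : F), x ∈ Φ.deg i ∧ y ∈ Φ.deg j ∧
      x * (k • Φ.p b + Φ.lincomb b l) * y = k • Φ.p c := by
  have step : ∀ (b : F) (l : List (K × List (Quiver.Total F))) (e : Quiver.Total F), e.left = b →
      (∀ q ∈ l, q.2 ≠ [] ∧ IsWalk b q.2 b ∧ HasExit q.2) →
      (∀ q ∈ rotate e l, q.2 ≠ [] ∧ IsWalk e.right q.2 e.right ∧ HasExit q.2) ∧
      ((∃ (i j : ℤ) (x y : A) (c : F), x ∈ Φ.deg i ∧ y ∈ Φ.deg j ∧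
        x * (k • Φ.p e.right + Φ.lincomb e.right (rotate e l)) * y = k • Φ.p c) →
       (∃ (i j : ℤ) (x y : A) (c : F), x ∈ Φ.deg i ∧ y ∈ Φ.deg j ∧
        x * (k • Φ.p b + Φ.lincomb b l) * y = k • Φ.p c)) := by
    rintro b l e rfl hl
    refine ⟨fun q hq => ?_, ?_⟩
    · obtain ⟨α, hα, hq⟩ := mem_rotate.1 hq
      obtain ⟨-, ⟨-, h1⟩, h2⟩ := hl _ hα
      rw [hq]
      refine ⟨by simp, h1.append (isWalk_singleton e), ?_⟩
      obtain ⟨f, g, hg, hf⟩ := h2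
      exact ⟨f, g, by simp only [List.mem_cons, List.mem_append] at hg ⊢; tauto, hf⟩
    · rintro ⟨i, j, x, y, c, hx, hy, h⟩
      refine ⟨_, _, x * Φ.t e, Φ.s e * y, c, Φ.mul_mem_deg hx (Φ.t_mem_deg e),
        Φ.mul_mem_deg (Φ.s_mem_deg e) hy, ?_⟩
      rw [← h, ← Φ.t_mul_lincomb_mul_s fun q hq => ⟨(hl q hq).1, (hl q hq).2.1⟩]
      have : Φ.t e * (k • Φ.p e.left) * Φ.s e = k • Φ.p e.right := by
        rw [mul_smul_comm, smul_mul_assoc, Φ.t_mul_p, Φ.t_mul_s_self]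
      rw [← this]
      simp only [mul_add, add_mul, mul_assoc]
  have base : ∀ b : F, ∃ (i j : ℤ) (x y : A) (c : F), x ∈ Φ.deg i ∧ y ∈ Φ.deg j ∧
      x * (k • Φ.p b + Φ.lincomb b []) * y = k • Φ.p c := fun b =>
    ⟨0, 0, Φ.p b, Φ.p b, b, Φ.p_mem_deg b, Φ.p_mem_deg b, by
      rw [lincomb_nil, add_zero, mul_smul_comm, smul_mul_assoc, Φ.p_mul_self, Φ.p_mul_self]⟩
  induction n generalizing b l α₁ with
  | zero =>
    obtain rfl : l = [] := List.length_eq_zero_iff.1 (by omega)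
    exact base b
  | succ n ih =>
    by_cases hl0 : l = []
    · subst hl0; exact base b
    obtain ⟨k', e, α₂, f, hmem, hfl, hfe⟩ := hα hl0
    -- With fewer terms the outer induction applies, since any remaining term provides a new exit to
    -- mark.
    have drop : ∀ (b : F) (l : List (K × List (Quiver.Total F))), l.length ≤ n →
        (∀ q ∈ l, q.2 ≠ [] ∧ IsWalk b q.2 b ∧ HasExit q.2) →
        ∃ (i j : ℤ) (x y : A) (c : F), x ∈ Φ.deg i ∧ y ∈ Φ.deg j ∧
          x * (k • Φ.p b + Φ.lincomb b l) * y = k • Φ.p c := by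
      intro b l hn hl
      rcases l with _ | ⟨⟨k', α⟩, l⟩
      · exact base b
      · obtain ⟨-, -, f, e, he, hfe⟩ := hl (k', α) (by simp)
        obtain ⟨α₁, α₂, rfl⟩ := List.append_of_mem he
        exact ih α₁ b _ hn hl fun _ => ⟨k', e, α₂, f, by simp, hfe⟩
    clear hl0 hα
    induction α₁ generalizing b l α₂ with
    | nil =>
      -- The exit has been rotated to the base vertex, so conjugation by `f` removes the marked
      -- term.
      have hb : f.left = b := hfl.trans (hl _ hmem).2.1.1
      obtain ⟨h1, h2⟩ := step b l f hb hl
      refine h2 (drop _ _ ?_ h1)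
      have := length_rotate_lt hmem hfe.symm
      omega
    | cons e₀ α₁ ih' =>
      -- Rotation by the first edge shortens the segment before the exit and keeps the marked term.
      obtain ⟨h1, h2⟩ := step b l e₀ (hl _ hmem).2.1.1 hl
      refine h2 (ih' _ _ ((length_rotate_le _ _).trans hln) h1 (α₂ ++ [e₀]) ?_)
      exact mem_rotate.2 ⟨_, hmem, by simp⟩

/-- Strips first edges by left multiplication with ghost edges until a nonzero scalar term becomes
visible at `b`; each stripping lowers the length bound. -/
theorem exists_mul_eq_smul_add_lincomb {Q : Quiver.Total F → Prop} {N : ℕ} {b : F} {y : A}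
    (hy : y ∈ Φ.realSpan Q N b) (h0 : y ≠ 0) : ∃ (n : ℤ) (x : A) (k : K)
      (l : List (K × List (Quiver.Total F))), x ∈ Φ.deg n ∧ k ≠ 0 ∧
      (∀ q ∈ l, q.2 ≠ [] ∧ IsWalk b q.2 b) ∧ x * y = k • Φ.p b + Φ.lincomb b l ∧ x * y ≠ 0 := by
  induction N generalizing y with
  | zero =>
    obtain ⟨k, g, -, -, -, hg, rfl⟩ := Φ.exists_eq_smul_add_sum hy
    obtain rfl := hg rfl
    rw [Finsupp.sum_zero_index, add_zero] at h0 ⊢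
    have : Φ.p b * k • Φ.p b = k • Φ.p b := by rw [mul_smul_comm, Φ.p_mul_self]
    refine ⟨0, Φ.p b, k, [], Φ.p_mem_deg b, fun hk => h0 (by simp [hk]), by simp, ?_, ?_⟩
    · rw [this, lincomb_nil, add_zero]
    · rwa [this]
  | succ N ih =>
    obtain ⟨k, g, hg, hpg, -, -, rfl⟩ := Φ.exists_eq_smul_add_sum hy
    set y := k • Φ.p b + g.sum fun e y => Φ.s e * y with hydef
    obtain ⟨a, ha⟩ : ∃ a, Φ.p a * y ≠ 0 := by
      by_contra! h
      exact h0 (Φ.eq_zero_of_forall_p_mul h)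
    by_cases hab : a = b ∧ k ≠ 0
    · obtain ⟨rfl, hk⟩ := hab
      obtain ⟨l, hl, hl'⟩ := Φ.exists_lincomb (P := fun α => α ≠ [] ∧ IsWalk a α a) (b := a)
        (x := Φ.p a * g.sum fun e y => Φ.s e * y) <| by
          rw [Finsupp.mul_sum]
          refine Submodule.sum_mem _ fun e _ => ?_
          beta_reduce
          rw [← mul_assoc]
          refine mul_mem_of_mem_span ?_ (hg e)
          rintro _ ⟨c, α, hα, -, -, rfl⟩
          rw [mul_assoc]
          by_cases hea : a = e.left
          · rw [← mul_assoc, hea, Φ.p_mul_s]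
            by_cases hec : e.right = c
            · subst hec hea
              exact Submodule.subset_span ⟨e :: α, ⟨by simp, rfl, hα⟩, rfl⟩
            · rw [← hea, ← Φ.s_mul_p, mul_assoc, Φ.p_mul_real_of_ne hα hec, mul_zero]
              exact zero_mem _
          · rw [← mul_assoc, Φ.p_mul_s_of_ne hea, zero_mul]
            exact zero_mem _
      refine ⟨0, Φ.p a, k, l, Φ.p_mem_deg a, hk, hl, ?_, ha⟩
      rw [hydef, mul_add, mul_smul_comm, Φ.p_mul_self, hl']
    -- The scalar term does not contribute at `a`, so some first edge `e` at `a` does, and `e* y = g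
    -- e` is shorter.
    · have hka : Φ.p a * k • Φ.p b = 0 := by
        by_cases h : a = b
        · have : k = 0 := by
            by_contra hk
            exact hab ⟨h, hk⟩
          simp [this]
        · rw [mul_smul_comm, Φ.p_mul_p_of_ne _ _ h, smul_zero]
      obtain ⟨e, rfl, he⟩ : ∃ e : Quiver.Total F, e.left = a ∧ g e ≠ 0 := by
        by_contra! h
        refine ha ?_
        rw [hydef, mul_add, hka, zero_add, Finsupp.mul_sum]
        refine Finset.sum_eq_zero fun e _ => ?_
        by_cases hea : e.left = a
        · simp [h e hea]
        · beta_reduce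
          rw [← mul_assoc, Φ.p_mul_s_of_ne (Ne.symm hea), zero_mul]
      obtain ⟨n, x, k', l, hx, hk', hl, hxy, hxy0⟩ := ih (hg e) he
      have hty : Φ.t e * y = g e := by
        rw [hydef, mul_add, Φ.t_mul_sum hpg, ← Φ.t_mul_p, mul_assoc, hka, mul_zero, zero_add]
      refine ⟨_, x * Φ.t e, k', l, Φ.mul_mem_deg hx (Φ.t_mem_deg e), hk', hl, ?_⟩
      rw [mul_assoc, hty]
      exact ⟨hxy, hxy0⟩

theorem mul_p_of_mem_realSpan {Q : Quiver.Total F → Prop} {N : ℕ} {b : F} {x : A}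
    (hx : x ∈ Φ.realSpan Q N b) : x * Φ.p b = x := by
  induction hx using Submodule.span_induction with
  | mem x hx =>
    obtain ⟨a, α, -, -, -, rfl⟩ := hx
    exact Φ.real_mul_p α b
  | zero => simp
  | add x y _ _ hx hy => rw [add_mul, hx, hy]
  | smul k x _ hx => rw [smul_mul_assoc, hx]

theorem p_mul_lincomb {b : F} {l : List (K × List (Quiver.Total F))}
    (hl : ∀ q ∈ l, IsWalk b q.2 b) : Φ.p b * Φ.lincomb b l = Φ.lincomb b l := by
  induction l with
  | nil => simp [lincomb_nil]
  | cons q l ih =>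
    rw [lincomb_cons, mul_add, ih fun q hq => hl q (List.mem_cons_of_mem _ hq), mul_smul_comm,
      Φ.p_mul_real (hl q (by simp))]

theorem exists_mem_ghostSpan (x : A) (b : F) : ∃ N, x * Φ.p b ∈ Φ.ghostSpan N b := by
  have mono : ∀ {N N' : ℕ}, N ≤ N' → Φ.ghostSpan N b ≤ Φ.ghostSpan N' b := by
    intro N N' h
    refine Submodule.span_mono ?_
    rintro _ ⟨a, c, α, β, hα, hβ, hN, rfl⟩
    exact ⟨a, c, α, β, hα, hβ, hN.trans h, rfl⟩
  induction Φ.mem_span_monomials x using Submodule.span_induction with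
  | mem y hy =>
    obtain ⟨a, b', c, α, β, hα, hβ, rfl⟩ := hy
    by_cases h : b' = b
    · subst h
      rw [mul_assoc, Φ.ghost_mul_p hβ]
      exact ⟨β.length, Submodule.subset_span ⟨a, c, α, β, hα, hβ, le_rfl, rfl⟩⟩
    · rw [mul_assoc, Φ.ghost_mul_p_of_ne hβ h, mul_zero]
      exact ⟨0, zero_mem _⟩
  | zero => exact ⟨0, by simp⟩
  | add x y _ _ hx hy =>
    obtain ⟨N, hN⟩ := hx
    obtain ⟨N', hN'⟩ := hy
    refine ⟨max N N', ?_⟩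
    rw [add_mul]
    exact add_mem (mono (le_max_left _ _) hN) (mono (le_max_right _ _) hN')
  | smul k x _ hx =>
    obtain ⟨N, hN⟩ := hx
    exact ⟨N, by rw [smul_mul_assoc]; exact Submodule.smul_mem _ _ hN⟩

/-- The reduction theorem: every non-zero element can be multiplied on both sides by homogeneous
elements so that the product is a non-zero multiple of a vertex, or a non-zero element of the
corner at a vertex on a closed path without exits. -/
theorem reduction (hp : ∀ a, Φ.p a ≠ 0) {x : A} (hx : x ≠ 0) :
    ∃ (m n : ℤ) (y z : A) (a : F), y ∈ Φ.deg m ∧ z ∈ Φ.deg n ∧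
      ((∃ k : K, k ≠ 0 ∧ y * x * z = k • Φ.p a) ∨
        (IsNoExit a ∧ y * x * z ≠ 0 ∧ Φ.p a * (y * x * z) * Φ.p a = y * x * z)) := by
  obtain ⟨b, hb⟩ : ∃ b, x * Φ.p b ≠ 0 := by
    by_contra! h
    exact hx (Φ.eq_zero_of_forall_mul_p h)
  obtain ⟨N, hN⟩ := Φ.exists_mem_ghostSpan x b
  obtain ⟨n, z, c, M, T, hz, hxz, hxz'⟩ := Φ.exists_mul_mem_realSpan hp hN hb
  obtain ⟨m, y, k, l, hy, hk, hl, hyx, hyx0⟩ := Φ.exists_mul_eq_smul_add_lincomb hxz' hxz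
  by_cases hc : IsNoExit c
  · refine ⟨m, 0 + n, y, Φ.p b * z, c, hy, Φ.mul_mem_deg (Φ.p_mem_deg b) hz, Or.inr ⟨hc, ?_, ?_⟩⟩
    · simpa only [mul_assoc] using hyx0
    · have h1 : Φ.p c * (y * (x * Φ.p b * z)) = y * (x * Φ.p b * z) := by
        rw [hyx, mul_add, mul_smul_comm, Φ.p_mul_self, Φ.p_mul_lincomb fun q hq => (hl q hq).2]
      have h2 := Φ.mul_p_of_mem_realSpan hxz'
      have h3 : y * x * (Φ.p b * z) = y * (x * Φ.p b * z) := by simp only [mul_assoc]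
      rw [h3, h1, mul_assoc, h2]
  -- When `c` is on no closed path without exits, all the closed paths in `l` have exits and can be
  -- removed.
  · have hl' : ∀ q ∈ l, q.2 ≠ [] ∧ IsWalk c q.2 c ∧ HasExit q.2 := fun q hq => by
      refine ⟨(hl q hq).1, (hl q hq).2, ?_⟩
      by_contra h
      exact hc ⟨q.2, (hl q hq).1, (hl q hq).2, h⟩
    obtain ⟨i, j, u, v, d, hu, hv, huv⟩ : ∃ (i j : ℤ) (x y : A) (d : F), x ∈ Φ.deg i ∧
        y ∈ Φ.deg j ∧ x * (k • Φ.p c + Φ.lincomb c l) * y = k • Φ.p d := by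
      rcases l with _ | ⟨⟨k', α⟩, l⟩
      · exact Φ.exists_ghost_mul_mul_real 0 [] k c [] (by simp) (by simp) (by simp)
      · obtain ⟨-, -, f, e, he, hfe⟩ := hl' (k', α) (by simp)
        obtain ⟨α₁, α₂, rfl⟩ := List.append_of_mem he
        exact Φ.exists_ghost_mul_mul_real _ α₁ k c _ le_rfl hl'
          fun _ => ⟨k', e, α₂, f, by simp, hfe⟩
    refine ⟨i + m, 0 + n + j, u * y, Φ.p b * z * v, d, Φ.mul_mem_deg hu hy,
      Φ.mul_mem_deg (Φ.mul_mem_deg (Φ.p_mem_deg b) hz) hv, Or.inl ⟨k, hk, ?_⟩⟩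
    rw [← huv, ← hyx]
    simp only [mul_assoc]

end CKFamily

/-! ### Combinatorics of closed paths without exits. -/

section NoExit

variable {F : Type u} [Quiver.{v} F]

theorem not_hasExit_iff {l : List (Quiver.Total F)} :
    ¬ HasExit l ↔ ∀ e ∈ l, ∀ f : Quiver.Total F, f.left = e.left → f = e := by
  unfold HasExit
  push Not
  exact ⟨fun h e he f hf => h f e he hf, fun h f e he hf => h e he f hf⟩

/-- Along a path without exits each next edge is forced. -/
theorem IsWalk.prefix_of_not_hasExit {a b c : F} {l l' : List (Quiver.Total F)}
    (h : IsWalk a l b) (h' : IsWalk a l' c) (hl' : ¬ HasExit l') (hle : l.length ≤ l'.length) :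
    l <+: l' := by
  rw [not_hasExit_iff] at hl'
  induction l generalizing a l' with
  | nil => exact List.nil_prefix
  | cons e l ih =>
    cases l' with
    | nil => simp at hle
    | cons f l' =>
      obtain rfl : e = f := hl' f (by simp) e (h.1.trans h'.1.symm)
      rw [List.cons_prefix_cons]
      exact ⟨rfl, ih h.2 h'.2 (fun e he => hl' e (by simp [he])) (by simpa using hle)⟩

/-- The `n`-fold concatenation of a list with itself. -/
def listPow {X : Type*} (l : List X) (n : ℕ) : List X := (List.replicate n l).flatten

theorem listPow_zero {X : Type*} (l : List X) : listPow l 0 = [] := rfl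

theorem listPow_succ {X : Type*} (l : List X) (n : ℕ) :
    listPow l (n + 1) = l ++ listPow l n := by
  simp [listPow, List.replicate_succ]

theorem listPow_add {X : Type*} (l : List X) (m n : ℕ) :
    listPow l (m + n) = listPow l m ++ listPow l n := by
  rw [listPow, List.replicate_add, List.flatten_append, listPow, listPow]

theorem le_length_listPow {X : Type*} {l : List X} (hl : l ≠ []) (n : ℕ) :
    n ≤ (listPow l n).length := by
  rw [listPow, List.length_flatten, List.map_replicate, List.sum_replicate, smul_eq_mul]
  exact Nat.le_mul_of_pos_right _ (List.length_pos_iff.2 hl)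

theorem mem_of_mem_listPow {X : Type*} {l : List X} {n : ℕ} {x : X} (h : x ∈ listPow l n) :
    x ∈ l := by
  simp only [listPow, List.mem_flatten, List.mem_replicate] at h
  obtain ⟨_, ⟨-, rfl⟩, h⟩ := h
  exact h

theorem IsWalk.listPow {a : F} {l : List (Quiver.Total F)} (h : IsWalk a l a) (n : ℕ) :
    IsWalk a (listPow l n) a := by
  induction n with
  | zero => rfl
  | succ n ih => rw [listPow_succ]; exact h.append ih

theorem IsWalk.prefix_listPow {a b : F} {l l' : List (Quiver.Total F)} (h : IsWalk a l b)
    (h' : IsWalk a l' a) (hl' : l' ≠ []) (hex : ¬ HasExit l') :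
    l <+: LPA.listPow l' l.length := by
  refine h.prefix_of_not_hasExit (h'.listPow _) ?_ (le_length_listPow hl' _)
  rw [not_hasExit_iff] at hex ⊢
  exact fun e he => hex e (mem_of_mem_listPow he)

/-- Every path from `a` is an initial segment of a power of the closed path without exits at `a`. -/
theorem IsNoExit.not_hasExit {a b : F} (ha : IsNoExit a) {l : List (Quiver.Total F)}
    (h : IsWalk a l b) : ¬ HasExit l := by
  obtain ⟨l', hl', h', hex⟩ := ha
  have := h.prefix_listPow h' hl' hex
  rw [not_hasExit_iff] at hex ⊢
  exact fun e he => hex e (mem_of_mem_listPow (this.subset he))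

theorem IsNoExit.reaches {a b : F} (ha : IsNoExit a) (h : Reaches a b) : Reaches b a := by
  obtain ⟨l', hl', h', hex⟩ := ha
  obtain ⟨l, hl⟩ := h.exists_isWalk
  obtain ⟨l'', h''⟩ := hl.prefix_listPow h' hl' hex
  have := h'.listPow l.length
  rw [← h'', isWalk_append] at this
  obtain ⟨c, h1, h2⟩ := this
  obtain rfl := hl.target_unique h1
  exact h2.reaches

theorem IsNoExit.exists_minimal {a : F} (ha : IsNoExit a) : ∃ l : List (Quiver.Total F),
    l ≠ [] ∧ IsWalk a l a ∧ ∀ l', IsWalk a l' a → l' ≠ [] → l.length ≤ l'.length := by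
  have hex : ∃ n, ∃ l : List (Quiver.Total F), l ≠ [] ∧ IsWalk a l a ∧ l.length = n := by
    obtain ⟨l, h1, h2, -⟩ := ha
    exact ⟨_, l, h1, h2, rfl⟩
  classical
  obtain ⟨l, h1, h2, h3⟩ := Nat.find_spec hex
  exact ⟨l, h1, h2, fun l' h h' => h3 ▸ Nat.find_min' hex ⟨l', h', h, rfl⟩⟩

/-- Edges being forced, a nonempty closed path starts with the shortest one; removing it leaves a
shorter closed path. -/
theorem IsNoExit.eq_listPow {a : F} (ha : IsNoExit a) {l : List (Quiver.Total F)} (hl : l ≠ [])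
    (hw : IsWalk a l a) (hmin : ∀ l', IsWalk a l' a → l' ≠ [] → l.length ≤ l'.length)
    {l' : List (Quiver.Total F)} (h' : IsWalk a l' a) : ∃ n, l' = listPow l n := by
  induction hn : l'.length using Nat.strong_induction_on generalizing l' with
  | _ n ih =>
    by_cases h0 : l' = []
    · exact ⟨0, h0⟩
    · obtain ⟨l'', rfl⟩ := hw.prefix_of_not_hasExit h' (ha.not_hasExit h') (hmin l' h' h0)
      obtain ⟨b, h1, h2⟩ := isWalk_append.1 h'
      obtain rfl := hw.target_unique h1
      have : 0 < l.length := List.length_pos_iff.2 hl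
      obtain ⟨m, rfl⟩ := ih l''.length (by rw [← hn, List.length_append]; omega) h2 rfl
      exact ⟨m + 1, (listPow_succ _ _).symm⟩

theorem IsWalk.isChain {a b : F} {l : List (Quiver.Total F)} (h : IsWalk a l b) :
    l.IsChain fun e f => e.right = f.left := by
  induction l generalizing a with
  | nil => exact .nil
  | cons e l ih =>
    cases l with
    | nil => exact .singleton _
    | cons f l => exact .cons_cons h.2.1.symm (ih h.2)

theorem IsWalk.head_left {a b : F} {l : List (Quiver.Total F)} (h : IsWalk a l b) (hl : l ≠ []) :
    (l.head hl).left = a := by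
  cases l with
  | nil => exact (hl rfl).elim
  | cons e l => exact h.1

theorem IsWalk.getLast_right {a b : F} {l : List (Quiver.Total F)} (h : IsWalk a l b)
    (hl : l ≠ []) : (l.getLast hl).right = b := by
  induction l generalizing a with
  | nil => exact (hl rfl).elim
  | cons e l ih =>
    cases l with
    | nil => exact h.2
    | cons f l => exact ih h.2 (by simp)

theorem isWalk_of_isChain {l : List (Quiver.Total F)}
    (h : l.IsChain fun e f => e.right = f.left) (hl : l ≠ []) :
    IsWalk (l.head hl).left l (l.getLast hl).right := by
  induction l with
  | nil => exact (hl rfl).elim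
  | cons e l ih =>
    cases l with
    | nil => exact ⟨rfl, rfl⟩
    | cons f l =>
      rw [List.isChain_cons_cons] at h
      exact ⟨rfl, h.1 ▸ ih h.2 (by simp)⟩

theorem exists_append_of_not_nodup {X Y : Type*} (f : X → Y) {l : List X}
    (h : ¬ (l.map f).Nodup) : ∃ l₁ x l₂ y l₃, l = l₁ ++ x :: l₂ ++ y :: l₃ ∧ f x = f y := by
  induction l with
  | nil => simp at h
  | cons x l ih =>
    by_cases hx : f x ∈ l.map f
    · obtain ⟨y, hy, hxy⟩ := List.mem_map.1 hx
      obtain ⟨l₂, l₃, rfl⟩ := List.append_of_mem hy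
      exact ⟨[], x, l₂, y, l₃, by simp, hxy.symm⟩
    · obtain ⟨l₁, x', l₂, y, l₃, rfl, hxy⟩ := ih fun hl => h (by
        rw [List.map_cons, List.nodup_cons]; exact ⟨hx, hl⟩)
      exact ⟨x :: l₁, x', l₂, y, l₃, by simp, hxy⟩

/-- A shortest closed path is a cycle, for a repeated source would allow a shortcut. -/
theorem IsNoExit.not_conditionL {a : F} (ha : IsNoExit a) : ¬ ConditionL F := by
  intro hL
  obtain ⟨l, hl, hw, hmin⟩ := ha.exists_minimal
  refine ha.not_hasExit hw (hL l ⟨hw.isChain, ⟨hl, ?_⟩, ?_⟩)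
  · rw [hw.getLast_right, hw.head_left]
  · by_contra hnd
    obtain ⟨l₁, x, l₂, y, l₃, rfl, hxy⟩ := exists_append_of_not_nodup _ hnd
    rw [List.append_assoc, isWalk_append] at hw
    obtain ⟨b, h1, h2⟩ := hw
    obtain ⟨c, -, h3⟩ := isWalk_append.1 h2
    have h4 : IsWalk b (y :: l₃) a := ⟨hxy.symm.trans h2.1, h3.2⟩
    have := hmin _ (h1.append h4) (by simp)
    simp only [List.length_append, List.length_cons] at this
    omega

theorem conditionL_of_forall_not_isNoExit (h : ∀ a : F, ¬ IsNoExit a) : ConditionL F := by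
  rintro l ⟨h1, ⟨hl, h2⟩, -⟩
  by_contra hex
  have := isWalk_of_isChain h1 hl
  rw [h2] at this
  exact h _ ⟨l, hl, this, hex⟩

end NoExit

/-! ### Homogeneous elements of a corner without exits. -/

namespace CKFamily

set_option linter.unusedSectionVars false

variable {K : Type w} [Field K] {F : Type u} [Quiver.{v} F] {A : Type*}
    [NonUnitalRing A] [Module K A] [IsScalarTower K A A] [SMulCommClass K A A]
    (Φ : CKFamily K F A)

theorem s_mul_t_of_unique {e : Quiver.Total F}
    (h : ∀ f : Quiver.Total F, f.left = e.left → f = e) : Φ.s e * Φ.t e = Φ.p e.left := by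
  obtain ⟨a, b, e⟩ := e
  let _ : Unique (Quiver.Star a) :=
    { default := ⟨b, e⟩
      uniq := by
        rintro ⟨c, f⟩
        simpa using h ⟨a, c, f⟩ rfl }
  rw [← Φ.finsum_s_mul_t a ⟨inferInstance, inferInstance⟩, finsum_unique]
  rfl

theorem real_mul_ghost_of_not_hasExit {a b : F} {l : List (Quiver.Total F)} (h : IsWalk a l b)
    (hl : ¬ HasExit l) : Φ.real l b * Φ.ghost l b = Φ.p a := by
  induction l generalizing a with
  | nil => obtain rfl := h; exact Φ.p_mul_self a
  | cons e l ih =>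
    rw [not_hasExit_iff] at hl
    have := ih h.2 (not_hasExit_iff.2 fun e he => hl e (by simp [he]))
    rw [real_cons, ghost_cons, mul_assoc, ← mul_assoc (Φ.real l b), this, Φ.p_mul_t,
      Φ.s_mul_t_of_unique (hl e (by simp)), h.1]

/-- The longer paths extend the shorter ones by a common path `γ` without exits, and `γ γ*` is a
vertex, so it cancels. -/
theorem real_mul_ghost_eq {a b b' : F} (ha : IsNoExit a) {α β α' β' : List (Quiver.Total F)}
    (hα : IsWalk a α b) (hβ : IsWalk a β b) (hα' : IsWalk a α' b') (hβ' : IsWalk a β' b')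
    (h : (α.length : ℤ) - β.length = α'.length - β'.length) (hle : α.length ≤ α'.length) :
    Φ.real α b * Φ.ghost β b = Φ.real α' b' * Φ.ghost β' b' := by
  obtain ⟨γ, rfl⟩ := hα.prefix_of_not_hasExit hα' (ha.not_hasExit hα') hle
  obtain ⟨γ', rfl⟩ := hβ.prefix_of_not_hasExit hβ' (ha.not_hasExit hβ') (by omega)
  obtain ⟨c, h1, h2⟩ := isWalk_append.1 hα'
  obtain rfl := hα.target_unique h1
  obtain ⟨c, h3, h4⟩ := isWalk_append.1 hβ'
  obtain rfl := hβ.target_unique h3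
  have hγ : ¬ HasExit γ := by
    have := ha.not_hasExit hα'
    rw [not_hasExit_iff] at this ⊢
    exact fun e he => this e (by simp [he])
  have hlen : γ'.length = γ.length := by
    simp only [List.length_append] at h
    omega
  obtain rfl : γ' = γ := (h4.prefix_of_not_hasExit h2 hγ hlen.le).eq_of_length hlen
  rw [← Φ.real_mul_real h2, ← Φ.ghost_mul_ghost h2, mul_assoc, ← mul_assoc (Φ.real γ' b'),
    Φ.real_mul_ghost_of_not_hasExit h2 hγ, Φ.p_mul_ghost]

/-- By `real_mul_ghost_eq` all monomials of one degree in this corner coincide, so its homogeneous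
components are at most one-dimensional. -/
theorem exists_eq_smul_of_mem_deg {a : F} (ha : IsNoExit a) {n : ℤ} {x : A} (hx : x ∈ Φ.deg n)
    (hxa : Φ.p a * x * Φ.p a = x) (h0 : x ≠ 0) : ∃ (k : K) (b : F) (α β : List (Quiver.Total F)),
      k ≠ 0 ∧ IsWalk a α b ∧ IsWalk a β b ∧ x = k • (Φ.real α b * Φ.ghost β b) := by
  by_cases hex : ∃ (b : F) (α β : List (Quiver.Total F)), IsWalk a α b ∧ IsWalk a β b ∧
      (α.length : ℤ) - β.length = n
  · obtain ⟨b, α, β, hα, hβ, hn⟩ := hex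
    suffices Φ.p a * x * Φ.p a ∈ Submodule.span K {Φ.real α b * Φ.ghost β b} by
      obtain ⟨k, hk⟩ := Submodule.mem_span_singleton.1 this
      rw [hxa] at hk
      exact ⟨k, b, α, β, fun h => h0 (by rw [← hk, h, zero_smul]), hα, hβ, hk.symm⟩
    rw [mul_assoc]
    refine mul_mem_of_mem_span (N := Submodule.span K {Φ.real α b * Φ.ghost β b})
      (s := {x | ∃ y ∈ Φ.deg n, x = y * Φ.p a}) ?_ (Submodule.subset_span ⟨x, hx, rfl⟩)
    rintro _ ⟨y, hy, rfl⟩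
    rw [← mul_assoc]
    induction hy using Submodule.span_induction with
    | mem y hy =>
      obtain ⟨c, d, b', α', β', hα', hβ', hn', rfl⟩ := hy
      by_cases hc : a = c
      · by_cases hd : d = a
        · subst hc hd
          rw [← mul_assoc, Φ.p_mul_real hα', mul_assoc, Φ.ghost_mul_p hβ']
          refine Submodule.mem_span_singleton.2 ⟨1, ?_⟩
          rw [one_smul]
          rcases le_total α.length α'.length with h | h
          · exact Φ.real_mul_ghost_eq ha hα hβ hα' hβ' (by omega) h
          · exact (Φ.real_mul_ghost_eq ha hα' hβ' hα hβ (by omega) h).symm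
        · rw [mul_assoc, mul_assoc, Φ.ghost_mul_p_of_ne hβ' hd, mul_zero, mul_zero]
          exact zero_mem _
      · rw [← mul_assoc, Φ.p_mul_real_of_ne hα' hc, zero_mul, zero_mul]
        exact zero_mem _
    | zero => simp
    | add x y _ _ hx hy => rw [mul_add, add_mul]; exact add_mem hx hy
    | smul k x _ hx => rw [mul_smul_comm, smul_mul_assoc]; exact Submodule.smul_mem _ _ hx
  · refine (h0 ?_).elim
    rw [← hxa]
    clear hxa h0
    induction hx using Submodule.span_induction with
    | mem y hy =>
      obtain ⟨c, d, b', α', β', hα', hβ', hn', rfl⟩ := hy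
      by_cases hc : a = c
      · by_cases hd : d = a
        · subst hc hd
          exact (hex ⟨b', α', β', hα', hβ', hn'⟩).elim
        · rw [mul_assoc, mul_assoc, Φ.ghost_mul_p_of_ne hβ' hd, mul_zero, mul_zero]
      · rw [← mul_assoc, Φ.p_mul_real_of_ne hα' hc, zero_mul, zero_mul]
    | zero => simp
    | add x y _ _ hx hy => rw [mul_add, add_mul, hx, hy, add_zero]
    | smul k x _ hx => rw [mul_smul_comm, smul_mul_assoc, hx, smul_zero]

/-- The reduction theorem for homogeneous elements. -/
theorem reduction_of_mem_deg (hp : ∀ a, Φ.p a ≠ 0) {n : ℤ} {x : A} (hx : x ∈ Φ.deg n)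
    (h0 : x ≠ 0) : ∃ (y z : A) (a : F), y * x * z = Φ.p a := by
  obtain ⟨i, j, y, z, a, hy, hz, ⟨k, hk, h⟩ | ⟨ha, h1, h2⟩⟩ := Φ.reduction hp h0
  · refine ⟨k⁻¹ • y, z, a, ?_⟩
    rw [smul_mul_assoc, smul_mul_assoc, h, smul_smul, inv_mul_cancel₀ hk, one_smul]
  · obtain ⟨k, b, α, β, hk, hα, hβ, h⟩ := Φ.exists_eq_smul_of_mem_deg ha
      (Φ.mul_mem_deg (Φ.mul_mem_deg hy hx) hz) h2 h1
    -- The monomial `α β*` becomes the vertex `b` when multiplied by `α*` on the left and `β` on the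
    -- right.
    refine ⟨k⁻¹ • (Φ.ghost α b * y), z * Φ.real β b, b, ?_⟩
    have : Φ.ghost α b * (y * x * z) * Φ.real β b = k • Φ.p b := by
      rw [h, mul_smul_comm, smul_mul_assoc, ← mul_assoc, Φ.ghost_mul_real hα, mul_assoc,
        Φ.ghost_mul_real hβ, Φ.p_mul_self]
    calc k⁻¹ • (Φ.ghost α b * y) * x * (z * Φ.real β b)
        = k⁻¹ • (Φ.ghost α b * (y * x * z) * Φ.real β b) := by
          simp only [smul_mul_assoc, mul_assoc]
      _ = Φ.p b := by rw [this, smul_smul, inv_mul_cancel₀ hk, one_smul]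

end CKFamily

/-! ### Laurent polynomials in a closed path without exits. -/

namespace CKFamily

set_option linter.unusedSectionVars false

variable {K : Type w} [Field K] {F : Type u} [Quiver.{v} F] {A : Type*}
    [NonUnitalRing A] [Module K A] [IsScalarTower K A A] [SMulCommClass K A A]
    (Φ : CKFamily K F A)

open Polynomial

/-- Evaluation of polynomials at a closed path `l` at `a`, with values in the corner at `a`. -/
def polyEval (a : F) (l : List (Quiver.Total F)) : K[X] →ₗ[K] A :=
  Polynomial.lsum fun n => LinearMap.toSpanSingleton K A (Φ.real (listPow l n) a)

theorem polyEval_monomial (a : F) (l : List (Quiver.Total F)) (n : ℕ) (k : K) :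
    Φ.polyEval a l (monomial n k) = k • Φ.real (listPow l n) a := by
  simp [polyEval, Polynomial.lsum_apply, Polynomial.sum_monomial_index]

theorem polyEval_X_pow (a : F) (l : List (Quiver.Total F)) (n : ℕ) :
    Φ.polyEval a l (X ^ n) = Φ.real (listPow l n) a := by
  rw [← monomial_one_right_eq_X_pow, polyEval_monomial, one_smul]

theorem polyEval_one (a : F) (l : List (Quiver.Total F)) : Φ.polyEval a l 1 = Φ.p a := by
  simpa [listPow_zero] using Φ.polyEval_X_pow a l 0

theorem polyEval_mul {a : F} {l : List (Quiver.Total F)} (h : IsWalk a l a) (f g : K[X]) :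
    Φ.polyEval a l (f * g) = Φ.polyEval a l f * Φ.polyEval a l g := by
  induction f using Polynomial.induction_on' with
  | add f f' hf hf' => rw [add_mul, map_add, map_add, add_mul, hf, hf']
  | monomial m k =>
    induction g using Polynomial.induction_on' with
    | add g g' hg hg' => rw [mul_add, map_add, map_add, mul_add, hg, hg']
    | monomial n k' =>
      rw [monomial_mul_monomial, polyEval_monomial, polyEval_monomial, polyEval_monomial,
        smul_mul_smul_comm, Φ.real_mul_real (h.listPow n), listPow_add]

theorem p_mul_polyEval {a : F} {l : List (Quiver.Total F)} (h : IsWalk a l a) (f : K[X]) :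
    Φ.p a * Φ.polyEval a l f = Φ.polyEval a l f := by
  rw [← Φ.polyEval_one a l, ← Φ.polyEval_mul h, one_mul]

theorem polyEval_mul_p {a : F} {l : List (Quiver.Total F)} (h : IsWalk a l a) (f : K[X]) :
    Φ.polyEval a l f * Φ.p a = Φ.polyEval a l f := by
  rw [← Φ.polyEval_one a l, ← Φ.polyEval_mul h, mul_one]

/-- The path `l` is a shortest closed path at `a`, and no path from `a` has an exit. -/
def IsLoop (a : F) (l : List (Quiver.Total F)) : Prop :=
  IsNoExit a ∧ l ≠ [] ∧ IsWalk a l a ∧ ∀ l', IsWalk a l' a → l' ≠ [] → l.length ≤ l'.length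

theorem exists_isLoop {a : F} (h : IsNoExit a) : ∃ l : List (Quiver.Total F), IsLoop a l :=
  h.exists_minimal.imp fun _ hl => ⟨h, hl⟩

variable {Φ}
variable {a : F} {l : List (Quiver.Total F)}

theorem polyEval_X_pow_mul_ghost (h : IsLoop a l) (n : ℕ) :
    Φ.polyEval a l (X ^ n) * Φ.ghost (listPow l n) a = Φ.p a := by
  rw [polyEval_X_pow, Φ.real_mul_ghost_of_not_hasExit (h.2.2.1.listPow n)
    (h.1.not_hasExit (h.2.2.1.listPow n))]

/-- Clears denominators: a high power of the closed path absorbs all ghost paths in the corner. -/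
theorem exists_p_mul_mul_polyEval_eq (h : IsLoop a l) (x : A) :
    ∃ (n : ℕ) (f : K[X]), Φ.p a * x * Φ.polyEval a l (X ^ n) = Φ.polyEval a l f := by
  obtain ⟨hne, hl, hw, hmin⟩ := h
  induction Φ.mem_span_monomials x using Submodule.span_induction with
  | mem y hy =>
    obtain ⟨b, b', c, α, β, hα, hβ, rfl⟩ := hy
    by_cases hb : a = b
    · by_cases hb' : b' = a
      · subst hb hb'
        -- Completing `β` by `γ` to a power of `l` turns `α β*` times that power into `α γ`, a
        -- closed path at `a` and hence a power of `l`.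
        obtain ⟨γ, hγ⟩ := hβ.prefix_of_not_hasExit (hw.listPow β.length)
          (hne.not_hasExit (hw.listPow _)) (le_length_listPow hl _)
        obtain ⟨d, h1, h2⟩ := isWalk_append.1 (hγ ▸ hw.listPow β.length)
        obtain rfl := hβ.target_unique h1
        obtain ⟨n, hn⟩ := hne.eq_listPow hl hw hmin (hα.append h2)
        refine ⟨β.length, X ^ n, ?_⟩
        rw [polyEval_X_pow, polyEval_X_pow, ← hγ, ← Φ.real_mul_real h2, ← hn,
          ← Φ.real_mul_real h2, ← mul_assoc (Φ.p _), Φ.p_mul_real hα, mul_assoc, ← mul_assoc (Φ.ghost _ _),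
          Φ.ghost_mul_real hβ, Φ.p_mul_real h2]
      · refine ⟨0, 0, ?_⟩
        rw [pow_zero, polyEval_one, map_zero, mul_assoc, mul_assoc, Φ.ghost_mul_p_of_ne hβ hb',
          mul_zero, mul_zero]
    · refine ⟨0, 0, ?_⟩
      rw [← mul_assoc, Φ.p_mul_real_of_ne hα hb, zero_mul, zero_mul, map_zero]
  | zero => exact ⟨0, 0, by simp⟩
  | add x y _ _ hx hy =>
    obtain ⟨n, f, hf⟩ := hx
    obtain ⟨m, g, hg⟩ := hy
    refine ⟨n + m, f * X ^ m + g * X ^ n, ?_⟩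
    rw [map_add, Φ.polyEval_mul hw, Φ.polyEval_mul hw, ← hf, ← hg, mul_assoc (Φ.p a * x),
      mul_assoc (Φ.p a * y), ← Φ.polyEval_mul hw, ← Φ.polyEval_mul hw, ← pow_add, ← pow_add,
      add_comm m n, mul_add, add_mul]
  | smul k x _ hx =>
    obtain ⟨n, f, hf⟩ := hx
    exact ⟨n, k • f, by rw [map_smul, ← hf, mul_smul_comm, smul_mul_assoc]⟩

theorem mem_of_polyEval_mem (h : IsLoop a l) {J : TwoSidedIdeal A} {x : A} {n : ℕ} {f : K[X]}
    (hx : x * Φ.p a = x) (hxf : x * Φ.polyEval a l (X ^ n) = Φ.polyEval a l f)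
    (hf : Φ.polyEval a l f ∈ J) : x ∈ J := by
  have := J.mul_mem_right _ (Φ.ghost (listPow l n) a) hf
  rwa [← hxf, mul_assoc, polyEval_X_pow_mul_ghost h, hx] at this

/-- If a prime ideal contains a non-zero element of the corner at a vertex `a` on a closed path
without exits, then every ideal properly containing it contains `a`. -/
theorem p_mem_of_prime_lt (h : IsLoop a l) {J Q : TwoSidedIdeal A}
    (hJ : ∀ x y, x * y ∈ J → (∀ z, x * z * y ∈ J) → x ∈ J ∨ y ∈ J) (ha : Φ.p a ∉ J)
    {x : A} (hxJ : x ∈ J) (hx0 : x ≠ 0) (hxa : Φ.p a * x * Φ.p a = x) (hJQ : J < Q) :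
    Φ.p a ∈ Q := by
  have hw := h.2.2.1
  have corner : ∀ y, Φ.p a * y * Φ.p a = y → Φ.p a * y = y ∧ y * Φ.p a = y := by
    intro y hy
    constructor
    · rw [← hy, ← mul_assoc, ← mul_assoc, Φ.p_mul_self]
    · rw [← hy, mul_assoc, Φ.p_mul_self]
  -- The trace of `J` on polynomials in the closed path; it is shown to be prime and nonzero, hence
  -- maximal.
  let I : Ideal K[X] :=
    { carrier := {f | Φ.polyEval a l f ∈ J}
      add_mem' := fun {f g} hf hg => by
        change Φ.polyEval a l (f + g) ∈ J
        rw [map_add]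
        exact J.add_mem hf hg
      zero_mem' := by
        change Φ.polyEval a l 0 ∈ J
        rw [map_zero]
        exact J.zero_mem
      smul_mem' := fun f g hg => by
        change Φ.polyEval a l (f * g) ∈ J
        rw [Φ.polyEval_mul hw]
        exact J.mul_mem_left _ _ hg }
  have hI : ∀ f, f ∈ I ↔ Φ.polyEval a l f ∈ J := fun _ => Iff.rfl
  have hprime : I.IsPrime := by
    refine ⟨fun htop => ha ?_, fun {f g} hfg => ?_⟩
    · rw [← Φ.polyEval_one a l, ← hI, htop]
      trivial
    · rw [hI] at hfg
      refine hJ _ _ (by rwa [← Φ.polyEval_mul hw]) fun z => ?_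
      -- Up to a power of `l`, the middle factor `z` is a polynomial `r`, and polynomials in `l`
      -- commute.
      obtain ⟨n, r, hr⟩ := exists_p_mul_mul_polyEval_eq (Φ := Φ) h z
      refine mem_of_polyEval_mem (Φ := Φ) (n := n) (f := r * (f * g)) h ?_ ?_ ?_
      · rw [mul_assoc, Φ.polyEval_mul_p hw]
      · calc Φ.polyEval a l f * z * Φ.polyEval a l g * Φ.polyEval a l (X ^ n)
            = Φ.polyEval a l f * (Φ.p a * z * Φ.polyEval a l (X ^ n)) * Φ.polyEval a l g := by
              rw [mul_assoc, ← Φ.polyEval_mul hw, mul_comm g, Φ.polyEval_mul hw,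
                ← Φ.polyEval_mul_p hw f]
              simp only [mul_assoc]
              rw [← mul_assoc (Φ.p a) (Φ.p a), Φ.p_mul_self]
          _ = Φ.polyEval a l (r * (f * g)) := by
              rw [hr, ← Φ.polyEval_mul hw, ← Φ.polyEval_mul hw]
              congr 1
              ring
      · rw [Φ.polyEval_mul hw]
        exact J.mul_mem_left _ _ hfg
  obtain ⟨n, f, hf⟩ := exists_p_mul_mul_polyEval_eq (Φ := Φ) h x
  rw [(corner x hxa).1] at hf
  have hfI : f ∈ I := by
    rw [hI, ← hf]
    exact J.mul_mem_right _ _ hxJ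
  have hI0 : I ≠ ⊥ := by
    rintro hbot
    rw [hbot, Ideal.mem_bot] at hfI
    refine hx0 ((TwoSidedIdeal.mem_bot A).1 ?_)
    exact mem_of_polyEval_mem h (corner x hxa).2 hf (by rw [hfI, map_zero]; exact zero_mem _)
  have hmax : I.IsMaximal := hprime.isMaximal hI0
  obtain ⟨y, hyQ, hyJ⟩ := SetLike.exists_of_lt hJQ
  -- Primeness of `J` moves `y` into the corner at `a`, one side at a time, without falling into
  -- `J`.
  obtain ⟨z, hz⟩ : ∃ z, Φ.p a * z * y ∉ J := by
    by_contra! hcon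
    rcases hJ (Φ.p a) y (by simpa [Φ.p_mul_self] using hcon (Φ.p a)) hcon with h' | h'
    exacts [ha h', hyJ h']
  obtain ⟨z', hz'⟩ : ∃ z', Φ.p a * z * y * z' * Φ.p a ∉ J := by
    by_contra! hcon
    rcases hJ (Φ.p a * z * y) (Φ.p a) (by simpa [mul_assoc, Φ.p_mul_self] using hcon (Φ.p a)) hcon
      with h' | h'
    exacts [hz h', ha h']
  set y' := Φ.p a * z * y * z' * Φ.p a with hy'
  have hy'Q : y' ∈ Q := by
    rw [hy']
    exact Q.mul_mem_right _ _ (Q.mul_mem_right _ _ (Q.mul_mem_left _ _ hyQ))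
  have hy'a : Φ.p a * y' = y' ∧ y' * Φ.p a = y' := by
    constructor
    · rw [hy']; simp only [← mul_assoc, Φ.p_mul_self]
    · rw [hy']; simp only [mul_assoc, Φ.p_mul_self]
  obtain ⟨m, g, hg⟩ := exists_p_mul_mul_polyEval_eq (Φ := Φ) h y'
  rw [hy'a.1] at hg
  have hgI : g ∉ I := fun hgI => hz' (mem_of_polyEval_mem h hy'a.2 hg hgI)
  -- Modulo the maximal ideal `I` the polynomial `g` is invertible, which expresses the vertex by
  -- elements of `Q`.
  obtain ⟨r, i, hi, hri⟩ := hmax.exists_inv hgI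
  rw [← Φ.polyEval_one a l, ← hri, map_add, Φ.polyEval_mul hw]
  refine Q.add_mem (Q.mul_mem_left _ _ ?_) (hJQ.le hi)
  rw [← hg]
  exact Q.mul_mem_right _ _ hy'Q

/-- The polynomial `q` is not a unit among Laurent polynomials, so the ideal it generates does not
fill the corner at `a`. -/
theorem p_notMem_span_polyEval (h : IsLoop a l)
    (hinj : Function.Injective (Φ.polyEval a l)) {q : K[X]} (h0 : q.coeff 0 ≠ 0)
    (hq : 0 < q.natDegree) : Φ.p a ∉ TwoSidedIdeal.span {Φ.polyEval a l q} := by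
  have hw := h.2.2.1
  intro hmem
  -- The elements whose compressions to the corner are all multiples of `q` once denominators are
  -- cleared.
  let M : TwoSidedIdeal A := TwoSidedIdeal.mk'
    {x | ∀ u v, ∃ (n : ℕ) (f : K[X]),
      Φ.p a * (u * x * v) * Φ.polyEval a l (X ^ n) = Φ.polyEval a l (f * q)}
    (fun u v => ⟨0, 0, by simp⟩)
    (fun {x y} hx hy u v => by
      obtain ⟨n, f, hf⟩ := hx u v
      obtain ⟨m, g, hg⟩ := hy u v
      refine ⟨n + m, f * X ^ m + g * X ^ n, ?_⟩
      have e : (f * X ^ m + g * X ^ n) * q = f * q * X ^ m + g * q * X ^ n := by ring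
      rw [e, map_add, Φ.polyEval_mul hw (f * q), Φ.polyEval_mul hw (g * q), ← hf, ← hg,
        mul_assoc (Φ.p a * (u * x * v)), mul_assoc (Φ.p a * (u * y * v)), ← Φ.polyEval_mul hw,
        ← Φ.polyEval_mul hw, ← pow_add, ← pow_add, add_comm m n]
      simp only [mul_add, add_mul])
    (fun {x} hx u v => by
      obtain ⟨n, f, hf⟩ := hx u v
      refine ⟨n, -f, ?_⟩
      rw [neg_mul, map_neg, ← hf]
      simp only [mul_neg, neg_mul])
    (fun {x y} hy u v => by
      obtain ⟨n, f, hf⟩ := hy (u * x) v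
      exact ⟨n, f, by rw [← hf]; simp only [mul_assoc]⟩)
    (fun {x y} hx u v => by
      obtain ⟨n, f, hf⟩ := hx u (y * v)
      exact ⟨n, f, by rw [← hf]; simp only [mul_assoc]⟩)
  have hle : TwoSidedIdeal.span {Φ.polyEval a l q} ≤ M := by
    rw [TwoSidedIdeal.span_le]
    rintro _ rfl
    simp only [SetLike.mem_coe, M, TwoSidedIdeal.mem_mk', Set.mem_ofPred_eq]
    intro u v
    obtain ⟨n, f, hf⟩ := exists_p_mul_mul_polyEval_eq (Φ := Φ) h u
    obtain ⟨m, g, hg⟩ := exists_p_mul_mul_polyEval_eq (Φ := Φ) h v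
    refine ⟨m + n, f * g, ?_⟩
    calc Φ.p a * (u * Φ.polyEval a l q * v) * Φ.polyEval a l (X ^ (m + n))
        = Φ.p a * u * (Φ.polyEval a l q * (Φ.p a * v * Φ.polyEval a l (X ^ m)) *
            Φ.polyEval a l (X ^ n)) := by
          rw [pow_add, Φ.polyEval_mul hw, ← Φ.polyEval_mul_p hw q]
          simp only [mul_assoc]
          rw [← mul_assoc (Φ.p a) (Φ.p a), Φ.p_mul_self]
      _ = Φ.p a * u * Φ.polyEval a l (X ^ n) * Φ.polyEval a l (q * g) := by
          rw [hg, ← Φ.polyEval_mul hw, ← Φ.polyEval_mul hw, mul_comm, Φ.polyEval_mul hw, mul_assoc,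
            mul_assoc, mul_assoc]
      _ = Φ.polyEval a l (f * g * q) := by
          rw [hf, ← Φ.polyEval_mul hw]
          congr 1
          ring
  have := hle hmem
  simp only [M, TwoSidedIdeal.mem_mk', Set.mem_ofPred_eq] at this
  obtain ⟨n, f, hf⟩ := this (Φ.p a) (Φ.p a)
  rw [Φ.p_mul_self, Φ.p_mul_self, Φ.p_mul_self, Φ.p_mul_polyEval hw] at hf
  have hdvd : q ∣ X ^ n := ⟨f, by rw [hinj hf, mul_comm]⟩
  -- A divisor of `X ^ n` is associated to some `X ^ i`; the nonzero constant term forces `i = 0`,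
  -- so `q` would be constant.
  obtain ⟨i, -, hi⟩ := (dvd_prime_pow Polynomial.prime_X n).1 hdvd
  obtain ⟨c, hc⟩ := hi.symm
  have hi0 : i = 0 := by
    by_contra hi0
    refine h0 ?_
    rw [← hc, Polynomial.mul_coeff_zero, Polynomial.coeff_X_pow, if_neg (Ne.symm hi0), zero_mul]
  rw [hi0, pow_zero, one_mul] at hc
  rw [← hc, Polynomial.natDegree_coe_units] at hq
  exact lt_irrefl _ hq

end CKFamily

/-! ### Prime ideals in non-unital rings. -/

section Ideals

variable {R : Type*} [NonUnitalRing R]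

/-- Without a unit, `x R y ⊆ P` need not include `x y`, hence the two hypotheses. They say that `x`
lies in the ideal `A` of left annihilators of `y` and `R y` modulo `P`; `B` is the ideal of right
annihilators of `A` modulo `P`. -/
theorem IsPrimeIdeal.mem_or_mem {P : TwoSidedIdeal R} (hP : IsPrimeIdeal P) {x y : R}
    (hxy : x * y ∈ P) (h : ∀ z, x * z * y ∈ P) : x ∈ P ∨ y ∈ P := by
  let A : TwoSidedIdeal R := .mk' {a | a * y ∈ P ∧ ∀ z, a * z * y ∈ P}
    (by simp [P.zero_mem])
    (fun {a b} ha hb => ⟨by rw [add_mul]; exact P.add_mem ha.1 hb.1, fun z => by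
      rw [add_mul, add_mul]; exact P.add_mem (ha.2 z) (hb.2 z)⟩)
    (fun {a} ha => ⟨by rw [neg_mul]; exact P.neg_mem ha.1, fun z => by
      rw [neg_mul, neg_mul]; exact P.neg_mem (ha.2 z)⟩)
    (fun {a b} hb => ⟨by rw [mul_assoc]; exact P.mul_mem_left _ _ hb.1, fun z => by
      rw [mul_assoc, mul_assoc, ← mul_assoc b]; exact P.mul_mem_left _ _ (hb.2 z)⟩)
    (fun {a b} ha => ⟨ha.2 b, fun z => by rw [mul_assoc a]; exact ha.2 _⟩)
  let B : TwoSidedIdeal R := .mk' {b | ∀ a ∈ A, a * b ∈ P}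
    (by simp [P.zero_mem])
    (fun {b c} hb hc a ha => by rw [mul_add]; exact P.add_mem (hb a ha) (hc a ha))
    (fun {b} hb a ha => by rw [mul_neg]; exact P.neg_mem (hb a ha))
    (fun {c b} hb a ha => by rw [← mul_assoc]; exact hb _ (A.mul_mem_right _ _ ha))
    (fun {b c} hb a ha => by rw [← mul_assoc]; exact P.mul_mem_right _ _ (hb a ha))
  have hA : ∀ a, a ∈ A ↔ a * y ∈ P ∧ ∀ z, a * z * y ∈ P := fun a => by
    simp [A]
  have hB : ∀ b, b ∈ B ↔ ∀ a ∈ A, a * b ∈ P := fun b => by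
    simp [B]
  refine (hP.2 A B fun a ha b hb => (hB b).1 hb a ha).imp (fun hle => hle ?_) fun hle => hle ?_
  · exact (hA x).2 ⟨hxy, h⟩
  · exact (hB y).2 fun a ha => ((hA a).1 ha).1

/-- An ideal which does not contain an idempotent (modulo this ideal) is contained in a prime
ideal which does not contain it either. -/
theorem exists_isPrimeIdeal {N : TwoSidedIdeal R} {e : R} (he : e * e - e ∈ N) (heN : e ∉ N) :
    ∃ Q, IsPrimeIdeal Q ∧ N ≤ Q ∧ e ∉ Q := by
  obtain ⟨Q, hNQ, hQ⟩ := zorn_le_nonempty₀ {Q : TwoSidedIdeal R | e ∉ Q} (by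
    intro c hc hchain y hy
    let U : TwoSidedIdeal R := .mk' {x | ∃ Q ∈ c, x ∈ Q}
      ⟨y, hy, y.zero_mem⟩
      (by
        rintro a b ⟨Q, hQ, ha⟩ ⟨Q', hQ', hb⟩
        rcases hchain.total hQ hQ' with h | h
        · exact ⟨Q', hQ', Q'.add_mem (h ha) hb⟩
        · exact ⟨Q, hQ, Q.add_mem ha (h hb)⟩)
      (by rintro a ⟨Q, hQ, ha⟩; exact ⟨Q, hQ, Q.neg_mem ha⟩)
      (by rintro a b ⟨Q, hQ, ha⟩; exact ⟨Q, hQ, Q.mul_mem_left _ _ ha⟩)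
      (by rintro a b ⟨Q, hQ, ha⟩; exact ⟨Q, hQ, Q.mul_mem_right _ _ ha⟩)
    have hU : ∀ x, x ∈ U ↔ ∃ Q ∈ c, x ∈ Q := fun x => by simp [U]
    refine ⟨U, fun h => ?_, fun Q hQ x hx => (hU x).2 ⟨Q, hQ, hx⟩⟩
    obtain ⟨Q, hQ, h⟩ := (hU e).1 h
    exact hc hQ h) N heN
  have heQ : e ∉ Q := hQ.prop
  -- By maximality, an ideal not contained in `Q` generates `e` together with `Q`.
  have key : ∀ A : TwoSidedIdeal R, ¬ A ≤ Q → ∃ a ∈ A, ∃ q ∈ Q, a + q = e := by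
    intro A hA
    by_contra hcon
    have hmem : e ∉ A ⊔ Q := fun h => hcon (TwoSidedIdeal.mem_sup.1 h)
    exact hA (le_sup_left.trans (hQ.le_of_ge (y := A ⊔ Q) hmem le_sup_right))
  refine ⟨Q, ⟨?_, ?_⟩, hNQ, heQ⟩
  · rintro rfl
    exact heQ trivial
  · intro A B hAB
    by_contra hcon
    rw [not_or] at hcon
    obtain ⟨a, ha, q, hq, hae⟩ := key A hcon.1
    obtain ⟨b, hb, r, hr, hbe⟩ := key B hcon.2
    refine heQ ?_
    -- In `(a + q) * (b + r)` the product `a * b` is in `Q` by assumption, and the other terms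
    -- contain a factor from `Q`.
    have h1 : e * e ∈ Q := by
      nth_rw 1 [← hae]
      rw [← hbe, add_mul, mul_add]
      exact Q.add_mem (Q.add_mem (hAB a ha b hb) (Q.mul_mem_left _ _ hr)) (Q.mul_mem_right _ _ hq)
    have h2 := Q.sub_mem h1 (hNQ he)
    rwa [sub_sub_cancel] at h2

end Ideals

/-! ### Strong countable separation from a single vertex. -/

section Tree

variable {F : Type u} [Quiver.{v} F]

/-- The vertices reached from `u` by paths of length `n` all of whose edges start at regular
vertices. -/
def regularLevel (u : F) : ℕ → Set F
  | 0 => {u}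
  | n + 1 => {b | ∃ e : Quiver.Total F, e.left ∈ regularLevel u n ∧ IsRegular e.left ∧ e.right = b}

theorem finite_regularLevel (u : F) (n : ℕ) : (regularLevel u n).Finite := by
  induction n with
  | zero => exact Set.finite_singleton u
  | succ n ih =>
    have : regularLevel u (n + 1) ⊆ ⋃ a ∈ regularLevel u n, {b | IsRegular a ∧
        b ∈ Set.range fun e : Quiver.Star a => e.1} := by
      rintro _ ⟨e, he, hreg, rfl⟩
      simp only [Set.mem_iUnion]
      exact ⟨e.left, he, hreg, ⟨e.right, e.hom⟩, rfl⟩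
    refine (ih.biUnion fun a _ => ?_).subset this
    by_cases h : IsRegular a
    · have := h.2
      exact (Set.finite_range _).subset fun b hb => hb.2
    · exact Set.finite_empty.subset fun b hb => h hb.1

theorem reaches_of_mem_regularLevel {u a : F} {n : ℕ} (h : a ∈ regularLevel u n) :
    Reaches u a := by
  induction n generalizing a with
  | zero => obtain rfl := h; exact .refl _
  | succ n ih =>
    obtain ⟨e, he, -, rfl⟩ := h
    exact (ih he).trans (.of_edge e)

/-- The saturated closure of a set of vertices. -/
inductive SatClosure (X : Set F) : F → Prop
  | base (a : F) (h : a ∈ X) : SatClosure X a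
  | step (a : F) (h : IsRegular a) (h' : ∀ e : Quiver.Star a, SatClosure X e.1) : SatClosure X a

theorem SatClosure.isHereditary {X : Set F} (hX : IsHereditary X) :
    IsHereditary {a | SatClosure X a} := by
  have key : ∀ a, SatClosure X a → ∀ e : Quiver.Star a, SatClosure X e.1 := by
    intro a ha e
    cases ha with
    | base a h => exact .base _ (hX a h _ ⟨e.2.toPath⟩)
    | step a _ h => exact h e
  rintro a ha b ⟨p⟩
  induction p with
  | nil => exact ha
  | cons p e ih => exact key _ ih ⟨_, e⟩

/-- The countable set consists of the vertices reached from `u` through regular vertices. For a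
common descendant `x` of `a` and `u`, the vertex `u` lies in the saturated closure of the
descendants of `x`, so some member of the countable set is a descendant of `x`. -/
theorem strongCSP_of_forall_mem (hdd : DownwardDirected F) {u : F}
    (hu : ∀ H : Set F, H.Nonempty → IsHereditary H → IsSaturated H → u ∈ H) : StrongCSP F := by
  refine ⟨⋃ n, regularLevel u n,
    ⟨Set.countable_iUnion fun n => (finite_regularLevel u n).countable, fun a => ?_⟩, ?_⟩
  · obtain ⟨x, hax, hux⟩ := hdd.2 a u
    have hX : IsHereditary {b : F | Reaches x b} := fun b hb c hc => Reaches.trans hb hc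
    have huX : SatClosure {b : F | Reaches x b} u :=
      hu {a | SatClosure {b : F | Reaches x b} a} ⟨x, .base _ (Reaches.refl x)⟩
        (SatClosure.isHereditary hX) fun a ha h => SatClosure.step a ha h
    -- Membership in the closure unwinds to a path through regular vertices that ends below `x`; `n`
    -- is the level attained along it.
    suffices ∀ c, SatClosure {b : F | Reaches x b} c → ∀ n, c ∈ regularLevel u n →
        ∃ b ∈ ⋃ n, regularLevel u n, Reaches x b by
      obtain ⟨b, hb, hxb⟩ := this u huX 0 rfl
      exact ⟨b, hb, hax.trans hxb⟩
    intro c hc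
    induction hc with
    | base c h => exact fun n hn => ⟨c, Set.mem_iUnion_of_mem n hn, h⟩
    | step c hreg _ ih =>
      intro n hn
      obtain ⟨e⟩ := hreg.1
      exact ih e (n + 1) ⟨⟨c, e.1, e.2⟩, hn, hreg, rfl⟩
  · intro H hne hH hsat b hb
    obtain ⟨n, hn⟩ := Set.mem_iUnion.1 hb
    exact hH u (hu H hne hH hsat) b (reaches_of_mem_regularLevel hn)

/-- Descendants of `a` lead back to `a`, so by downward directedness every vertex reaches `a`, and
`{a}` is the required set. -/
theorem IsNoExit.strongCSP {a : F} (ha : IsNoExit a) (hdd : DownwardDirected F) :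
    StrongCSP F := by
  have key : ∀ b, Reaches b a := fun b => by
    obtain ⟨c, hbc, hac⟩ := hdd.2 b a
    exact hbc.trans (ha.reaches hac)
  refine ⟨{a}, ⟨Set.countable_singleton a, fun b => ⟨a, rfl, key b⟩⟩, ?_⟩
  rintro H ⟨b, hb⟩ hH - _ rfl
  exact hH b hb _ (key b)

end Tree

/-! ### Vertices in ideals, and ideals generated by vertices. -/

namespace CKFamily

set_option linter.unusedSectionVars false

variable {K : Type w} [Field K] {F : Type u} [Quiver.{v} F] {A : Type*}
    [NonUnitalRing A] [Module K A] [IsScalarTower K A A] [SMulCommClass K A A]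
    (Φ : CKFamily K F A)

theorem isHereditary_vertices (J : TwoSidedIdeal A) : IsHereditary {a | Φ.p a ∈ J} := by
  intro a ha b hab
  obtain ⟨l, hl⟩ := hab.exists_isWalk
  change Φ.p b ∈ J
  rw [← Φ.ghost_mul_real hl, ← Φ.p_mul_real hl]
  exact J.mul_mem_left _ _ (J.mul_mem_right _ _ ha)

theorem isSaturated_vertices (J : TwoSidedIdeal A) : IsSaturated {a | Φ.p a ∈ J} := by
  intro a ha h
  have := ha.2
  cases nonempty_fintype (Quiver.Star a)
  change Φ.p a ∈ J
  rw [← Φ.finsum_s_mul_t a ha, finsum_eq_sum_of_fintype]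
  refine sum_mem fun e _ => ?_
  rw [← Φ.s_mul_p]
  exact J.mul_mem_right _ _ (J.mul_mem_left _ _ (h e))

/-- The span of the `α β*` with `α` and `β` of length at most `n` and ending in `H`. -/
def idealSpan (H : Set F) (n : ℕ) : Submodule K A :=
  Submodule.span K {x | ∃ (a b c : F) (α β : List (Quiver.Total F)), c ∈ H ∧ IsWalk a α c ∧
    IsWalk b β c ∧ α.length ≤ n ∧ β.length ≤ n ∧ x = Φ.real α c * Φ.ghost β c}

theorem idealSpan_mono (H : Set F) : Monotone (Φ.idealSpan H) := by
  refine fun m n hmn => Submodule.span_mono ?_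
  rintro _ ⟨a, b, c, α, β, hc, hα, hβ, h, h', rfl⟩
  exact ⟨a, b, c, α, β, hc, hα, hβ, h.trans hmn, h'.trans hmn, rfl⟩

theorem gen_mul_mem_idealSpan {H : Set F} (hH : IsHereditary H) {n : ℕ} {x : A}
    (hx : x ∈ Φ.idealSpan H n) :
    (∀ a, Φ.p a * x ∈ Φ.idealSpan H (n + 1)) ∧ (∀ e, Φ.s e * x ∈ Φ.idealSpan H (n + 1)) ∧
      ∀ e, Φ.t e * x ∈ Φ.idealSpan H (n + 1) := by
  refine ⟨fun d => mul_mem_of_mem_span ?_ hx, fun e => mul_mem_of_mem_span ?_ hx,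
    fun e => mul_mem_of_mem_span ?_ hx⟩ <;>
    rintro _ ⟨a, b, c, α, β, hc, hα, hβ, h, h', rfl⟩ <;> rw [← mul_assoc]
  · by_cases hd : d = a
    · rw [hd, Φ.p_mul_real hα]
      exact Submodule.subset_span ⟨a, b, c, α, β, hc, hα, hβ, by omega, by omega, rfl⟩
    · rw [Φ.p_mul_real_of_ne hα hd, zero_mul]
      exact zero_mem _
  · by_cases he : e.right = a
    · rw [← real_cons]
      exact Submodule.subset_span ⟨e.left, b, c, e :: α, β, hc, ⟨rfl, he ▸ hα⟩, hβ,
        by simpa using h, by omega, rfl⟩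
    · rw [← Φ.s_mul_p, mul_assoc (Φ.s e), Φ.p_mul_real_of_ne hα he, mul_zero, zero_mul]
      exact zero_mem _
  · cases α with
    | nil =>
      obtain rfl := hα
      by_cases he : e.left = a
      · subst he
        rw [real_nil, Φ.t_mul_p, t_mul_ghost, ← Φ.p_mul_ghost, ← real_nil]
        exact Submodule.subset_span ⟨e.right, b, _, [], _, hH _ hc _ (.of_edge e), rfl,
          hβ.append (isWalk_singleton e), by simp, by simpa using h', rfl⟩
      · rw [real_nil, Φ.t_mul_p_of_ne he, zero_mul]
        exact zero_mem _
    | cons f α =>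
      by_cases he : e = f
      · subst he
        rw [Φ.t_mul_real_cons_self hα]
        simp only [List.length_cons] at h
        exact Submodule.subset_span ⟨_, b, c, α, β, hc, hα.2, hβ, by omega, by omega, rfl⟩
      · rw [Φ.t_mul_real_cons_of_ne he, zero_mul]
        exact zero_mem _

theorem mul_gen_mem_idealSpan {H : Set F} (hH : IsHereditary H) {n : ℕ} {x : A}
    (hx : x ∈ Φ.idealSpan H n) :
    (∀ a, x * Φ.p a ∈ Φ.idealSpan H (n + 1)) ∧ (∀ e, x * Φ.s e ∈ Φ.idealSpan H (n + 1)) ∧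
      ∀ e, x * Φ.t e ∈ Φ.idealSpan H (n + 1) := by
  refine ⟨fun d => mul_mem_of_mem_span' ?_ hx, fun e => mul_mem_of_mem_span' ?_ hx,
    fun e => mul_mem_of_mem_span' ?_ hx⟩ <;>
    rintro _ ⟨a, b, c, α, β, hc, hα, hβ, h, h', rfl⟩ <;> rw [mul_assoc]
  · by_cases hd : b = d
    · rw [← hd, Φ.ghost_mul_p hβ]
      exact Submodule.subset_span ⟨a, b, c, α, β, hc, hα, hβ, by omega, by omega, rfl⟩
    · rw [Φ.ghost_mul_p_of_ne hβ hd, mul_zero]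
      exact zero_mem _
  · cases β with
    | nil =>
      obtain rfl := hβ
      by_cases he : b = e.left
      · subst he
        rw [ghost_nil, Φ.p_mul_s, real_mul_s, ← Φ.real_mul_p, ← ghost_nil]
        exact Submodule.subset_span ⟨a, e.right, _, _, [], hH _ hc _ (.of_edge e),
          hα.append (isWalk_singleton e), rfl, by simpa using h, by simp, rfl⟩
      · rw [ghost_nil, Φ.p_mul_s_of_ne he, mul_zero]
        exact zero_mem _
    | cons f β =>
      by_cases he : f = e
      · subst he
        rw [Φ.ghost_cons_mul_s_self hβ]
        simp only [List.length_cons] at h'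
        exact Submodule.subset_span ⟨a, _, c, α, β, hc, hα, hβ.2, by omega, by omega, rfl⟩
      · rw [Φ.ghost_cons_mul_s_of_ne he, mul_zero]
        exact zero_mem _
  · by_cases he : b = e.right
    · rw [← ghost_cons]
      exact Submodule.subset_span ⟨a, e.left, c, α, e :: β, hc, hα, ⟨rfl, he ▸ hβ⟩,
        by omega, by simpa using h', rfl⟩
    · rw [← Φ.p_mul_t, ← mul_assoc (Φ.ghost β c), Φ.ghost_mul_p_of_ne hβ he, zero_mul, mul_zero]
      exact zero_mem _

theorem mul_mem_idealSpan {H : Set F} (hH : IsHereditary H) (y : A) :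
    (∀ x n, x ∈ Φ.idealSpan H n → ∃ m, y * x ∈ Φ.idealSpan H m) ∧
      ∀ x n, x ∈ Φ.idealSpan H n → ∃ m, x * y ∈ Φ.idealSpan H m := by
  have hy : y ∈ NonUnitalAlgebra.adjoin K (Set.range Φ.p ∪ Set.range Φ.s ∪ Set.range Φ.t) := by
    rw [Φ.adjoin_eq_top]; trivial
  induction hy using NonUnitalAlgebra.adjoin_induction with
  | mem y hy =>
    rcases hy with (⟨a, rfl⟩ | ⟨e, rfl⟩) | ⟨e, rfl⟩
    · exact ⟨fun x n hx => ⟨_, (Φ.gen_mul_mem_idealSpan hH hx).1 a⟩,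
        fun x n hx => ⟨_, (Φ.mul_gen_mem_idealSpan hH hx).1 a⟩⟩
    · exact ⟨fun x n hx => ⟨_, (Φ.gen_mul_mem_idealSpan hH hx).2.1 e⟩,
        fun x n hx => ⟨_, (Φ.mul_gen_mem_idealSpan hH hx).2.1 e⟩⟩
    · exact ⟨fun x n hx => ⟨_, (Φ.gen_mul_mem_idealSpan hH hx).2.2 e⟩,
        fun x n hx => ⟨_, (Φ.mul_gen_mem_idealSpan hH hx).2.2 e⟩⟩
  | add y z _ _ hy hz =>
    refine ⟨fun x n hx => ?_, fun x n hx => ?_⟩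
    · obtain ⟨i, hi⟩ := hy.1 x n hx
      obtain ⟨j, hj⟩ := hz.1 x n hx
      refine ⟨max i j, ?_⟩
      rw [add_mul]
      exact add_mem (Φ.idealSpan_mono H (le_max_left _ _) hi)
        (Φ.idealSpan_mono H (le_max_right _ _) hj)
    · obtain ⟨i, hi⟩ := hy.2 x n hx
      obtain ⟨j, hj⟩ := hz.2 x n hx
      refine ⟨max i j, ?_⟩
      rw [mul_add]
      exact add_mem (Φ.idealSpan_mono H (le_max_left _ _) hi)
        (Φ.idealSpan_mono H (le_max_right _ _) hj)
  | zero => exact ⟨fun x n _ => ⟨0, by simp⟩, fun x n _ => ⟨0, by simp⟩⟩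
  | mul y z _ _ hy hz =>
    refine ⟨fun x n hx => ?_, fun x n hx => ?_⟩
    · obtain ⟨i, hi⟩ := hz.1 x n hx
      rw [mul_assoc]
      exact hy.1 _ i hi
    · obtain ⟨i, hi⟩ := hy.2 x n hx
      rw [← mul_assoc]
      exact hz.2 _ i hi
  | smul k y _ hy =>
    refine ⟨fun x n hx => ?_, fun x n hx => ?_⟩
    · obtain ⟨i, hi⟩ := hy.1 x n hx
      exact ⟨i, by rw [smul_mul_assoc]; exact Submodule.smul_mem _ _ hi⟩
    · obtain ⟨i, hi⟩ := hy.2 x n hx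
      exact ⟨i, by rw [mul_smul_comm]; exact Submodule.smul_mem _ _ hi⟩

theorem exists_mem_idealSpan {H : Set F} (hH : IsHereditary H) {x : A}
    (hx : x ∈ TwoSidedIdeal.span (Φ.p '' H)) : ∃ n, x ∈ Φ.idealSpan H n := by
  let M : TwoSidedIdeal A := .mk' {x | ∃ n, x ∈ Φ.idealSpan H n}
    ⟨0, zero_mem _⟩
    (by
      rintro x y ⟨i, hi⟩ ⟨j, hj⟩
      exact ⟨max i j, add_mem (Φ.idealSpan_mono H (le_max_left _ _) hi)
        (Φ.idealSpan_mono H (le_max_right _ _) hj)⟩)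
    (by rintro x ⟨i, hi⟩; exact ⟨i, neg_mem hi⟩)
    (by rintro y x ⟨i, hi⟩; exact (Φ.mul_mem_idealSpan hH y).1 x i hi)
    (by rintro x y ⟨i, hi⟩; exact (Φ.mul_mem_idealSpan hH y).2 x i hi)
  have hM : ∀ x, x ∈ M ↔ ∃ n, x ∈ Φ.idealSpan H n := fun x => by simp [M]
  have hle : TwoSidedIdeal.span (Φ.p '' H) ≤ M := by
    rw [TwoSidedIdeal.span_le]
    rintro _ ⟨a, ha, rfl⟩
    refine (hM _).2 ⟨0, Submodule.subset_span
      ⟨a, a, a, [], [], ha, rfl, rfl, le_rfl, le_rfl, ?_⟩⟩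
    rw [real_nil, ghost_nil, Φ.p_mul_self]
  exact (hM x).1 (hle hx)

/-- If `a ∉ H`, every monomial starting at `a` has a first edge. Finitely many monomials use
finitely many first edges, which forces `a` to be regular; conjugating by an edge shows that its
range satisfies the hypothesis with smaller `n`. Saturation concludes. -/
theorem mem_of_p_mem_idealSpan (hp : ∀ a, Φ.p a ≠ 0) {H : Set F}
    (hsat : IsSaturated H) {n : ℕ} {a : F} (ha : Φ.p a ∈ Φ.idealSpan H n) : a ∈ H := by
  classical
  induction n generalizing a with
  | zero =>
    by_contra haH
    have key : ∀ x ∈ Φ.idealSpan H 0, Φ.p a * x = 0 := by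
      intro x hx
      induction hx using Submodule.span_induction with
      | mem x hx =>
        obtain ⟨b, b', c, α, β, hc, hα, hβ, h, h', rfl⟩ := hx
        obtain rfl := List.length_eq_zero_iff.1 (Nat.le_zero.1 h)
        rw [← mul_assoc, Φ.p_mul_real_of_ne hα, zero_mul]
        rintro rfl
        exact haH (hα ▸ hc)
      | zero => simp
      | add x y _ _ hx hy => rw [mul_add, hx, hy, add_zero]
      | smul k x _ hx => rw [mul_smul_comm, hx, smul_zero]
    exact hp a (by rw [← Φ.p_mul_self, key _ ha])
  | succ n ih =>
    by_contra haH
    -- Here `T` collects the first edges at `a` that occur in an expression of `x`.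
    have key : ∀ x ∈ Φ.idealSpan H (n + 1), (∃ T : Finset (Quiver.Total F),
        (∀ e ∈ T, e.left = a) ∧ (∀ f, f ∉ T → Φ.t f * (Φ.p a * x) = 0) ∧
          (T = ∅ → Φ.p a * x = 0)) ∧
        ∀ f : Quiver.Total F, f.left = a → Φ.t f * x * Φ.s f ∈ Φ.idealSpan H n := by
      intro x hx
      induction hx using Submodule.span_induction with
      | mem x hx =>
        obtain ⟨b, b', c, α, β, hc, hα, hβ, h, h', rfl⟩ := hx
        by_cases hb : a = b
        · subst hb
          cases α with
          | nil => exact (haH (hα.symm ▸ hc)).elim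
          | cons e α =>
            refine ⟨⟨{e}, fun f hf => ?_, fun f hf => ?_, by simp⟩, fun f hfa => ?_⟩
            · rw [Finset.mem_singleton.1 hf]; exact hα.1
            · rw [← mul_assoc (Φ.p a), Φ.p_mul_real hα, ← mul_assoc,
                Φ.t_mul_real_cons_of_ne (by simpa using hf), zero_mul]
            · by_cases hfe : f = e
              · subst hfe
                rw [← mul_assoc, Φ.t_mul_real_cons_self hα, mul_assoc]
                cases β with
                | nil =>
                  obtain rfl := hβ
                  by_cases hb'a : b' = f.left
                  · exact (haH (hfa ▸ hb'a ▸ hc)).elim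
                  · rw [ghost_nil, Φ.p_mul_s_of_ne hb'a, mul_zero]
                    exact zero_mem _
                | cons g β =>
                  by_cases hg : g = f
                  · subst hg
                    rw [Φ.ghost_cons_mul_s_self hβ]
                    exact Submodule.subset_span ⟨_, _, c, α, β, hc, hα.2, hβ.2,
                      by simpa using h, by simpa using h', rfl⟩
                  · rw [Φ.ghost_cons_mul_s_of_ne hg, mul_zero]
                    exact zero_mem _
              · rw [← mul_assoc, Φ.t_mul_real_cons_of_ne hfe, zero_mul, zero_mul]
                exact zero_mem _
        · have h0 : Φ.p a * (Φ.real α c * Φ.ghost β c) = 0 := by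
            rw [← mul_assoc, Φ.p_mul_real_of_ne hα hb, zero_mul]
          refine ⟨⟨∅, by simp, fun f _ => by rw [h0, mul_zero], fun _ => h0⟩, fun f hfa => ?_⟩
          rw [← Φ.t_mul_p, hfa, mul_assoc (Φ.t f), h0, mul_zero, zero_mul]
          exact zero_mem _
      | zero => exact ⟨⟨∅, by simp, by simp, by simp⟩, by simp⟩
      | add x y _ _ hx hy =>
        obtain ⟨⟨T, h1, h2, h3⟩, h4⟩ := hx
        obtain ⟨⟨T', h1', h2', h3'⟩, h4'⟩ := hy
        refine ⟨⟨T ∪ T', fun e he => (Finset.mem_union.1 he).elim (h1 e) (h1' e), fun f hf => ?_,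
          fun hT => ?_⟩, fun f hf => ?_⟩
        · rw [Finset.mem_union, not_or] at hf
          rw [mul_add, mul_add, h2 f hf.1, h2' f hf.2, add_zero]
        · rw [Finset.union_eq_empty] at hT
          rw [mul_add, h3 hT.1, h3' hT.2, add_zero]
        · rw [mul_add, add_mul]
          exact add_mem (h4 f hf) (h4' f hf)
      | smul k x _ hx =>
        obtain ⟨⟨T, h1, h2, h3⟩, h4⟩ := hx
        refine ⟨⟨T, h1, fun f hf => ?_, fun hT => ?_⟩, fun f hf => ?_⟩
        · rw [mul_smul_comm, mul_smul_comm, h2 f hf, smul_zero]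
        · rw [mul_smul_comm, h3 hT, smul_zero]
        · rw [mul_smul_comm, smul_mul_assoc]
          exact Submodule.smul_mem _ _ (h4 f hf)
    obtain ⟨⟨T, h1, h2, h3⟩, h4⟩ := key _ ha
    rw [Φ.p_mul_self] at h2 h3
    -- An edge outside `T` would have `f* = f* a = 0`, although `f* f` is a nonzero vertex.
    have hT : ∀ f : Quiver.Total F, f.left = a → f ∈ T := by
      intro f hf
      by_contra hfT
      have := h2 f hfT
      rw [← hf, Φ.t_mul_p] at this
      exact hp f.right (by rw [← Φ.t_mul_s_self, this, zero_mul])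
    have hfin : Finite (Quiver.Star a) := by
      refine Finite.of_injective (β := T) (fun e => ⟨⟨a, e.1, e.2⟩, hT _ rfl⟩) ?_
      rintro ⟨c, e⟩ ⟨c', e'⟩ h
      simpa using h
    have hne : Nonempty (Quiver.Star a) := by
      obtain ⟨e, he⟩ := Finset.nonempty_iff_ne_empty.2 fun h => hp a (h3 h)
      obtain rfl := h1 e he
      exact ⟨⟨e.right, e.hom⟩⟩
    refine haH (hsat a ⟨hne, hfin⟩ fun e => ih ?_)
    have := h4 ⟨a, e.1, e.2⟩ rfl
    rwa [Φ.t_mul_p ⟨a, e.1, e.2⟩, Φ.t_mul_s_self] at this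

theorem mem_of_p_mem_span (hp : ∀ a, Φ.p a ≠ 0) {H : Set F} (hH : IsHereditary H)
    (hsat : IsSaturated H) {a : F} (ha : Φ.p a ∈ TwoSidedIdeal.span (Φ.p '' H)) : a ∈ H := by
  obtain ⟨n, hn⟩ := Φ.exists_mem_idealSpan hH ha
  exact Φ.mem_of_p_mem_idealSpan hp hsat hn

end CKFamily

/-! ### Ideal-theoretic consequences of the reduction theorem. -/

namespace CKFamily

set_option linter.unusedSectionVars false

variable {K : Type w} [Field K] {F : Type u} [Quiver.{v} F] {A : Type*}
    [NonUnitalRing A] [Module K A] [IsScalarTower K A A] [SMulCommClass K A A]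
    {Φ : CKFamily K F A}

theorem p_mem_of_smul_mem {J : TwoSidedIdeal A} {k : K} (hk : k ≠ 0) {a : F}
    (h : k • Φ.p a ∈ J) : Φ.p a ∈ J := by
  have := J.mul_mem_left (k⁻¹ • Φ.p a) _ h
  rwa [smul_mul_assoc, mul_smul_comm, Φ.p_mul_self, smul_smul, inv_mul_cancel₀ hk,
    one_smul] at this

/-- A non-zero ideal contains a vertex or a non-zero element of the corner at a vertex on a closed
path without exits. -/
theorem exists_of_ne_bot (hp : ∀ a, Φ.p a ≠ 0) {J : TwoSidedIdeal A} (hJ : J ≠ ⊥) :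
    (∃ a, Φ.p a ∈ J) ∨ ∃ a x, IsNoExit a ∧ x ∈ J ∧ x ≠ 0 ∧ Φ.p a * x * Φ.p a = x := by
  obtain ⟨x, hx, hx0⟩ : ∃ x ∈ J, x ≠ 0 := by
    by_contra! h
    exact hJ (eq_bot_iff.2 fun x hx => (TwoSidedIdeal.mem_bot A).2 (h x hx))
  obtain ⟨-, -, y, z, a, -, -, ⟨k, hk, h⟩ | ⟨ha, h1, h2⟩⟩ := Φ.reduction hp hx0
  · refine Or.inl ⟨a, p_mem_of_smul_mem hk ?_⟩
    rw [← h]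
    exact J.mul_mem_right _ _ (J.mul_mem_left _ _ hx)
  · exact Or.inr ⟨a, _, ha, J.mul_mem_right _ _ (J.mul_mem_left _ _ hx), h1, h2⟩

theorem exists_p_mem_of_conditionL (hp : ∀ a, Φ.p a ≠ 0) (hL : ConditionL F)
    {J : TwoSidedIdeal A} (hJ : J ≠ ⊥) : ∃ a, Φ.p a ∈ J :=
  (exists_of_ne_bot hp hJ).resolve_right fun ⟨_, _, ha, _⟩ => ha.not_conditionL hL

/-- A nonzero monomial `α β*` between `a` and `b` passes through a common descendant; without one,
`p a * A * p b = 0` contradicts primeness. -/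
theorem downwardDirected_of_prime {J : TwoSidedIdeal A}
    (hJ : ∀ x y, x * y ∈ J → (∀ z, x * z * y ∈ J) → x ∈ J ∨ y ∈ J) (hv : ∀ a, Φ.p a ∉ J)
    (htop : J ≠ ⊤) : DownwardDirected F := by
  constructor
  · by_contra h
    rw [not_nonempty_iff] at h
    refine htop (eq_top_iff.2 fun x _ => ?_)
    rw [Φ.eq_zero_of_forall_mul_p (x := x) h.elim]
    exact zero_mem _
  · intro a b
    by_contra! hcon
    have key : ∀ z, Φ.p a * z * Φ.p b = 0 := by
      intro z
      induction Φ.mem_span_monomials z using Submodule.span_induction with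
      | mem z hz =>
        obtain ⟨c, d, c', α, β, hα, hβ, rfl⟩ := hz
        by_cases hc : a = c
        · by_cases hd : d = b
          · subst hc hd
            exact (hcon c' hα.reaches hβ.reaches).elim
          · rw [mul_assoc, mul_assoc, Φ.ghost_mul_p_of_ne hβ hd, mul_zero, mul_zero]
        · rw [← mul_assoc, Φ.p_mul_real_of_ne hα hc, zero_mul, zero_mul]
      | zero => simp
      | add x y _ _ hx hy => rw [mul_add, add_mul, hx, hy, add_zero]
      | smul k x _ hx => rw [mul_smul_comm, smul_mul_assoc, hx, smul_zero]
    rcases hJ (Φ.p a) (Φ.p b) (by rw [← Φ.p_mul_self a, key]; exact zero_mem _)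
      (fun z => by rw [key]; exact zero_mem _) with h | h
    exacts [hv a h, hv b h]

/-- Elements lying in all ideals which properly contain a given prime ideal without vertices. -/
theorem exists_forall_lt_mem (hp : ∀ a, Φ.p a ≠ 0) {J : TwoSidedIdeal A}
    (hJ : ∀ x y, x * y ∈ J → (∀ z, x * z * y ∈ J) → x ∈ J ∨ y ∈ J) (hv : ∀ a, Φ.p a ∉ J)
    (hne : Nonempty F) (hbot : J = ⊥ → ConditionL F) (hcsp : StrongCSP F) :
    ∃ y ∉ J, ∀ Q, J < Q → y ∈ Q := by
  by_cases h0 : J = ⊥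
  · obtain ⟨C, ⟨-, hC⟩, hC'⟩ := hcsp
    obtain ⟨c, hc, -⟩ := hC hne.some
    refine ⟨Φ.p c, hv c, fun Q hQ => ?_⟩
    obtain ⟨a, ha⟩ := exists_p_mem_of_conditionL hp (hbot h0) (h0 ▸ hQ).ne'
    exact hC' {a | Φ.p a ∈ Q} ⟨a, ha⟩ (Φ.isHereditary_vertices Q) (Φ.isSaturated_vertices Q) hc
  · obtain ⟨a, x, ha, hxJ, hx0, hxa⟩ :=
      (exists_of_ne_bot hp h0).resolve_left fun ⟨a, ha⟩ => hv a ha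
    obtain ⟨l, hl⟩ := exists_isLoop ha
    exact ⟨Φ.p a, hv a, fun Q hQ => p_mem_of_prime_lt hl hJ (hv a) hxJ hx0 hxa hQ⟩

-- Euclid's argument. A vertex `a` on a closed path without exits lets `y` be compressed to a
-- polynomial `g ≠ 0`. The ideal of `X * g + 1` misses `a`, but an ideal containing it and `y`
-- contains `a`.
open Polynomial in
theorem conditionL_of_forall_mem (hp : ∀ a, Φ.p a ≠ 0)
    (hprime : ∀ x y : A, x * y = 0 → (∀ z, x * z * y = 0) → x = 0 ∨ y = 0)
    (hinj : ∀ a l, IsLoop a l → Function.Injective (Φ.polyEval a l)) {y : A} (hy0 : y ≠ 0)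
    (hy : ∀ (N : TwoSidedIdeal A) (e : A), e * e = e → N ≠ ⊥ → e ∉ N →
      ∃ Q, N ≤ Q ∧ e ∉ Q ∧ y ∈ Q) : ConditionL F := by
  refine conditionL_of_forall_not_isNoExit fun a ha => ?_
  obtain ⟨l, hl⟩ := exists_isLoop ha
  have hw := hl.2.2.1
  obtain ⟨z, hz⟩ : ∃ z, Φ.p a * z * y ≠ 0 := by
    by_contra! hcon
    rcases hprime (Φ.p a) y (by simpa [Φ.p_mul_self] using hcon (Φ.p a)) hcon with h' | h'
    exacts [hp a h', hy0 h']
  obtain ⟨z', hz'⟩ : ∃ z', Φ.p a * z * y * z' * Φ.p a ≠ 0 := by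
    by_contra! hcon
    rcases hprime (Φ.p a * z * y) (Φ.p a)
      (by simpa [mul_assoc, Φ.p_mul_self] using hcon (Φ.p a)) hcon with h' | h'
    exacts [hz h', hp a h']
  obtain ⟨n, g, hg⟩ := exists_p_mul_mul_polyEval_eq (Φ := Φ) hl (z * y * z' * Φ.p a)
  have hg0 : g ≠ 0 := by
    rintro rfl
    refine hz' ((TwoSidedIdeal.mem_bot A).1 (mem_of_polyEval_mem (Φ := Φ) (n := n) (f := 0) hl
      ?_ ?_ ?_))
    · rw [mul_assoc, Φ.p_mul_self]
    · rw [← hg]; simp only [mul_assoc]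
    · rw [map_zero]; exact zero_mem _
  -- Coprime to `g`, with constant term `1` and positive degree, hence not a unit even among Laurent
  -- polynomials.
  set q : K[X] := X * g + 1 with hq
  have hq0 : q.coeff 0 = 1 := by simp [hq]
  have hqdeg : q.natDegree = g.natDegree + 1 := by
    rw [hq, ← C_1, natDegree_add_C, natDegree_X_mul hg0]
  have hnotMem := p_notMem_span_polyEval (Φ := Φ) hl (hinj a l hl) (q := q)
    (by rw [hq0]; exact one_ne_zero) (by omega)
  have hqmem : Φ.polyEval a l q ∈ TwoSidedIdeal.span {Φ.polyEval a l q} :=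
    TwoSidedIdeal.subset_span rfl
  obtain ⟨Q, hNQ, haQ, hyQ⟩ := hy _ _ (Φ.p_mul_self a) (fun hbot => by
    rw [hbot, TwoSidedIdeal.mem_bot] at hqmem
    have : q = 0 := hinj a l hl (by rw [hqmem, map_zero])
    rw [this, natDegree_zero] at hqdeg
    omega) hnotMem
  refine haQ ?_
  have h1 : Φ.polyEval a l g ∈ Q := by
    rw [← hg]
    refine Q.mul_mem_right _ _ (Q.mul_mem_left _ _ ?_)
    exact Q.mul_mem_right _ _ (Q.mul_mem_right _ _ (Q.mul_mem_left _ _ hyQ))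
  have h2 : Φ.p a = Φ.polyEval a l q - Φ.polyEval a l X * Φ.polyEval a l g := by
    rw [hq, map_add, Φ.polyEval_mul hw, polyEval_one, add_sub_cancel_left]
  rw [h2]
  exact Q.sub_mem (hNQ hqmem) (Q.mul_mem_left _ _ h1)

/-- Condition (L) yields a vertex `u` in the ideal of `y`. If a nonempty hereditary saturated `H`
missed `u`, so would the ideal of `H`, and `hy` would give an ideal containing `y` but not `u`. -/
theorem strongCSP_of_forall_mem (hp : ∀ a, Φ.p a ≠ 0) (hdd : DownwardDirected F)
    (hL : ConditionL F) {y : A} (hy0 : y ≠ 0)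
    (hy : ∀ (N : TwoSidedIdeal A) (e : A), e * e = e → N ≠ ⊥ → e ∉ N →
      ∃ Q, N ≤ Q ∧ e ∉ Q ∧ y ∈ Q) : StrongCSP F := by
  obtain ⟨u, hu⟩ := exists_p_mem_of_conditionL (Φ := Φ) hp hL (J := TwoSidedIdeal.span {y})
    fun hbot => hy0 <| by
      rw [← TwoSidedIdeal.mem_bot A, ← hbot]
      exact TwoSidedIdeal.subset_span rfl
  refine LPA.strongCSP_of_forall_mem hdd (u := u) fun H ⟨b, hb⟩ hH hsat => ?_
  by_contra huH
  have hbmem : Φ.p b ∈ TwoSidedIdeal.span (Φ.p '' H) :=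
    TwoSidedIdeal.subset_span ⟨b, hb, rfl⟩
  obtain ⟨Q, -, huQ, hyQ⟩ := hy (TwoSidedIdeal.span (Φ.p '' H)) (Φ.p u) (Φ.p_mul_self u)
    (fun hbot => by
      rw [hbot, TwoSidedIdeal.mem_bot] at hbmem
      exact hp b hbmem)
    fun h => huH (Φ.mem_of_p_mem_span hp hH hsat h)
  have hle : TwoSidedIdeal.span {y} ≤ Q := by
    rw [TwoSidedIdeal.span_le]
    rintro _ rfl
    exact hyQ
  exact huQ (hle hu)

end CKFamily

/-! ### The Leavitt path algebra: generators, grading, quotients. -/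

section Leavitt

variable (K : Type w) [Field K] (V : Type u) [Quiver.{v} V]

open Gen

/-- The inclusion of the Leavitt path algebra into the unital algebra with the same presentation. -/
def toUnital : LeavittPathAlgebra K V →ₙₐ[K] RingQuot (Rel K V) :=
  NonUnitalSubalgebraClass.subtype (NonUnitalAlgebra.adjoin K (Set.range (unitalGen K V)))

theorem toUnital_injective : Function.Injective (toUnital K V) := Subtype.val_injective

theorem toUnital_gen (g : Gen V) : toUnital K V (gen K g) = unitalGen K V g := rfl

variable {K V} in
theorem leavitt_adjoin_induction {M : LeavittPathAlgebra K V → Prop} (h : ∀ g, M (gen K g))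
    (zero : M 0) (add : ∀ x y, M x → M y → M (x + y)) (mul : ∀ x y, M x → M y → M (x * y))
    (smul : ∀ (k : K) x, M x → M (k • x)) (x : LeavittPathAlgebra K V) : M x := by
  obtain ⟨x, hx⟩ := x
  induction hx using NonUnitalAlgebra.adjoin_induction with
  | mem x hx => obtain ⟨g, rfl⟩ := hx; exact h g
  | add x y hx hy h1 h2 => exact add ⟨x, hx⟩ ⟨y, hy⟩ h1 h2
  | zero => exact zero
  | mul x y hx hy h1 h2 => exact mul ⟨x, hx⟩ ⟨y, hy⟩ h1 h2
  | smul k x hx h1 => exact smul k ⟨x, hx⟩ h1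

/-- The generating family of the Leavitt path algebra. -/
def leavittFamily : CKFamily K V (LeavittPathAlgebra K V) where
  p a := gen K (vertex a)
  s e := gen K (edge e)
  t e := gen K (ghost e)
  p_mul_self a := by
    apply toUnital_injective
    simpa [toUnital_gen, unitalGen] using RingQuot.mkAlgHom_rel K (Rel.idem (K := K) a)
  p_mul_p_of_ne a b h := by
    apply toUnital_injective
    simpa [toUnital_gen, unitalGen] using RingQuot.mkAlgHom_rel K (Rel.orth (K := K) a b h)
  p_mul_s e := by
    apply toUnital_injective
    simpa [toUnital_gen, unitalGen] using RingQuot.mkAlgHom_rel K (Rel.source_edge (K := K) e)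
  s_mul_p e := by
    apply toUnital_injective
    simpa [toUnital_gen, unitalGen] using RingQuot.mkAlgHom_rel K (Rel.edge_range (K := K) e)
  p_mul_t e := by
    apply toUnital_injective
    simpa [toUnital_gen, unitalGen] using RingQuot.mkAlgHom_rel K (Rel.range_ghost (K := K) e)
  t_mul_p e := by
    apply toUnital_injective
    simpa [toUnital_gen, unitalGen] using RingQuot.mkAlgHom_rel K (Rel.ghost_source (K := K) e)
  t_mul_s_self e := by
    apply toUnital_injective
    simpa [toUnital_gen, unitalGen] using RingQuot.mkAlgHom_rel K (Rel.ck1_same (K := K) e)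
  t_mul_s_of_ne e f h := by
    apply toUnital_injective
    simpa [toUnital_gen, unitalGen] using RingQuot.mkAlgHom_rel K (Rel.ck1_ne (K := K) e f h)
  finsum_s_mul_t a h := by
    have := h.1
    have := h.2
    cases nonempty_fintype (Quiver.Star a)
    apply toUnital_injective
    rw [finsum_eq_sum_of_fintype]
    simpa [toUnital_gen, unitalGen] using (RingQuot.mkAlgHom_rel K (Rel.ck2 (K := K) a)).symm
  adjoin_eq_top := by
    rw [eq_top_iff]
    intro x _
    refine leavitt_adjoin_induction (fun g => NonUnitalAlgebra.subset_adjoin K ?_) (zero_mem _)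
      (fun x y hx hy => add_mem hx hy) (fun x y hx hy => mul_mem hx hy)
      (fun k x hx => SMulMemClass.smul_mem k hx) x
    cases g with
    | vertex a => exact Or.inl (Or.inl ⟨a, rfl⟩)
    | edge e => exact Or.inl (Or.inr ⟨e, rfl⟩)
    | ghost e => exact Or.inr ⟨e, rfl⟩

variable {V}

theorem exists_isWalk_of_path {a c : V} (α : Quiver.Path a c) : ∃ l, IsWalk a l c ∧
    l.length = α.length ∧ ofPath K α = (leavittFamily K V).real l c ∧
      ofGhostPath K α = (leavittFamily K V).ghost l c := by
  induction α with
  | nil => exact ⟨[], rfl, rfl, rfl, rfl⟩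
  | @cons b c p e ih =>
    obtain ⟨l, h1, h2, h3, h4⟩ := ih
    refine ⟨l ++ [⟨b, c, e⟩], h1.append (isWalk_singleton ⟨b, c, e⟩), by simp [h2], ?_, ?_⟩
    · rw [ofPath, h3]
      exact (leavittFamily K V).real_mul_s ⟨b, c, e⟩
    · rw [ofGhostPath, h4]
      exact (leavittFamily K V).t_mul_ghost ⟨b, c, e⟩

theorem exists_path_of_isWalk {a c : V} {l : List (Quiver.Total V)} (h : IsWalk a l c) :
    ∃ α : Quiver.Path a c, l.length = α.length ∧ ofPath K α = (leavittFamily K V).real l c ∧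
      ofGhostPath K α = (leavittFamily K V).ghost l c := by
  induction l using List.reverseRecOn generalizing c with
  | nil => obtain rfl := h; exact ⟨.nil, rfl, rfl, rfl⟩
  | append_singleton l e ih =>
    obtain ⟨b, h1, rfl, rfl⟩ := isWalk_append.1 h
    obtain ⟨α, h2, h3, h4⟩ := ih h1
    refine ⟨α.cons e.hom, by simp [h2], ?_, ?_⟩
    · rw [ofPath, h3]
      exact (leavittFamily K V).real_mul_s e
    · rw [ofGhostPath, h4]
      exact (leavittFamily K V).t_mul_ghost e

theorem component_eq_deg (n : ℤ) : component K V n = (leavittFamily K V).deg n := by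
  refine congrArg (Submodule.span K) (Set.ext fun x => ⟨?_, ?_⟩)
  · rintro ⟨a, b, c, α, β, hn, rfl⟩
    obtain ⟨l, h1, h2, h3, -⟩ := exists_isWalk_of_path K α
    obtain ⟨l', h1', h2', -, h4'⟩ := exists_isWalk_of_path K β
    exact ⟨a, b, c, l, l', h1, h1', by rw [h2, h2', hn], by rw [h3, h4']⟩
  · rintro ⟨a, b, c, l, l', h1, h1', hn, rfl⟩
    obtain ⟨α, h2, h3, -⟩ := exists_path_of_isWalk K h1
    obtain ⟨β, h2', -, h4'⟩ := exists_path_of_isWalk K h1'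
    exact ⟨a, b, c, α, β, by rw [← h2, ← h2', hn], by rw [h3, h4']⟩

variable (V)

/-- A homomorphism from the unital algebra with the same presentation as the Leavitt path algebra. -/
def unitalLift {B : Type*} [Ring B] [Algebra K B] (f : Gen V → B)
    (hf : ∀ x y, Rel K V x y → FreeAlgebra.lift K f x = FreeAlgebra.lift K f y) :
    RingQuot (Rel K V) →ₐ[K] B :=
  RingQuot.liftAlgHom K ⟨FreeAlgebra.lift K f, fun x y h => hf x y h⟩

variable {V} in
theorem unitalLift_unitalGen {B : Type*} [Ring B] [Algebra K B] (f : Gen V → B)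
    (hf : ∀ x y, Rel K V x y → FreeAlgebra.lift K f x = FreeAlgebra.lift K f y) (g : Gen V) :
    unitalLift K V f hf (unitalGen K V g) = f g := by
  rw [unitalLift, unitalGen, RingQuot.liftAlgHom_mkAlgHom_apply]
  exact FreeAlgebra.lift_ι_apply _ _

/-- The grading, as a coaction. -/
def coaction : RingQuot (Rel K V) →ₐ[K] AddMonoidAlgebra (RingQuot (Rel K V)) ℤ :=
  unitalLift K V
    (fun g => AddMonoidAlgebra.single
      (match g with
        | vertex _ => 0
        | edge _ => 1
        | ghost _ => -1) (unitalGen K V g)) (by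
    have hrel : ∀ {x y}, Rel K V x y →
        RingQuot.mkAlgHom K (Rel K V) x = RingQuot.mkAlgHom K (Rel K V) y :=
      fun h => RingQuot.mkAlgHom_rel K h
    intro x y h
    have h' := hrel h
    cases h with
    | ck2 a =>
      simp only [map_mul, map_sum, FreeAlgebra.lift_ι_apply,
        AddMonoidAlgebra.single_mul_single] at h' ⊢
      rw [unitalGen, h']
      exact map_sum (AddMonoidAlgebra.singleAddHom (0 : ℤ)) _ _
    | _ =>
      simp only [map_mul, map_zero, FreeAlgebra.lift_ι_apply,
        AddMonoidAlgebra.single_mul_single, unitalGen] at h' ⊢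
      rw [h']
      simp)

end Leavitt

section Leavitt

variable {K : Type w} [Field K] {V : Type u} [Quiver.{v} V]

open Gen

theorem coaction_toUnital {n : ℤ} {x : LeavittPathAlgebra K V} (hx : x ∈ component K V n) :
    coaction K V (toUnital K V x) = AddMonoidAlgebra.single n (toUnital K V x) := by
  have hreal : ∀ (l : List (Quiver.Total V)) (c : V),
      coaction K V (toUnital K V ((leavittFamily K V).real l c)) =
        AddMonoidAlgebra.single (l.length : ℤ) (toUnital K V ((leavittFamily K V).real l c)) := by
    intro l c
    induction l with
    | nil => exact unitalLift_unitalGen _ _ _ _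
    | cons e l ih =>
      rw [CKFamily.real_cons, map_mul, map_mul, ih]
      change coaction K V (unitalGen K V (edge e)) * _ = _
      rw [coaction, unitalLift_unitalGen, AddMonoidAlgebra.single_mul_single, List.length_cons,
        Nat.cast_succ, add_comm]
      rfl
  have hghost : ∀ (l : List (Quiver.Total V)) (c : V),
      coaction K V (toUnital K V ((leavittFamily K V).ghost l c)) =
        AddMonoidAlgebra.single (-l.length : ℤ)
          (toUnital K V ((leavittFamily K V).ghost l c)) := by
    intro l c
    induction l with
    | nil => exact unitalLift_unitalGen _ _ _ _
    | cons e l ih =>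
      rw [CKFamily.ghost_cons, map_mul, map_mul, ih]
      change _ * coaction K V (unitalGen K V (ghost e)) = _
      rw [coaction, unitalLift_unitalGen, AddMonoidAlgebra.single_mul_single, List.length_cons,
        Nat.cast_succ, neg_add]
      rfl
  rw [component_eq_deg] at hx
  induction hx using Submodule.span_induction with
  | mem x hx =>
    obtain ⟨a, b, c, α, β, -, -, rfl, rfl⟩ := hx
    rw [map_mul, map_mul, hreal, hghost, AddMonoidAlgebra.single_mul_single, sub_eq_add_neg]
  | zero => simp
  | add x y _ _ hx hy => rw [map_add, map_add, hx, hy, AddMonoidAlgebra.single_add]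
  | smul k x _ hx => rw [map_smul, map_smul, hx, AddMonoidAlgebra.smul_single]

/-- A graded ideal contains the homogeneous components of its elements. -/
theorem IsGraded.mem_of_sum_mem {P : TwoSidedIdeal (LeavittPathAlgebra K V)} (hP : IsGraded P)
    {ι : Type*} {d : ι → ℤ} (hd : Function.Injective d) {y : ι → LeavittPathAlgebra K V}
    (hy : ∀ i, y i ∈ component K V (d i)) {s : Finset ι} (hs : ∑ i ∈ s, y i ∈ P) {i : ι}
    (hi : i ∈ s) : y i ∈ P := by
  classical
  -- The coefficients of the coaction stay in a graded ideal; on a sum of homogeneous elements of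
  -- distinct degrees they return the summands.
  have key : ∀ x ∈ P, ∀ n, ∃ z ∈ P, toUnital K V z = (coaction K V (toUnital K V x)).coeff n := by
    intro x hx n
    have hx' := hP x hx
    clear hx
    induction hx' using AddSubgroup.closure_induction with
    | mem x hx =>
      obtain ⟨hxP, m, hm⟩ := hx
      rw [coaction_toUnital hm, AddMonoidAlgebra.coeff_single, Finsupp.single_apply]
      split_ifs
      · exact ⟨x, hxP, rfl⟩
      · exact ⟨0, zero_mem _, map_zero _⟩
    | zero => exact ⟨0, zero_mem _, by simp⟩
    | add x y _ _ hx hy =>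
      obtain ⟨z, hz, h⟩ := hx
      obtain ⟨z', hz', h'⟩ := hy
      exact ⟨z + z', add_mem hz hz', by simp [h, h']⟩
    | neg x _ hx =>
      obtain ⟨z, hz, h⟩ := hx
      refine ⟨-z, neg_mem hz, ?_⟩
      rw [map_neg, h, map_neg, map_neg, ← add_eq_zero_iff_neg_eq, ← Finsupp.add_apply,
        ← AddMonoidAlgebra.coeff_add, add_neg_cancel, AddMonoidAlgebra.coeff_zero,
        Finsupp.zero_apply]
  obtain ⟨z, hz, h⟩ := key _ hs (d i)
  have : toUnital K V z = toUnital K V (y i) := by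
    rw [h, map_sum, map_sum, AddMonoidAlgebra.coeff_sum, Finsupp.finsetSum_apply,
      Finset.sum_eq_single i]
    · rw [coaction_toUnital (hy i), AddMonoidAlgebra.coeff_single, Finsupp.single_eq_same]
    · intro j _ hj
      rw [coaction_toUnital (hy j), AddMonoidAlgebra.coeff_single,
        Finsupp.single_eq_of_ne (fun h => hj (hd h).symm)]
    · exact fun h => (h hi).elim
  exact toUnital_injective K V this ▸ hz

/-- The algebra is spanned by homogeneous elements, so the additive group generated by the
homogeneous elements of `P` is already an ideal. -/
theorem isGraded_of_gradedPart_eq {P : TwoSidedIdeal (LeavittPathAlgebra K V)}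
    (h : gradedPart P = P) : IsGraded P := by
  let C := AddSubgroup.closure (homogeneousElements P)
  have hmul : ∀ x ∈ C, ∀ y, y * x ∈ C ∧ x * y ∈ C := by
    intro x hx y
    have hy : y ∈ ⨆ n, (leavittFamily K V).deg n := by
      rw [CKFamily.iSup_deg_eq_top]; trivial
    refine Submodule.iSup_induction _ (motive := fun y => y * x ∈ C ∧ x * y ∈ C) hy ?_
      ⟨by simp, by simp⟩ (fun y z hy hz => by
        rw [add_mul, mul_add]; exact ⟨add_mem hy.1 hz.1, add_mem hy.2 hz.2⟩)
    intro n y hy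
    induction hx using AddSubgroup.closure_induction with
    | mem x hx =>
      obtain ⟨hxP, m, hm⟩ := hx
      rw [component_eq_deg] at hm
      refine ⟨AddSubgroup.subset_closure ⟨P.mul_mem_left _ _ hxP, n + m, ?_⟩,
        AddSubgroup.subset_closure ⟨P.mul_mem_right _ _ hxP, m + n, ?_⟩⟩
      · rw [component_eq_deg]; exact (leavittFamily K V).mul_mem_deg hy hm
      · rw [component_eq_deg]; exact (leavittFamily K V).mul_mem_deg hm hy
    | zero => simp
    | add x z _ _ hx hz =>
      rw [add_mul, mul_add]; exact ⟨add_mem hx.1 hz.1, add_mem hx.2 hz.2⟩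
    | neg x _ hx =>
      rw [neg_mul, mul_neg]; exact ⟨neg_mem hx.1, neg_mem hx.2⟩
  let M : TwoSidedIdeal (LeavittPathAlgebra K V) := .mk' C C.zero_mem C.add_mem C.neg_mem
    (fun {x y} hy => (hmul y hy x).1) (fun {x y} hx => (hmul x hx y).2)
  have hM : ∀ x, x ∈ M ↔ x ∈ C := fun x => TwoSidedIdeal.mem_mk' _ _ _ _ _ _ _
  have hle : gradedPart P ≤ M :=
    TwoSidedIdeal.span_le.2 fun x hx => (hM x).2 (AddSubgroup.subset_closure hx)
  exact fun x hx => (hM x).1 (hle (h.symm ▸ hx))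

theorem gradedPart_le (P : TwoSidedIdeal (LeavittPathAlgebra K V)) : gradedPart P ≤ P :=
  TwoSidedIdeal.span_le.2 fun _ hx => hx.1

theorem IsGraded.gradedPart_eq {P : TwoSidedIdeal (LeavittPathAlgebra K V)} (h : IsGraded P) :
    gradedPart P = P :=
  le_antisymm (gradedPart_le P) fun x hx => by
    have hx' := h x hx
    clear hx
    induction hx' using AddSubgroup.closure_induction with
    | mem x hx => exact TwoSidedIdeal.subset_span hx
    | zero => exact zero_mem _
    | add x y _ _ hx hy => exact add_mem hx hy
    | neg x _ hx => exact neg_mem hx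

/-- Local units turn a scalar multiple into a product with an algebra element, so ring ideals are
subspaces. -/
theorem smul_mem_ideal (I : TwoSidedIdeal (LeavittPathAlgebra K V)) (k : K)
    {x : LeavittPathAlgebra K V} (hx : x ∈ I) : k • x ∈ I := by
  obtain ⟨T, hT⟩ := (leavittFamily K V).exists_sum_p_mul_eq x
  rw [← hT, ← smul_mul_assoc]
  exact I.mul_mem_left _ _ hx

/-- The quotient of the Leavitt path algebra by an ideal. -/
def LeavittQuotient (I : TwoSidedIdeal (LeavittPathAlgebra K V)) : Type (max u v w) :=
  I.ringCon.Quotient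

namespace LeavittQuotient

variable (I : TwoSidedIdeal (LeavittPathAlgebra K V))

instance : NonUnitalRing (LeavittQuotient I) :=
  inferInstanceAs (NonUnitalRing I.ringCon.Quotient)

/-- The quotient map. -/
def mk : LeavittPathAlgebra K V →ₙ+* LeavittQuotient I where
  toFun x := (x : I.ringCon.Quotient)
  map_zero' := rfl
  map_add' _ _ := rfl
  map_mul' _ _ := rfl

theorem mk_surjective : Function.Surjective (mk I) := Quotient.mk''_surjective

theorem mk_eq_zero_iff {x : LeavittPathAlgebra K V} : mk I x = 0 ↔ x ∈ I :=
  RingCon.eq _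

instance : SMul K (LeavittQuotient I) :=
  ⟨fun k => Quotient.map' (k • ·) fun x y h => by
    change I.ringCon (k • x) (k • y)
    change I.ringCon x y at h
    rw [TwoSidedIdeal.rel_iff] at h ⊢
    rw [← smul_sub]
    exact smul_mem_ideal I k h⟩

theorem mk_smul (k : K) (x : LeavittPathAlgebra K V) : mk I (k • x) = k • mk I x := rfl

instance : Module K (LeavittQuotient I) :=
  (mk_surjective I).module K (mk I).toAddMonoidHom (mk_smul I)

instance : IsScalarTower K (LeavittQuotient I) (LeavittQuotient I) where
  smul_assoc k x y := by
    obtain ⟨x, rfl⟩ := mk_surjective I x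
    obtain ⟨y, rfl⟩ := mk_surjective I y
    rw [smul_eq_mul, smul_eq_mul, ← mk_smul, ← map_mul, ← map_mul, ← mk_smul, smul_mul_assoc]

instance : SMulCommClass K (LeavittQuotient I) (LeavittQuotient I) where
  smul_comm k x y := by
    obtain ⟨x, rfl⟩ := mk_surjective I x
    obtain ⟨y, rfl⟩ := mk_surjective I y
    rw [smul_eq_mul, smul_eq_mul, ← mk_smul, ← map_mul, ← map_mul, ← mk_smul, mul_smul_comm]

variable {I} in
theorem exists_comap_eq {J : TwoSidedIdeal (LeavittPathAlgebra K V)} (h : I ≤ J) :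
    ∃ J' : TwoSidedIdeal (LeavittQuotient I), ∀ x, mk I x ∈ J' ↔ x ∈ J := by
  have key : ∀ x y, mk I x = mk I y → x ∈ J → y ∈ J := by
    intro x y hxy hx
    have : x - y ∈ I := by rw [← mk_eq_zero_iff, map_sub, hxy, sub_self]
    simpa using J.sub_mem hx (h this)
  refine ⟨.mk' (mk I '' J) ⟨0, J.zero_mem, map_zero _⟩ ?_ ?_ ?_ ?_, fun x => ?_⟩
  · rintro _ _ ⟨x, hx, rfl⟩ ⟨y, hy, rfl⟩
    exact ⟨x + y, J.add_mem hx hy, map_add _ _ _⟩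
  · rintro _ ⟨x, hx, rfl⟩
    exact ⟨-x, J.neg_mem hx, map_neg _ _⟩
  · rintro x _ ⟨y, hy, rfl⟩
    obtain ⟨x, rfl⟩ := mk_surjective I x
    exact ⟨x * y, J.mul_mem_left _ _ hy, map_mul _ _ _⟩
  · rintro _ y ⟨x, hx, rfl⟩
    obtain ⟨y, rfl⟩ := mk_surjective I y
    exact ⟨x * y, J.mul_mem_right _ _ hx, map_mul _ _ _⟩
  · exact (TwoSidedIdeal.mem_mk' _ _ _ _ _ _ _).trans
      ⟨fun ⟨y, hy, hxy⟩ => key y x hxy hy, fun hx => ⟨x, hx, rfl⟩⟩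

end LeavittQuotient

end Leavitt

/-! ### A representation annihilating `I(H, S)`. -/

/-- The linear operator on functions which is given by composition with a partial map. -/
def partialOp (K : Type w) [Field K] {Y : Type*} (g : Y → Option Y) : Module.End K (Y → K) where
  toFun f y := (g y).elim 0 f
  map_add' f f' := by ext y; cases h : g y <;> simp [h]
  map_smul' k f := by ext y; cases h : g y <;> simp [h]

/-- Pulling back functions reverses composition: points are moved by `g` first and then by `h`. So
an edge strips a branch label and its ghost edge attaches one. -/
theorem partialOp_mul (K : Type w) [Field K] {Y : Type*} (g h : Y → Option Y) :
    partialOp K g * partialOp K h = partialOp K fun y => (g y).bind h := by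
  ext f y
  cases hg : g y <;> simp [partialOp, hg]

theorem partialOp_none (K : Type w) [Field K] {Y : Type*} :
    partialOp K (fun _ : Y => none) = 0 := rfl

section Branching

variable {V : Type u} [Quiver.{v} V]

/-- The edges which start at `a` and do not end in `H`. -/
abbrev StarOff (H : Set V) (a : V) : Type (max u v) := {e : Quiver.Star a // e.1 ∉ H}

variable (V) in
/-- An infinite set which is at least as large as the set of all edges. -/
abbrev BranchSet : Type (max u v) := ℕ ⊕ Quiver.Total V

-- Cardinal arithmetic in a large infinite set. Surjectivity will supply the second Cuntz–Krieger
-- relation; a point off the image, available at each vertex of `B_H \ S`, will witness that `a^H`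
-- acts nontrivially there.
open Classical in
theorem exists_branching (H S : Set V) (a : V) :
    ∃ f : StarOff H a × BranchSet V → BranchSet V, Function.Injective f ∧
      (Function.Surjective f ↔ Nonempty (StarOff H a) ∧ a ∉ breaking H \ S) := by
  have hle : Cardinal.mk (StarOff H a) ≤ Cardinal.mk (BranchSet V) := by
    refine Cardinal.mk_le_of_injective (f := fun e => Sum.inr ⟨a, e.1.1, e.1.2⟩) ?_
    rintro ⟨⟨c, e⟩, h⟩ ⟨⟨c', e'⟩, h'⟩ heq
    simpa using heq
  have hinf : Cardinal.aleph0 ≤ Cardinal.mk (BranchSet V) := Cardinal.aleph0_le_mk _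
  by_cases hC : Nonempty (StarOff H a) ∧ a ∉ breaking H \ S
  · have hne := hC.1
    have : Cardinal.mk (StarOff H a × BranchSet V) = Cardinal.mk (BranchSet V) := by
      rw [Cardinal.mk_prod, Cardinal.lift_id, Cardinal.lift_id]
      exact Cardinal.mul_eq_right hinf hle (Cardinal.mk_ne_zero _)
    obtain ⟨f⟩ := Cardinal.eq.1 this
    exact ⟨f, f.injective, iff_of_true f.surjective hC⟩
  · have : Cardinal.mk (Option (StarOff H a × BranchSet V)) ≤ Cardinal.mk (BranchSet V) := by
      rw [Cardinal.mk_option, Cardinal.mk_prod, Cardinal.lift_id, Cardinal.lift_id]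
      refine Cardinal.add_le_of_le hinf ?_ (Cardinal.one_le_aleph0.trans hinf)
      exact Cardinal.mul_le_of_le hinf hle le_rfl
    obtain ⟨f⟩ := Cardinal.le_def _ _ |>.1 this
    refine ⟨fun q => f (some q), fun q q' h => by simpa using h, iff_of_false (fun h => ?_) hC⟩
    obtain ⟨q, hq⟩ := h (f none)
    simp at hq

variable (H S : Set V)

/-- A choice of injections as in `exists_branching`. -/
def enc (a : V) : StarOff H a × BranchSet V → BranchSet V := (exists_branching H S a).choose

theorem enc_injective (a : V) : Function.Injective (enc H S a) :=
  (exists_branching H S a).choose_spec.1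

theorem enc_surjective_iff (a : V) : Function.Surjective (enc H S a) ↔
    Nonempty (StarOff H a) ∧ a ∉ breaking H \ S :=
  (exists_branching H S a).choose_spec.2

/-- The partial inverse of `enc`. -/
def dec (a : V) : BranchSet V → Option (StarOff H a × BranchSet V) :=
  Function.partialInv (enc H S a)

theorem dec_eq_some {a : V} {x : BranchSet V} {q : StarOff H a × BranchSet V} :
    dec H S a x = some q ↔ enc H S a q = x :=
  (enc_injective H S a).isPartialInv _ _

theorem dec_enc {a : V} (q : StarOff H a × BranchSet V) : dec H S a (enc H S a q) = some q :=
  (dec_eq_some H S).2 rfl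

theorem exists_dec_eq_none_iff {a : V} : (∃ x, dec H S a x = none) ↔
    ¬ (Nonempty (StarOff H a) ∧ a ∉ breaking H \ S) := by
  rw [← enc_surjective_iff, Function.Surjective]
  push Not
  refine exists_congr fun x => ?_
  rw [Option.eq_none_iff_forall_ne_some]
  exact forall_congr' fun q => (dec_eq_some H S).not

open Classical in
/-- The partial map given by a generator of the Leavitt path algebra. -/
def branchMap : Gen V → V × BranchSet V → Option (V × BranchSet V)
  | .vertex a, y => if y.1 = a ∧ a ∉ H then some y else none
  | .edge e, y => (dec H S y.1 y.2).bind fun q =>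
      if (⟨y.1, q.1.1.1, q.1.1.2⟩ : Quiver.Total V) = e then some (e.right, q.2) else none
  | .ghost e, y => if h : e.right ∉ H ∧ y.1 = e.right then
      some (e.left, enc H S e.left (⟨⟨e.right, e.hom⟩, h.1⟩, y.2)) else none

variable (K : Type w) [Field K]

/-- The operator given by a generator of the Leavitt path algebra. -/
def branchOp (g : Gen V) : Module.End K (V × BranchSet V → K) := partialOp K (branchMap H S g)

open Classical in
theorem branchOp_edge_mul_ghost_apply (e : Quiver.Total V) (f : V × BranchSet V → K) (b : V)
    (x : BranchSet V) : (branchOp H S K (.edge e) * branchOp H S K (.ghost e)) f (b, x) =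
      if ∃ q, dec H S b x = some q ∧ (⟨b, q.1.1.1, q.1.1.2⟩ : Quiver.Total V) = e
        then f (b, x) else 0 := by
  rw [branchOp, branchOp, partialOp_mul]
  simp only [partialOp, branchMap, LinearMap.coe_mk, AddHom.coe_mk]
  cases hq : dec H S b x with
  | none => simp
  | some q =>
    by_cases he : (⟨b, q.1.1.1, q.1.1.2⟩ : Quiver.Total V) = e
    · subst he
      have hx := (dec_eq_some H S).1 hq
      have hq1 : q.1.1.1 ∉ H := q.1.2
      simp [branchMap, hq1, hx]
    · simp [he]

-- The sum of the `e e*` is the projection onto the points over `a` that carry a branch label. The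
-- index map `j` allows both all edges at `a`, as in the second Cuntz–Krieger relation, and only
-- those ending outside `H`, as in `a^H`.
open Classical in
theorem sum_branchOp_apply {ι : Type*} [Fintype ι] {a : V} (j : ι → Quiver.Star a)
    (hj : Function.Injective j) (hj' : ∀ e : Quiver.Star a, e.1 ∉ H → e ∈ Set.range j)
    (f : V × BranchSet V → K) (b : V) (x : BranchSet V) :
    (∑ i, branchOp H S K (.edge ⟨a, (j i).1, (j i).2⟩) *
      branchOp H S K (.ghost ⟨a, (j i).1, (j i).2⟩)) f (b, x) =
      if b = a ∧ dec H S b x ≠ none then f (b, x) else 0 := by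
  rw [LinearMap.sum_apply, Finset.sum_apply]
  simp only [branchOp_edge_mul_ghost_apply]
  by_cases hb : b = a
  · subst hb
    cases hq : dec H S b x with
    | none => simp
    | some q =>
      obtain ⟨i, hi⟩ := hj' q.1.1 q.1.2
      rw [Finset.sum_eq_single i]
      · have hji : (⟨b, q.1.1.1, q.1.1.2⟩ : Quiver.Total V) = ⟨b, (j i).1, (j i).2⟩ := by rw [hi]
        rw [if_pos ⟨q, rfl, hji⟩]
        simp
      · intro i' _ hi'
        rw [if_neg]
        rintro ⟨q', hq', h⟩
        obtain rfl := Option.some.inj hq'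
        refine hi' (hj ?_)
        rw [hi]
        generalize j i' = e at h
        obtain ⟨c, e⟩ := e
        obtain ⟨⟨⟨c', e'⟩, h'⟩, z⟩ := q
        simpa using h.symm
      · simp
  · rw [if_neg (fun h => hb h.1)]
    refine Finset.sum_eq_zero fun i _ => if_neg ?_
    rintro ⟨q, -, h⟩
    exact hb (congrArg Quiver.Total.left h)

variable {H S}

theorem left_notMem (hH : IsHereditary H) {e : Quiver.Total V} (he : e.right ∉ H) :
    e.left ∉ H := fun h => he (hH _ h _ (.of_edge e))

theorem dec_eq_none_of_mem (hH : IsHereditary H) {a : V} (ha : a ∈ H) (x : BranchSet V) :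
    dec H S a x = none := by
  by_contra h
  obtain ⟨q, -⟩ := Option.ne_none_iff_exists'.1 h
  exact q.1.2 (hH a ha _ ⟨q.1.1.2.toPath⟩)

theorem dec_ne_none {a : V} (hne : Nonempty (StarOff H a)) (ha : a ∉ breaking H \ S)
    (x : BranchSet V) : dec H S a x ≠ none :=
  fun hx => (exists_dec_eq_none_iff H S).1 ⟨x, hx⟩ ⟨hne, ha⟩

/-- Saturation provides an edge ending outside `H`, and a finite emitter is never a breaking vertex.
-/
theorem dec_ne_none_of_isRegular (h : IsAdmissible H S) {a : V} (ha : a ∉ H) (hreg : IsRegular a)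
    (x : BranchSet V) : dec H S a x ≠ none := by
  refine dec_ne_none ?_ (fun hb => ?_) x
  · by_contra hne
    refine ha (h.2.1 a hreg fun e => ?_)
    by_contra he
    exact hne ⟨⟨e, he⟩⟩
  · have := hreg.2
    exact not_finite_iff_infinite.2 hb.1.2.1 this

open Classical in
theorem branchOp_vertex_apply (a : V) (f : V × BranchSet V → K) (b : V) (x : BranchSet V) :
    branchOp H S K (.vertex a) f (b, x) = if b = a ∧ a ∉ H then f (b, x) else 0 := by
  by_cases h : b = a ∧ a ∉ H <;> simp [branchOp, partialOp, branchMap, h]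

theorem branchOp_rel (h : IsAdmissible H S) (x y : FreeAlgebra K (Gen V)) (hxy : Rel K V x y) :
    FreeAlgebra.lift K (branchOp H S K) x = FreeAlgebra.lift K (branchOp H S K) y := by
  classical
  cases hxy with
  | ck2 a =>
    simp only [map_mul, map_sum, FreeAlgebra.lift_ι_apply]
    ext f ⟨b, x⟩
    rw [sum_branchOp_apply H S K (fun e : Quiver.Star a => e) (fun _ _ h => h)
      (fun e _ => ⟨e, rfl⟩), branchOp_vertex_apply]
    refine if_congr (and_congr_right ?_) rfl rfl
    rintro rfl
    exact ⟨fun hb => dec_ne_none_of_isRegular h hb ⟨inferInstance, Finite.of_fintype _⟩ x,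
      fun hx hb => hx (dec_eq_none_of_mem h.1 hb x)⟩
  | idem a =>
    simp only [map_mul, FreeAlgebra.lift_ι_apply, branchOp, partialOp_mul]
    congr 1
    funext ⟨b, x⟩
    by_cases hb : b = a ∧ a ∉ H <;> simp [branchMap, hb]
  | orth a a' ha =>
    simp only [map_mul, map_zero, FreeAlgebra.lift_ι_apply, branchOp, partialOp_mul,
      ← partialOp_none]
    congr 1
    funext ⟨b, x⟩
    by_cases hb : b = a ∧ a ∉ H
    · simp [branchMap, hb, ha]
    · simp [branchMap, hb]
  | source_edge e =>
    simp only [map_mul, FreeAlgebra.lift_ι_apply, branchOp, partialOp_mul]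
    congr 1
    funext ⟨b, x⟩
    by_cases hb : b = e.left
    · subst hb
      by_cases he : e.left ∈ H
      · simp [branchMap, dec_eq_none_of_mem h.1 he]
      · simp [branchMap, he]
    · have : ∀ c (g : b ⟶ c), (⟨b, c, g⟩ : Quiver.Total V) ≠ e := by
        rintro c g rfl
        exact hb rfl
      cases hx : dec H S b x <;> simp [branchMap, hb, hx, this]
  | edge_range e =>
    simp only [map_mul, FreeAlgebra.lift_ι_apply, branchOp, partialOp_mul]
    congr 1
    funext ⟨b, x⟩
    cases hx : dec H S b x with
    | none => simp [branchMap, hx]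
    | some q =>
      by_cases he : (⟨b, q.1.1.1, q.1.1.2⟩ : Quiver.Total V) = e
      · subst he
        have hq1 : q.1.1.1 ∉ H := q.1.2
        simp [branchMap, hx, hq1]
      · simp [branchMap, hx, he]
  | range_ghost e =>
    simp only [map_mul, FreeAlgebra.lift_ι_apply, branchOp, partialOp_mul]
    congr 1
    funext ⟨b, x⟩
    by_cases hb : e.right ∉ H ∧ b = e.right
    · simp [branchMap, hb]
    · have hb' : ¬ (b = e.right ∧ e.right ∉ H) := fun h => hb h.symm
      simp [branchMap, hb, hb']
  | ghost_source e =>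
    simp only [map_mul, FreeAlgebra.lift_ι_apply, branchOp, partialOp_mul]
    congr 1
    funext ⟨b, x⟩
    by_cases hb : e.right ∉ H ∧ b = e.right
    · simp [branchMap, hb, left_notMem h.1 hb.1]
    · simp [branchMap, hb]
  | ck1_same e =>
    simp only [map_mul, FreeAlgebra.lift_ι_apply, branchOp, partialOp_mul]
    congr 1
    funext ⟨b, x⟩
    by_cases hb : e.right ∉ H ∧ b = e.right
    · obtain ⟨hb, rfl⟩ := hb
      simp [branchMap, hb, dec_enc]
    · have hb' : ¬ (b = e.right ∧ e.right ∉ H) := fun h => hb h.symm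
      simp [branchMap, hb, hb']
  | ck1_ne e e' he =>
    simp only [map_mul, map_zero, FreeAlgebra.lift_ι_apply, branchOp, partialOp_mul,
      ← partialOp_none]
    congr 1
    funext ⟨b, x⟩
    by_cases hb : e.right ∉ H ∧ b = e.right
    · simp [branchMap, hb, dec_enc, he]
    · simp [branchMap, hb]

/-- The representation of the Leavitt path algebra on functions. -/
def branchRep (h : IsAdmissible H S) :
    LeavittPathAlgebra K V →ₙₐ[K] Module.End K (V × BranchSet V → K) :=
  ((unitalLift K V (branchOp H S K) (branchOp_rel K h) : _ →ₙₐ[K] _)).comp (toUnital K V)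

theorem branchRep_gen (h : IsAdmissible H S) (g : Gen V) :
    branchRep K h (gen K g) = branchOp H S K g :=
  unitalLift_unitalGen _ _ _ _

open Classical in
theorem branchRep_breakingElement_apply (h : IsAdmissible H S) {a : V} (ha : a ∈ breaking H)
    (f : V × BranchSet V → K) (x : BranchSet V) :
    branchRep K h (breakingElement K H a) f (a, x) =
      if dec H S a x = none then f (a, x) else 0 := by
  have := ha.2.2.2
  cases nonempty_fintype (StarOff H a)
  rw [breakingElement, finsum_eq_sum_of_fintype, map_sub, map_sum, LinearMap.sub_apply,
    Pi.sub_apply]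
  simp only [map_mul, branchRep_gen]
  rw [branchOp_vertex_apply, sum_branchOp_apply H S K (fun e : StarOff H a => e.1)
    Subtype.val_injective (fun e he => ⟨⟨e, he⟩, rfl⟩), if_pos ⟨rfl, ha.1⟩]
  by_cases hx : dec H S a x = none <;> simp [hx]

theorem branchRep_breakingElement_apply_of_ne (h : IsAdmissible H S) {a b : V}
    (ha : a ∈ breaking H) (hb : b ≠ a) (f : V × BranchSet V → K) (x : BranchSet V) :
    branchRep K h (breakingElement K H a) f (b, x) = 0 := by
  classical
  have := ha.2.2.2
  cases nonempty_fintype (StarOff H a)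
  rw [breakingElement, finsum_eq_sum_of_fintype, map_sub, map_sum, LinearMap.sub_apply,
    Pi.sub_apply]
  simp only [map_mul, branchRep_gen]
  rw [branchOp_vertex_apply, sum_branchOp_apply H S K (fun e : StarOff H a => e.1)
    Subtype.val_injective (fun e he => ⟨⟨e, he⟩, rfl⟩), if_neg (fun h => hb h.1),
    if_neg (fun h => hb h.1), sub_zero]

/-- Vertices of `H` act as zero by construction; for `a ∈ S` every point over `a` carries a branch
label, so `a^H` acts as zero too. -/
theorem admissibleIdeal_le_ker (h : IsAdmissible H S) {x : LeavittPathAlgebra K V}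
    (hx : x ∈ admissibleIdeal K H S) : branchRep K h x = 0 := by
  classical
  rw [← TwoSidedIdeal.mem_ker]
  revert x
  change admissibleIdeal K H S ≤ _
  rw [admissibleIdeal, TwoSidedIdeal.span_le]
  rintro _ (⟨a, ha, rfl⟩ | ⟨a, ha, rfl⟩) <;> rw [SetLike.mem_coe, TwoSidedIdeal.mem_ker] <;>
    ext f ⟨b, x⟩
  · rw [branchRep_gen, branchOp_vertex_apply, if_neg fun h => h.2 ha]
    rfl
  · by_cases hb : b = a
    · subst hb
      have hb := h.2.2 ha
      rw [branchRep_breakingElement_apply K h hb,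
        if_neg (dec_ne_none hb.2.2.1 (fun h => h.2 ha) x)]
      rfl
    · rw [branchRep_breakingElement_apply_of_ne K h (h.2.2 ha) hb]
      rfl

theorem vertex_notMem_admissibleIdeal (h : IsAdmissible H S) {a : V} (ha : a ∉ H) :
    gen K (.vertex a) ∉ admissibleIdeal K H S := by
  classical
  intro hmem
  have := congrFun (LinearMap.congr_fun (admissibleIdeal_le_ker K h hmem) fun _ => 1)
    (a, Sum.inl 0)
  rw [branchRep_gen, branchOp_vertex_apply, if_pos ⟨rfl, ha⟩] at this
  exact one_ne_zero this

theorem breakingElement_notMem_admissibleIdeal (h : IsAdmissible H S) {a : V}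
    (ha : a ∈ breaking H \ S) : breakingElement K H a ∉ admissibleIdeal K H S := by
  classical
  intro hmem
  obtain ⟨x, hx⟩ := (exists_dec_eq_none_iff H S).2 fun h => h.2 ha
  have := congrFun (LinearMap.congr_fun (admissibleIdeal_le_ker K h hmem) fun _ => 1) (a, x)
  rw [branchRep_breakingElement_apply K h ha.1, if_pos hx] at this
  exact one_ne_zero this

end Branching

/-! ### Breaking elements and relations modulo `I(H, S)`. -/

section Quotient

variable {K : Type w} [Field K] {V : Type u} [Quiver.{v} V] {H S : Set V}

open Gen

theorem sub_breakingElement (H : Set V) {a : V} [Fintype (StarOff H a)] :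
    gen K (vertex a) - breakingElement K H a =
      ∑ e : StarOff H a, gen K (edge ⟨a, e.1.1, e.1.2⟩) * gen K (ghost ⟨a, e.1.1, e.1.2⟩) := by
  rw [breakingElement, finsum_eq_sum_of_fintype, sub_sub_cancel]

theorem sub_breakingElement_mul_edge {a : V} (ha : a ∈ breaking H) (e : StarOff H a) :
    (gen K (vertex a) - breakingElement K H a) * gen K (edge ⟨a, e.1.1, e.1.2⟩) =
      gen K (edge ⟨a, e.1.1, e.1.2⟩) := by
  have := ha.2.2.2
  cases nonempty_fintype (StarOff H a)
  rw [sub_breakingElement, Finset.sum_mul, Finset.sum_eq_single e]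
  · rw [mul_assoc]
    refine (congrArg _ ((leavittFamily K V).t_mul_s_self _)).trans ?_
    exact (leavittFamily K V).s_mul_p ⟨a, e.1.1, e.1.2⟩
  · intro f _ hf
    rw [mul_assoc]
    refine (congrArg _ ((leavittFamily K V).t_mul_s_of_ne _ _ ?_)).trans (mul_zero _)
    obtain ⟨⟨c, f⟩, hf'⟩ := f
    obtain ⟨⟨c', e⟩, he'⟩ := e
    simpa using hf
  · exact fun h => (h (Finset.mem_univ _)).elim

theorem ghost_mul_sub_breakingElement {a : V} (ha : a ∈ breaking H) (e : StarOff H a) :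
    gen K (ghost ⟨a, e.1.1, e.1.2⟩) * (gen K (vertex a) - breakingElement K H a) =
      gen K (ghost ⟨a, e.1.1, e.1.2⟩) := by
  have := ha.2.2.2
  cases nonempty_fintype (StarOff H a)
  rw [sub_breakingElement, Finset.mul_sum, Finset.sum_eq_single e]
  · rw [← mul_assoc]
    refine (congrArg (· * _) ((leavittFamily K V).t_mul_s_self _)).trans ?_
    exact (leavittFamily K V).p_mul_t ⟨a, e.1.1, e.1.2⟩
  · intro f _ hf
    rw [← mul_assoc]
    refine (congrArg (· * _) ((leavittFamily K V).t_mul_s_of_ne _ _ ?_)).trans (zero_mul _)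
    obtain ⟨⟨c, f⟩, hf'⟩ := f
    obtain ⟨⟨c', e⟩, he'⟩ := e
    simpa [eq_comm] using hf
  · exact fun h => (h (Finset.mem_univ _)).elim

theorem vertex_mul_breakingElement {a : V} (ha : a ∈ breaking H) :
    gen K (vertex a) * breakingElement K H a = breakingElement K H a := by
  have := ha.2.2.2
  cases nonempty_fintype (StarOff H a)
  have h1 : gen K (vertex a) * gen K (vertex a) = gen K (vertex a) :=
    (leavittFamily K V).p_mul_self a
  have h2 : gen K (vertex a) * (gen K (vertex a) - breakingElement K H a) =
      gen K (vertex a) - breakingElement K H a := by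
    rw [sub_breakingElement, Finset.mul_sum]
    refine Finset.sum_congr rfl fun e _ => ?_
    rw [← mul_assoc]
    exact congrArg (· * _) ((leavittFamily K V).p_mul_s ⟨a, e.1.1, e.1.2⟩)
  rwa [mul_sub, h1, sub_right_inj] at h2

theorem breakingElement_mul_vertex {a : V} (ha : a ∈ breaking H) :
    breakingElement K H a * gen K (vertex a) = breakingElement K H a := by
  have := ha.2.2.2
  cases nonempty_fintype (StarOff H a)
  have h1 : gen K (vertex a) * gen K (vertex a) = gen K (vertex a) :=
    (leavittFamily K V).p_mul_self a
  have h2 : (gen K (vertex a) - breakingElement K H a) * gen K (vertex a) =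
      gen K (vertex a) - breakingElement K H a := by
    rw [sub_breakingElement, Finset.sum_mul]
    refine Finset.sum_congr rfl fun e _ => ?_
    rw [mul_assoc]
    exact congrArg _ ((leavittFamily K V).t_mul_p ⟨a, e.1.1, e.1.2⟩)
  rwa [sub_mul, h1, sub_right_inj] at h2

theorem breakingElement_mul_edge {a : V} (ha : a ∈ breaking H) (e : StarOff H a) :
    breakingElement K H a * gen K (edge ⟨a, e.1.1, e.1.2⟩) = 0 := by
  have h1 := sub_breakingElement_mul_edge (K := K) ha e
  have h2 : gen K (vertex a) * gen K (edge ⟨a, e.1.1, e.1.2⟩) = gen K (edge ⟨a, e.1.1, e.1.2⟩) :=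
    (leavittFamily K V).p_mul_s ⟨a, e.1.1, e.1.2⟩
  rwa [sub_mul, h2, sub_eq_self] at h1

theorem ghost_mul_breakingElement {a : V} (ha : a ∈ breaking H) (e : StarOff H a) :
    gen K (ghost ⟨a, e.1.1, e.1.2⟩) * breakingElement K H a = 0 := by
  have h1 := ghost_mul_sub_breakingElement (K := K) ha e
  have h2 : gen K (ghost ⟨a, e.1.1, e.1.2⟩) * gen K (vertex a) =
      gen K (ghost ⟨a, e.1.1, e.1.2⟩) :=
    (leavittFamily K V).t_mul_p ⟨a, e.1.1, e.1.2⟩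
  rwa [mul_sub, h2, sub_eq_self] at h1

theorem breakingElement_mul_self {a : V} (ha : a ∈ breaking H) :
    breakingElement K H a * breakingElement K H a = breakingElement K H a := by
  have := ha.2.2.2
  cases nonempty_fintype (StarOff H a)
  have h1 : breakingElement K H a * (gen K (vertex a) - breakingElement K H a) = 0 := by
    rw [sub_breakingElement, Finset.mul_sum]
    refine Finset.sum_eq_zero fun e _ => ?_
    rw [← mul_assoc, breakingElement_mul_edge ha e, zero_mul]
  rwa [mul_sub, breakingElement_mul_vertex ha, sub_eq_zero, eq_comm] at h1

/-- Conjugating `a - a^H = ∑ f f*` by `e` leaves the range of `e`. -/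
theorem vertex_mem_of_sub_breakingElement_mem {J : TwoSidedIdeal (LeavittPathAlgebra K V)} {a : V}
    (ha : a ∈ breaking H) (hJ : gen K (vertex a) - breakingElement K H a ∈ J) (e : StarOff H a) :
    gen K (vertex e.1.1) ∈ J := by
  have h1 : gen K (ghost ⟨a, e.1.1, e.1.2⟩) * gen K (edge ⟨a, e.1.1, e.1.2⟩) =
      gen K (vertex e.1.1) := (leavittFamily K V).t_mul_s_self ⟨a, e.1.1, e.1.2⟩
  rw [← h1, ← ghost_mul_sub_breakingElement ha e]
  exact J.mul_mem_right _ _ (J.mul_mem_left _ _ hJ)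

theorem breakingElement_mem_component {a : V} (ha : a ∈ breaking H) :
    breakingElement K H a ∈ component K V 0 := by
  have := ha.2.2.2
  cases nonempty_fintype (StarOff H a)
  have h1 : gen K (vertex a) ∈ component K V 0 := by
    rw [component_eq_deg]
    exact (leavittFamily K V).p_mem_deg a
  have h2 : ∀ e : StarOff H a, gen K (edge ⟨a, e.1.1, e.1.2⟩) *
      gen K (ghost ⟨a, e.1.1, e.1.2⟩) ∈ component K V 0 := fun e => by
    rw [component_eq_deg, ← add_neg_cancel (1 : ℤ)]
    exact (leavittFamily K V).mul_mem_deg ((leavittFamily K V).s_mem_deg ⟨a, e.1.1, e.1.2⟩)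
      ((leavittFamily K V).t_mem_deg ⟨a, e.1.1, e.1.2⟩)
  rw [breakingElement, finsum_eq_sum_of_fintype]
  exact Submodule.sub_mem _ h1 (Submodule.sum_mem _ fun e _ => h2 e)

variable (K H S) in
open Classical in
/-- The element of the Leavitt path algebra corresponding to the new vertex `a'` of the quotient
graph, and zero if there is no such vertex. -/
def sinkElement (a : V) : LeavittPathAlgebra K V :=
  if a ∈ breaking H \ S then breakingElement K H a else 0

theorem sinkElement_of_mem {a : V} (ha : a ∈ breaking H \ S) :
    sinkElement K H S a = breakingElement K H a := if_pos ha

theorem sinkElement_of_notMem {a : V} (ha : a ∉ breaking H \ S) : sinkElement K H S a = 0 :=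
  if_neg ha

theorem sinkElement_mem_component (a : V) : sinkElement K H S a ∈ component K V 0 := by
  by_cases ha : a ∈ breaking H \ S
  · rw [sinkElement_of_mem ha]; exact breakingElement_mem_component ha.1
  · rw [sinkElement_of_notMem ha]; exact zero_mem _

theorem vertex_mul_sinkElement (a : V) :
    gen K (vertex a) * sinkElement K H S a = sinkElement K H S a := by
  by_cases ha : a ∈ breaking H \ S
  · rw [sinkElement_of_mem ha, vertex_mul_breakingElement ha.1]
  · rw [sinkElement_of_notMem ha, mul_zero]

theorem sinkElement_mul_vertex (a : V) :
    sinkElement K H S a * gen K (vertex a) = sinkElement K H S a := by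
  by_cases ha : a ∈ breaking H \ S
  · rw [sinkElement_of_mem ha, breakingElement_mul_vertex ha.1]
  · rw [sinkElement_of_notMem ha, zero_mul]

theorem sinkElement_mul_self (a : V) :
    sinkElement K H S a * sinkElement K H S a = sinkElement K H S a := by
  by_cases ha : a ∈ breaking H \ S
  · rw [sinkElement_of_mem ha, breakingElement_mul_self ha.1]
  · rw [sinkElement_of_notMem ha, zero_mul]

open LeavittQuotient

variable (K H S) in
/-- The quotient map modulo `I(H, S)`. -/
abbrev toQuot : LeavittPathAlgebra K V →ₙ+* LeavittQuotient (admissibleIdeal K H S) := mk _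

theorem toQuot_vertex {a : V} (ha : a ∈ H) : toQuot K H S (gen K (vertex a)) = 0 :=
  (mk_eq_zero_iff _).2 (TwoSidedIdeal.subset_span (Or.inl ⟨a, ha, rfl⟩))

theorem toQuot_edge {e : Quiver.Total V} (he : e.right ∈ H) :
    toQuot K H S (gen K (edge e)) = 0 := by
  have h1 : gen K (edge e) * gen K (vertex e.right) = gen K (edge e) :=
    (leavittFamily K V).s_mul_p e
  rw [← h1, map_mul, toQuot_vertex he, mul_zero]

theorem toQuot_ghost {e : Quiver.Total V} (he : e.right ∈ H) :
    toQuot K H S (gen K (ghost e)) = 0 := by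
  have h1 : gen K (vertex e.right) * gen K (ghost e) = gen K (ghost e) :=
    (leavittFamily K V).p_mul_t e
  rw [← h1, map_mul, toQuot_vertex he, zero_mul]

theorem toQuot_breakingElement {a : V} (ha : a ∈ breaking H) :
    toQuot K H S (breakingElement K H a) = toQuot K H S (sinkElement K H S a) := by
  by_cases haS : a ∈ S
  · rw [sinkElement_of_notMem fun h => h.2 haS, map_zero]
    exact (mk_eq_zero_iff _).2 (TwoSidedIdeal.subset_span (Or.inr ⟨a, haS, rfl⟩))
  · rw [sinkElement_of_mem ⟨ha, haS⟩]

theorem toQuot_sinkElement_mul_edge (e : Quiver.Total V) :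
    toQuot K H S (sinkElement K H S e.left * gen K (edge e)) = 0 := by
  by_cases he : e.right ∈ H
  · rw [map_mul, toQuot_edge he, mul_zero]
  · by_cases ha : e.left ∈ breaking H \ S
    · rw [sinkElement_of_mem ha]
      exact (congrArg _ (breakingElement_mul_edge ha.1 ⟨⟨e.right, e.hom⟩, he⟩)).trans (map_zero _)
    · rw [sinkElement_of_notMem ha, zero_mul, map_zero]

theorem toQuot_ghost_mul_sinkElement (e : Quiver.Total V) :
    toQuot K H S (gen K (ghost e) * sinkElement K H S e.left) = 0 := by
  by_cases he : e.right ∈ H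
  · rw [map_mul, toQuot_ghost he, zero_mul]
  · by_cases ha : e.left ∈ breaking H \ S
    · rw [sinkElement_of_mem ha]
      exact (congrArg _ (ghost_mul_breakingElement ha.1 ⟨⟨e.right, e.hom⟩, he⟩)).trans (map_zero _)
    · rw [sinkElement_of_notMem ha, mul_zero, map_zero]

/-- For a finite emitter this is the second Cuntz–Krieger relation, edges into `H` being zero in the
quotient. Otherwise `a` is a breaking vertex and the definition of `a^H` applies. -/
theorem toQuot_vertex_sub_sinkElement {a : V} [Fintype (StarOff H a)] [Nonempty (StarOff H a)]
    (ha : a ∉ H) : toQuot K H S (gen K (vertex a) - sinkElement K H S a) =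
      ∑ e : StarOff H a, toQuot K H S
        (gen K (edge ⟨a, e.1.1, e.1.2⟩) * gen K (ghost ⟨a, e.1.1, e.1.2⟩)) := by
  by_cases hfin : Finite (Quiver.Star a)
  · have hb : a ∉ breaking H \ S := fun h => not_finite_iff_infinite.2 h.1.2.1 hfin
    cases nonempty_fintype (Quiver.Star a)
    obtain ⟨e⟩ := ‹Nonempty (StarOff H a)›
    have hck : _ = gen K (vertex a) := (leavittFamily K V).finsum_s_mul_t a ⟨⟨e.1⟩, hfin⟩
    rw [sinkElement_of_notMem hb, sub_zero, ← hck, finsum_eq_sum_of_fintype, map_sum]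
    symm
    refine Fintype.sum_of_injective (fun e : StarOff H a => e.1) Subtype.val_injective _ _
      (fun e he => ?_) fun e => rfl
    have : e.1 ∈ H := by
      by_contra h
      exact he ⟨⟨e, h⟩, rfl⟩
    rw [map_mul]
    exact (congrArg (· * _) (toQuot_edge this)).trans (zero_mul _)
  · have hb : a ∈ breaking H := ⟨ha, not_finite_iff_infinite.1 hfin, ‹_›, inferInstance⟩
    rw [map_sub, ← toQuot_breakingElement hb, ← map_sub, sub_breakingElement, map_sum]

end Quotient

/-! ### The quotient graph and the elements attached to its vertices. -/

section QuotientGraph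

variable {V : Type u} [Quiver.{v} V] {H S : Set V}

namespace QuotientGraph

/-- The vertex of `E` below a vertex of the quotient graph. -/
def base : QuotientGraph H S → V
  | Sum.inl a => a
  | Sum.inr a => a

/-- The vertex of the quotient graph given by a vertex outside `H`. -/
abbrev old (a : V) (ha : a ∉ H) : QuotientGraph H S := Sum.inl ⟨a, ha⟩

/-- The vertex of the quotient graph given by a vertex in `B_H \ S`. -/
abbrev new (a : V) (ha : a ∈ breaking H \ S) : QuotientGraph H S := Sum.inr ⟨a, ha⟩

theorem base_notMem (x : QuotientGraph H S) : x.base ∉ H := by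
  rcases x with a | a
  exacts [a.2, a.2.1.1]

/-- The edge of `E` below an edge of the quotient graph. -/
def baseHom : ∀ {x y : QuotientGraph H S}, (x ⟶ y) → (x.base ⟶ y.base)
  | Sum.inl _, Sum.inl _, e => e
  | Sum.inl _, Sum.inr _, e => e
  | Sum.inr _, _, e => e.elim

/-- The edge of `E` below an edge of the quotient graph. -/
abbrev baseEdge (e : Quiver.Total (QuotientGraph H S)) : Quiver.Total V :=
  ⟨e.left.base, e.right.base, baseHom e.hom⟩

theorem left_eq_old (e : Quiver.Total (QuotientGraph H S)) :
    e.left = old e.left.base (base_notMem _) := by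
  obtain ⟨x | x, y, e⟩ := e
  · rfl
  · exact e.elim

theorem eq_of_baseEdge_eq {e f : Quiver.Total (QuotientGraph H S)}
    (h : baseEdge e = baseEdge f) (h' : e.right = f.right) : e = f := by
  obtain ⟨⟨a, ha⟩ | x, y, e⟩ := e
  · obtain ⟨⟨b, hb⟩ | x', y', f⟩ := f
    · obtain rfl : y = y' := h'
      rcases y with ⟨c, hc⟩ | ⟨c, hc⟩ <;> cases h <;> rfl
    · exact f.elim
  · exact e.elim

variable (S) in
/-- The edges of the quotient graph which start at an old vertex. -/
def starEquiv (a : V) (ha : a ∉ H) : Quiver.Star (old (S := S) a ha) ≃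
    StarOff H a ⊕ {e : Quiver.Star a // e.1 ∈ breaking H \ S} where
  toFun
    | ⟨Sum.inl b, e⟩ => Sum.inl ⟨⟨b, e⟩, b.2⟩
    | ⟨Sum.inr b, e⟩ => Sum.inr ⟨⟨b, e⟩, b.2⟩
  invFun
    | Sum.inl e => ⟨Sum.inl ⟨e.1.1, e.2⟩, e.1.2⟩
    | Sum.inr e => ⟨Sum.inr ⟨e.1.1, e.2⟩, e.1.2⟩
  left_inv := by rintro ⟨b | b, e⟩ <;> rfl
  right_inv := by rintro (e | e) <;> rfl

end QuotientGraph

variable {K : Type w} [Field K]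

open Gen QuotientGraph

/-- The homogeneous element of the Leavitt path algebra given by a vertex of the quotient graph. -/
def quotP (K : Type w) [Field K] : QuotientGraph H S → LeavittPathAlgebra K V
  | Sum.inl a => gen K (vertex a.1) - sinkElement K H S a.1
  | Sum.inr a => sinkElement K H S a.1

theorem quotP_mem_component (x : QuotientGraph H S) : quotP K x ∈ component K V 0 := by
  have h : ∀ a, gen K (vertex a) ∈ component K V 0 := fun a => by
    rw [component_eq_deg]
    exact (leavittFamily K V).p_mem_deg a
  rcases x with a | a
  · exact Submodule.sub_mem _ (h a) (sinkElement_mem_component _)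
  · exact sinkElement_mem_component _

theorem vertex_mul_vertex (a : V) : gen K (vertex a) * gen K (vertex a) = gen K (vertex a) :=
  (leavittFamily K V).p_mul_self a

theorem vertex_mul_quotP (x : QuotientGraph H S) :
    gen K (vertex x.base) * quotP K x = quotP K x := by
  rcases x with a | a
  · exact (mul_sub _ _ _).trans
      (by rw [base, vertex_mul_vertex, vertex_mul_sinkElement, quotP])
  · exact vertex_mul_sinkElement _

theorem quotP_mul_vertex (x : QuotientGraph H S) :
    quotP K x * gen K (vertex x.base) = quotP K x := by
  rcases x with a | a
  · exact (sub_mul _ _ _).trans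
      (by rw [base, vertex_mul_vertex, sinkElement_mul_vertex, quotP])
  · exact sinkElement_mul_vertex _

theorem quotP_mul_self (x : QuotientGraph H S) : quotP K x * quotP K x = quotP K x := by
  rcases x with a | a
  · rw [quotP, mul_sub, sub_mul, sub_mul, vertex_mul_vertex, sinkElement_mul_vertex,
      vertex_mul_sinkElement, sinkElement_mul_self, sub_self, sub_zero]
  · exact sinkElement_mul_self _

theorem quotP_mul_quotP_of_ne {x y : QuotientGraph H S} (h : x ≠ y) :
    quotP K x * quotP K y = 0 := by
  by_cases hb : x.base = y.base
  · obtain ⟨a, ha⟩ | ⟨a, ha⟩ := x <;> obtain ⟨b, hb'⟩ | ⟨b, hb'⟩ := y <;>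
      obtain rfl : a = b := hb
    · exact (h rfl).elim
    · rw [quotP, quotP, sub_mul, vertex_mul_sinkElement, sinkElement_mul_self, sub_self]
    · rw [quotP, quotP, mul_sub, sinkElement_mul_vertex, sinkElement_mul_self, sub_self]
    · exact (h rfl).elim
  · have h0 : gen K (vertex x.base) * gen K (vertex y.base) = 0 :=
      (leavittFamily K V).p_mul_p_of_ne _ _ hb
    rw [← quotP_mul_vertex, ← vertex_mul_quotP y, mul_assoc, ← mul_assoc (gen K _), h0, zero_mul,
      mul_zero]

theorem toQuot_quotP_mul_edge (e : Quiver.Total (QuotientGraph H S)) :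
    toQuot K H S (quotP K e.left * gen K (edge (baseEdge e))) =
      toQuot K H S (gen K (edge (baseEdge e))) := by
  have h1 : gen K (vertex e.left.base) * gen K (edge (baseEdge e)) = gen K (edge (baseEdge e)) :=
    (leavittFamily K V).p_mul_s (baseEdge e)
  have h2 := toQuot_sinkElement_mul_edge (K := K) (H := H) (S := S) (baseEdge e)
  have h3 : quotP K e.left = gen K (vertex e.left.base) - sinkElement K H S e.left.base := by
    rw [left_eq_old e]; rfl
  rw [h3, sub_mul, map_sub, h1]
  exact (congrArg _ h2).trans (sub_zero _)

theorem toQuot_ghost_mul_quotP (e : Quiver.Total (QuotientGraph H S)) :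
    toQuot K H S (gen K (ghost (baseEdge e)) * quotP K e.left) =
      toQuot K H S (gen K (ghost (baseEdge e))) := by
  have h1 : gen K (ghost (baseEdge e)) * gen K (vertex e.left.base) = gen K (ghost (baseEdge e)) :=
    (leavittFamily K V).t_mul_p (baseEdge e)
  have h2 := toQuot_ghost_mul_sinkElement (K := K) (H := H) (S := S) (baseEdge e)
  have h3 : quotP K e.left = gen K (vertex e.left.base) - sinkElement K H S e.left.base := by
    rw [left_eq_old e]; rfl
  rw [h3, mul_sub, map_sub, h1]
  exact (congrArg _ h2).trans (sub_zero _)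

/-- In the quotient, `a` is the sum of the `quotP K x` over the at most two vertices `x` above it.
So the generators of the algebra can be cut into pieces indexed by the quotient graph. -/
theorem toQuot_mul_vertex_mul_mem (a : V) (M : AddSubmonoid (LeavittQuotient (admissibleIdeal K H S)))
    (c d : LeavittPathAlgebra K V)
    (hM : ∀ x : QuotientGraph H S, x.base = a → toQuot K H S (c * quotP K x * d) ∈ M) :
    toQuot K H S (c * gen K (vertex a) * d) ∈ M := by
  by_cases ha : a ∈ H
  · rw [map_mul, map_mul, toQuot_vertex ha, mul_zero, zero_mul]
    exact zero_mem _
  · have h1 := hM (old a ha) rfl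
    by_cases hb : a ∈ breaking H \ S
    · have h2 := add_mem h1 (hM (new a hb) rfl)
      rwa [← map_add, ← add_mul, ← mul_add, quotP, quotP, sub_add_cancel] at h2
    · rwa [quotP, sinkElement_of_notMem hb, sub_zero] at h1

/-- An edge `e` with range in `B_H \ S` contributes twice, as `e` and as `e'`; the two range
elements add up to `r(e)`, so together they contribute `e e*`. -/
theorem toQuot_quotP_old {a : V} (ha : a ∉ H)
    (hreg : IsRegular (old (S := S) a ha)) :
    ∑ᶠ e : Quiver.Star (old (S := S) a ha),
      toQuot K H S (gen K (edge (baseEdge ⟨_, e.1, e.2⟩)) * quotP K e.1) *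
        toQuot K H S (quotP K e.1 * gen K (ghost (baseEdge ⟨_, e.1, e.2⟩))) =
      toQuot K H S (quotP K (old (S := S) a ha)) := by
  obtain ⟨⟨e⟩, hfin⟩ := hreg
  have hfin1 : Finite (StarOff H a) :=
    Finite.of_injective (fun e => (starEquiv S a ha).symm (Sum.inl e))
      ((starEquiv S a ha).symm.injective.comp Sum.inl_injective)
  have hfin2 : Finite {e : Quiver.Star a // e.1 ∈ breaking H \ S} :=
    Finite.of_injective (fun e => (starEquiv S a ha).symm (Sum.inr e))
      ((starEquiv S a ha).symm.injective.comp Sum.inr_injective)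
  have hne : Nonempty (StarOff H a) := by
    rcases starEquiv S a ha e with e | e
    exacts [⟨e⟩, ⟨⟨e.1, e.2.1.1⟩⟩]
  cases nonempty_fintype (StarOff H a)
  cases nonempty_fintype (Quiver.Star (old (S := S) a ha))
  cases nonempty_fintype {e : Quiver.Star a // e.1 ∈ breaking H \ S}
  rw [quotP, toQuot_vertex_sub_sinkElement ha, finsum_eq_sum_of_fintype]
  have hterm : ∀ (x y : LeavittPathAlgebra K V) (z : QuotientGraph H S),
      toQuot K H S (x * quotP K z) * toQuot K H S (quotP K z * y) =
        toQuot K H S (x * quotP K z * y) := fun x y z => by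
    rw [← map_mul, mul_assoc, ← mul_assoc (quotP K z), quotP_mul_self, ← mul_assoc]
  simp only [hterm]
  rw [← (starEquiv S a ha).symm.sum_comp, Fintype.sum_sum_type]
  let f : StarOff H a → LeavittPathAlgebra K V := fun e =>
    gen K (edge ⟨a, e.1.1, e.1.2⟩) * sinkElement K H S e.1.1 * gen K (ghost ⟨a, e.1.1, e.1.2⟩)
  -- The sum over primed edges is extended by zero, so that it can be merged termwise with the sum
  -- over unprimed edges.
  have h2 : ∑ e : {e : Quiver.Star a // e.1 ∈ breaking H \ S},
      toQuot K H S (f ⟨e.1, e.2.1.1⟩) = ∑ e, toQuot K H S (f e) := by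
    refine Fintype.sum_of_injective
      (fun e : {e : Quiver.Star a // e.1 ∈ breaking H \ S} => (⟨e.1, e.2.1.1⟩ : StarOff H a))
      (fun e e' h => Subtype.ext (congrArg (fun z : StarOff H a => z.1) h)) _ _ (fun e he => ?_) fun e => rfl
    have : e.1.1 ∉ breaking H \ S := fun h => he ⟨⟨e.1, h⟩, rfl⟩
    change toQuot K H S (_ * _ * _) = 0
    rw [sinkElement_of_notMem this, mul_zero, zero_mul, map_zero]
  refine (congrArg _ h2).trans ?_
  rw [← Finset.sum_add_distrib]
  refine Finset.sum_congr rfl fun e _ => ?_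
  rw [← map_add]
  change toQuot K H S (gen K (edge ⟨a, e.1.1, e.1.2⟩) *
    (gen K (vertex e.1.1) - sinkElement K H S e.1.1) * gen K (ghost ⟨a, e.1.1, e.1.2⟩) +
      gen K (edge ⟨a, e.1.1, e.1.2⟩) * sinkElement K H S e.1.1 *
        gen K (ghost ⟨a, e.1.1, e.1.2⟩)) = _
  rw [← add_mul, ← mul_add, sub_add_cancel]
  exact congrArg (fun x => toQuot K H S (x * _)) ((leavittFamily K V).s_mul_p ⟨a, e.1.1, e.1.2⟩)

theorem exists_baseEdge_eq (hH : IsHereditary H) (e : Quiver.Total V) (x : QuotientGraph H S)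
    (hx : x.base = e.right) : ∃ f, baseEdge f = e ∧ f.right = x := by
  obtain ⟨a, b, e⟩ := e
  obtain rfl : x.base = b := hx
  have ha : a ∉ H := left_notMem hH (e := ⟨a, x.base, e⟩) x.base_notMem
  obtain x | x := x
  · exact ⟨⟨old a ha, Sum.inl x, e⟩, rfl, rfl⟩
  · exact ⟨⟨old a ha, Sum.inr x, e⟩, rfl, rfl⟩

end QuotientGraph

/-! ### The family in `L / I(H, S)` indexed by the quotient graph. -/

section QuotientFamily

variable (K : Type w) [Field K] {V : Type u} [Quiver.{v} V] {H S : Set V}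

open Gen QuotientGraph LeavittQuotient

theorem toQuot_vertex_mem (M : Submodule K (LeavittQuotient (admissibleIdeal K H S)))
    (hM : ∀ x : QuotientGraph H S, toQuot K H S (quotP K x) ∈ M) (a : V) :
    toQuot K H S (gen K (vertex a)) ∈ M := by
  have := toQuot_mul_vertex_mul_mem a M.toAddSubmonoid (gen K (vertex a)) (gen K (vertex a))
    fun x hx => by
      subst hx
      rw [vertex_mul_quotP, quotP_mul_vertex]
      exact hM x
  rwa [vertex_mul_vertex, vertex_mul_vertex] at this

theorem toQuot_edge_mem (hH : IsHereditary H)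
    (M : Submodule K (LeavittQuotient (admissibleIdeal K H S)))
    (hM : ∀ e : Quiver.Total (QuotientGraph H S),
      toQuot K H S (gen K (edge (baseEdge e)) * quotP K e.right) ∈ M) (e : Quiver.Total V) :
    toQuot K H S (gen K (edge e)) ∈ M := by
  have h1 : gen K (edge e) * gen K (vertex e.right) = gen K (edge e) :=
    (leavittFamily K V).s_mul_p e
  have := toQuot_mul_vertex_mul_mem e.right M.toAddSubmonoid (gen K (edge e))
    (gen K (vertex e.right)) fun x hx => by
      obtain ⟨f, hf, rfl⟩ := exists_baseEdge_eq hH e x hx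
      rw [← hx, mul_assoc, quotP_mul_vertex, ← hf]
      exact hM f
  rwa [h1, h1] at this

theorem toQuot_ghost_mem (hH : IsHereditary H)
    (M : Submodule K (LeavittQuotient (admissibleIdeal K H S)))
    (hM : ∀ e : Quiver.Total (QuotientGraph H S),
      toQuot K H S (quotP K e.right * gen K (ghost (baseEdge e))) ∈ M) (e : Quiver.Total V) :
    toQuot K H S (gen K (ghost e)) ∈ M := by
  have h1 : gen K (vertex e.right) * gen K (ghost e) = gen K (ghost e) :=
    (leavittFamily K V).p_mul_t e
  have := toQuot_mul_vertex_mul_mem e.right M.toAddSubmonoid (gen K (vertex e.right))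
    (gen K (ghost e)) fun x hx => by
      obtain ⟨f, hf, rfl⟩ := exists_baseEdge_eq hH e x hx
      rw [← hx, vertex_mul_quotP, ← hf]
      exact hM f
  rwa [mul_assoc, h1, h1] at this

/-- The quotient of the Leavitt path algebra of `E` by `I(H, S)` is generated by a family indexed
by the quotient graph `E \ (H, S)`. -/
def quotientFamily (h : IsAdmissible H S) :
    CKFamily K (QuotientGraph H S) (LeavittQuotient (admissibleIdeal K H S)) where
  p x := toQuot K H S (quotP K x)
  s e := toQuot K H S (gen K (edge (baseEdge e)) * quotP K e.right)
  t e := toQuot K H S (quotP K e.right * gen K (ghost (baseEdge e)))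
  p_mul_self x := by rw [← map_mul, quotP_mul_self]
  p_mul_p_of_ne x y hxy := by rw [← map_mul, quotP_mul_quotP_of_ne hxy, map_zero]
  p_mul_s e := by
    rw [← map_mul, ← mul_assoc, map_mul, toQuot_quotP_mul_edge, ← map_mul]
  s_mul_p e := by rw [← map_mul, mul_assoc, quotP_mul_self]
  p_mul_t e := by rw [← map_mul, ← mul_assoc, quotP_mul_self]
  t_mul_p e := by
    rw [← map_mul, mul_assoc, map_mul, toQuot_ghost_mul_quotP, ← map_mul]
  t_mul_s_self e := by
    have h1 : gen K (ghost (baseEdge e)) * gen K (edge (baseEdge e)) =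
      gen K (vertex e.right.base) := (leavittFamily K V).t_mul_s_self (baseEdge e)
    rw [← map_mul, mul_assoc, ← mul_assoc (gen K (ghost _)), h1, vertex_mul_quotP, quotP_mul_self]
  t_mul_s_of_ne e f hef := by
    rw [← map_mul, mul_assoc, ← mul_assoc (gen K (ghost _))]
    -- Edges `e` and `e'` have the same base edge and are separated by the orthogonal elements of
    -- their ranges.
    by_cases hb : baseEdge e = baseEdge f
    · have h1 : gen K (ghost (baseEdge e)) * gen K (edge (baseEdge e)) =
        gen K (vertex e.right.base) := (leavittFamily K V).t_mul_s_self (baseEdge e)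
      rw [← hb, h1, ← mul_assoc, quotP_mul_vertex,
        quotP_mul_quotP_of_ne fun h' => hef (eq_of_baseEdge_eq hb h'), map_zero]
    · have h1 : gen K (ghost (baseEdge e)) * gen K (edge (baseEdge f)) = 0 :=
        (leavittFamily K V).t_mul_s_of_ne _ _ hb
      rw [h1, zero_mul, mul_zero, map_zero]
  finsum_s_mul_t x hx := by
    obtain ⟨a, ha⟩ | x := x
    · exact toQuot_quotP_old ha hx
    · obtain ⟨e⟩ := hx.1
      exact e.2.elim
  adjoin_eq_top := by
    rw [eq_top_iff]
    intro x _
    obtain ⟨x, rfl⟩ := mk_surjective _ x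
    set N := NonUnitalAlgebra.adjoin K
      (Set.range (fun x : QuotientGraph H S => toQuot K H S (quotP K x)) ∪
        Set.range (fun e : Quiver.Total (QuotientGraph H S) =>
          toQuot K H S (gen K (edge (baseEdge e)) * quotP K e.right)) ∪
        Set.range fun e : Quiver.Total (QuotientGraph H S) =>
          toQuot K H S (quotP K e.right * gen K (ghost (baseEdge e)))) with hN
    refine leavitt_adjoin_induction (M := fun x => toQuot K H S x ∈ N) (fun g => ?_) ?_
      (fun x y hx hy => ?_) (fun x y hx hy => ?_) (fun k x hx => ?_) x
    · cases g with
      | vertex a =>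
        exact toQuot_vertex_mem K N.toSubmodule
          (fun x => NonUnitalAlgebra.subset_adjoin K (Or.inl (Or.inl ⟨x, rfl⟩))) a
      | edge e =>
        exact toQuot_edge_mem K h.1 N.toSubmodule
          (fun e => NonUnitalAlgebra.subset_adjoin K (Or.inl (Or.inr ⟨e, rfl⟩))) e
      | ghost e =>
        exact toQuot_ghost_mem K h.1 N.toSubmodule
          (fun e => NonUnitalAlgebra.subset_adjoin K (Or.inr ⟨e, rfl⟩)) e
    · rw [map_zero]; exact zero_mem _
    · rw [map_add]; exact add_mem hx hy
    · rw [map_mul]; exact mul_mem hx hy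
    · rw [toQuot, mk_smul]; exact SMulMemClass.smul_mem k hx

variable {K}

/-- Ideals which contain the element given by a vertex of the quotient graph. -/
theorem mem_of_quotP_mem (J : TwoSidedIdeal (LeavittPathAlgebra K V)) {x : QuotientGraph H S}
    (hx : quotP K x ∈ J) : (∃ a ∉ H, gen K (vertex a) ∈ J) ∨
      ∃ a ∈ breaking H \ S, breakingElement K H a ∈ J := by
  obtain ⟨a, ha⟩ | ⟨a, ha⟩ := x
  · rw [quotP] at hx
    by_cases hb : a ∈ breaking H \ S
    -- Here `a - a^H` is not a vertex of `E`, but it brings into `J` the range of any edge from `a`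
    -- ending outside `H`.
    · rw [sinkElement_of_mem hb] at hx
      obtain ⟨e⟩ := hb.1.2.2.1
      exact Or.inl ⟨_, e.2, vertex_mem_of_sub_breakingElement_mem hb.1 hx e⟩
    · rw [sinkElement_of_notMem hb, sub_zero] at hx
      exact Or.inl ⟨a, ha, hx⟩
  · rw [quotP, sinkElement_of_mem ha] at hx
    exact Or.inr ⟨a, ha, hx⟩

theorem quotientFamily_p_ne_zero (h : IsAdmissible H S) (x : QuotientGraph H S) :
    (quotientFamily K h).p x ≠ 0 := by
  intro h0
  rcases mem_of_quotP_mem _ ((mk_eq_zero_iff _).1 h0) with ⟨a, ha, hmem⟩ | ⟨a, ha, hmem⟩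
  exacts [vertex_notMem_admissibleIdeal K h ha hmem,
    breakingElement_notMem_admissibleIdeal K h ha hmem]

theorem mk_mem_deg (h : IsAdmissible H S) {n : ℤ} {x : LeavittPathAlgebra K V}
    (hx : x ∈ component K V n) : toQuot K H S x ∈ (quotientFamily K h).deg n := by
  set Φ := quotientFamily K h
  have hp : ∀ a, toQuot K H S (gen K (vertex a)) ∈ Φ.deg 0 :=
    toQuot_vertex_mem K _ Φ.p_mem_deg
  have hs : ∀ e, toQuot K H S (gen K (edge e)) ∈ Φ.deg 1 :=
    toQuot_edge_mem K h.1 _ Φ.s_mem_deg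
  have ht : ∀ e, toQuot K H S (gen K (ghost e)) ∈ Φ.deg (-1) :=
    toQuot_ghost_mem K h.1 _ Φ.t_mem_deg
  have hreal : ∀ {a b : V} (α : Quiver.Path a b), toQuot K H S (ofPath K α) ∈ Φ.deg α.length := by
    intro a b α
    induction α with
    | nil => exact hp a
    | cons α e ih =>
      rw [ofPath, map_mul, Quiver.Path.length_cons, Nat.cast_succ]
      exact Φ.mul_mem_deg ih (hs _)
  have hghost : ∀ {a b : V} (α : Quiver.Path a b),
      toQuot K H S (ofGhostPath K α) ∈ Φ.deg (-α.length) := by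
    intro a b α
    induction α with
    | nil => exact hp a
    | cons α e ih =>
      rw [ofGhostPath, map_mul, Quiver.Path.length_cons, Nat.cast_succ, neg_add, add_comm]
      exact Φ.mul_mem_deg (ht _) ih
  induction hx using Submodule.span_induction with
  | mem x hx =>
    obtain ⟨a, b, c, α, β, hn, rfl⟩ := hx
    rw [map_mul, ← hn, sub_eq_add_neg]
    exact Φ.mul_mem_deg (hreal α) (hghost β)
  | zero => rw [map_zero]; exact zero_mem _
  | add x y _ _ hx hy => rw [map_add]; exact add_mem hx hy
  | smul k x _ hx => rw [toQuot, mk_smul]; exact Submodule.smul_mem _ k hx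

theorem exists_mk_eq_real (h : IsAdmissible H S) (l : List (Quiver.Total (QuotientGraph H S)))
    (b : QuotientGraph H S) :
    ∃ x ∈ component K V l.length, toQuot K H S x = (quotientFamily K h).real l b := by
  induction l with
  | nil => exact ⟨quotP K b, quotP_mem_component b, rfl⟩
  | cons e l ih =>
    obtain ⟨x, hx, hxl⟩ := ih
    refine ⟨gen K (edge (baseEdge e)) * quotP K e.right * x, ?_, ?_⟩
    · have h1 := quotP_mem_component (K := K) e.right
      have h2 := (leavittFamily K V).s_mem_deg (baseEdge e)
      rw [component_eq_deg] at h1 hx ⊢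
      have h3 := (leavittFamily K V).mul_mem_deg ((leavittFamily K V).mul_mem_deg h2 h1) hx
      rw [add_zero, add_comm, ← Nat.cast_succ] at h3
      exact h3
    · rw [map_mul, hxl]
      rfl

end QuotientFamily

/-! ### Graded parts and the two main implications. -/

section StronglyPrimitive

variable {K : Type w} [Field K] {V : Type u} [Quiver.{v} V]

open Gen LeavittQuotient

/-- The graded part of an ideal is of the form `I(H, S)`. -/
theorem exists_gradedPart_eq (P : TwoSidedIdeal (LeavittPathAlgebra K V)) :
    ∃ H S : Set V, IsAdmissible H S ∧ gradedPart P = admissibleIdeal K H S := by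
  set H : Set V := {a | gen K (vertex a) ∈ P} with hH
  set S : Set V := {a | a ∈ breaking H ∧ breakingElement K H a ∈ P} with hS
  have h : IsAdmissible H S := ⟨(leavittFamily K V).isHereditary_vertices P,
    (leavittFamily K V).isSaturated_vertices P, fun a ha => ha.1⟩
  have hle : admissibleIdeal K H S ≤ gradedPart P := by
    rw [admissibleIdeal, TwoSidedIdeal.span_le]
    rintro _ (⟨a, ha, rfl⟩ | ⟨a, ha, rfl⟩)
    · refine TwoSidedIdeal.subset_span ⟨ha, 0, ?_⟩
      rw [component_eq_deg]
      exact (leavittFamily K V).p_mem_deg a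
    · exact TwoSidedIdeal.subset_span ⟨ha.2, 0, breakingElement_mem_component ha.1⟩
  refine ⟨H, S, h, le_antisymm (TwoSidedIdeal.span_le.2 ?_) hle⟩
  rintro x ⟨hxP, n, hn⟩
  by_contra hx
  -- A homogeneous element of `P` outside `I(H, S)` would reduce to a vertex of the quotient graph
  -- lying in `P`, which the choice of `H` and `S` excludes.
  obtain ⟨y, z, a, hyz⟩ := (quotientFamily K h).reduction_of_mem_deg (quotientFamily_p_ne_zero h)
    (mk_mem_deg h hn) fun h0 => hx ((mk_eq_zero_iff _).1 h0)
  obtain ⟨y, rfl⟩ := mk_surjective _ y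
  obtain ⟨z, rfl⟩ := mk_surjective _ z
  have hmem : y * x * z - quotP K a ∈ admissibleIdeal K H S := by
    rw [← mk_eq_zero_iff, map_sub, map_mul, map_mul, sub_eq_zero]
    exact hyz
  have ha : quotP K a ∈ P := by
    have h1 := P.sub_mem (P.mul_mem_right _ z (P.mul_mem_left y _ hxP))
      (gradedPart_le P (hle hmem))
    rwa [sub_sub_cancel] at h1
  rcases mem_of_quotP_mem P ha with ⟨b, hb, hb'⟩ | ⟨b, hb, hb'⟩
  exacts [hb hb', hb.2 ⟨hb.1, hb'⟩]

variable {P : TwoSidedIdeal (LeavittPathAlgebra K V)} {H S : Set V}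

variable {P' : TwoSidedIdeal (LeavittQuotient (admissibleIdeal K H S))}

theorem mem_or_mem_of_comap_eq (hP' : ∀ x, mk _ x ∈ P' ↔ x ∈ P)
    (hP : IsPrimeIdeal P)
    (x y : LeavittQuotient (admissibleIdeal K H S)) (hxy : x * y ∈ P')
    (h : ∀ z, x * z * y ∈ P') : x ∈ P' ∨ y ∈ P' := by
  obtain ⟨x, rfl⟩ := mk_surjective _ x
  obtain ⟨y, rfl⟩ := mk_surjective _ y
  rw [hP', hP']
  refine hP.mem_or_mem ((hP' _).1 (by rwa [map_mul])) fun z => (hP' _).1 ?_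
  rw [map_mul, map_mul]
  exact h _

/-- The vertices of the quotient graph lift to elements of degree `0`, so any that lay in `P` would
already lie in `gr(P)`. -/
theorem p_notMem_of_comap_eq (hP' : ∀ x, mk _ x ∈ P' ↔ x ∈ P)
    (h : IsAdmissible H S) (hgr : gradedPart P = admissibleIdeal K H S)
    (a : QuotientGraph H S) : (quotientFamily K h).p a ∉ P' := by
  intro ha
  refine quotientFamily_p_ne_zero (K := K) h a ((mk_eq_zero_iff _).2 ?_)
  rw [← hgr]
  exact TwoSidedIdeal.subset_span ⟨(hP' _).1 ha, 0, quotP_mem_component a⟩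

theorem eq_bot_iff_of_comap_eq (hP' : ∀ x, mk _ x ∈ P' ↔ x ∈ P)
    (hgr : gradedPart P = admissibleIdeal K H S) :
    P' = ⊥ ↔ IsGraded P := by
  constructor
  · rintro rfl
    refine isGraded_of_gradedPart_eq (le_antisymm (gradedPart_le P) fun x hx => ?_)
    rwa [hgr, ← mk_eq_zero_iff, ← TwoSidedIdeal.mem_bot, hP']
  · intro hP
    refine eq_bot_iff.2 fun x hx => ?_
    obtain ⟨x, rfl⟩ := mk_surjective _ x
    rwa [TwoSidedIdeal.mem_bot, mk_eq_zero_iff, ← hgr, hP.gradedPart_eq, ← hP']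

theorem IsStronglyPrimitive.isCompletelyIrreducible (hP : IsPrimeIdeal P)
    (hsp : IsStronglyPrimitive P) : IsCompletelyIrreducible P := by
  obtain ⟨H, S, h, hgr, hdd, hcsp, hL⟩ := hsp
  obtain ⟨P', hP'⟩ := exists_comap_eq (hgr ▸ gradedPart_le P)
  obtain ⟨y, hyP, hy⟩ := CKFamily.exists_forall_lt_mem (quotientFamily_p_ne_zero (K := K) h)
    (mem_or_mem_of_comap_eq hP' hP) (p_notMem_of_comap_eq hP' h hgr) hdd.1
    (fun h0 => hL ((eq_bot_iff_of_comap_eq hP' hgr).1 h0)) hcsp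
  obtain ⟨y, rfl⟩ := mk_surjective _ y
  intro heq
  refine hyP ((hP' y).2 ?_)
  rw [heq, TwoSidedIdeal.mem_sInf]
  intro Q (hPQ : P < Q)
  obtain ⟨Q', hQ'⟩ := exists_comap_eq ((hgr ▸ gradedPart_le P).trans hPQ.le)
  rw [← hQ']
  refine hy Q' (lt_of_le_of_ne (fun x hx => ?_) ?_)
  · obtain ⟨x, rfl⟩ := mk_surjective _ x
    exact (hQ' x).2 (hPQ.le ((hP' x).1 hx))
  · rintro rfl
    exact hPQ.ne (TwoSidedIdeal.ext fun x => (hP' x).symm.trans (hQ' x))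

-- Distinct powers of `l` lift to distinct degrees, so gradedness makes each term of a vanishing
-- combination vanish; a path is nonzero because `l* l` is a vertex.
open Polynomial in
theorem polyEval_injective (h : IsAdmissible H S) (hI : IsGraded (admissibleIdeal K H S))
    {a : QuotientGraph H S} {l : List (Quiver.Total (QuotientGraph H S))} (hl : CKFamily.IsLoop a l) :
    Function.Injective ((quotientFamily K h).polyEval a l) := by
  rw [injective_iff_map_eq_zero]
  intro f hf
  have hx : ∀ n, ∃ x ∈ component K V ((n * l.length : ℕ) : ℤ),
      toQuot K H S x = (quotientFamily K h).real (listPow l n) a := by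
    intro n
    obtain ⟨x, hx, hxn⟩ := exists_mk_eq_real (K := K) h (listPow l n) a
    refine ⟨x, ?_, hxn⟩
    rwa [listPow, List.length_flatten, List.map_replicate, List.sum_replicate, smul_eq_mul] at hx
  choose x hx hxr using hx
  have hd : Function.Injective fun n : ℕ => ((n * l.length : ℕ) : ℤ) := fun m n hmn =>
    Nat.eq_of_mul_eq_mul_right (List.length_pos_iff.2 hl.2.1) (Nat.cast_injective hmn)
  have hsum : ∑ n ∈ f.support, f.coeff n • x n ∈ admissibleIdeal K H S := by
    rw [← mk_eq_zero_iff, ← hf, map_sum]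
    conv_rhs => rw [f.as_sum_support, map_sum]
    refine Finset.sum_congr rfl fun n _ => ?_
    rw [CKFamily.polyEval_monomial, ← hxr, mk_smul]
  by_contra hf0
  obtain ⟨n, hn⟩ := Polynomial.support_nonempty.2 hf0
  have hmem := hI.mem_of_sum_mem hd (y := fun n => f.coeff n • x n)
    (fun n => Submodule.smul_mem _ _ (hx n)) hsum hn
  have h0 : f.coeff n • (quotientFamily K h).real (listPow l n) a = 0 := by
    rw [← hxr]
    exact (mk_eq_zero_iff _).2 hmem
  have h1 := (smul_eq_zero.1 h0).resolve_left (mem_support_iff.1 hn)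
  have h2 := (quotientFamily K h).ghost_mul_real (hl.2.2.1.listPow n)
  rw [h1, mul_zero] at h2
  exact quotientFamily_p_ne_zero h a h2.symm

theorem IsLocallyClosed.isStronglyPrimitive (hP : IsPrimeIdeal P) (hlc : IsLocallyClosed P) :
    IsStronglyPrimitive P := by
  obtain ⟨H, S, h, hgr⟩ := exists_gradedPart_eq P
  obtain ⟨P', hP'⟩ := exists_comap_eq (hgr ▸ gradedPart_le P)
  have hp := quotientFamily_p_ne_zero (K := K) h
  have hdd : DownwardDirected (QuotientGraph H S) :=
    CKFamily.downwardDirected_of_prime (mem_or_mem_of_comap_eq hP' hP)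
      (p_notMem_of_comap_eq hP' h hgr) fun htop => hP.1 <| eq_top_iff.2 fun x _ =>
        (hP' x).1 (htop ▸ trivial)
  refine ⟨H, S, h, hgr, hdd, ?_⟩
  by_cases h0 : P' = ⊥
  · have hgraded := (eq_bot_iff_of_comap_eq hP' hgr).1 h0
    have hPI : P = admissibleIdeal K H S := hgraded.gradedPart_eq.symm.trans hgr
    -- Local closedness provides an element outside `P` that is common to all primes properly above
    -- `P`.
    obtain ⟨y, hyP, hy⟩ : ∃ y ∉ P, ∀ Q, IsPrimeIdeal Q → P < Q → y ∈ Q := by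
      by_contra! hcon
      refine hlc (le_antisymm (le_sInf fun Q hQ => hQ.2.le) fun y hy => ?_)
      by_contra hyP
      obtain ⟨Q, hQ, hPQ, hyQ⟩ := hcon y hyP
      exact hyQ ((TwoSidedIdeal.mem_sInf _).1 hy Q ⟨hQ, hPQ⟩)
    have hy0 : mk (admissibleIdeal K H S) y ≠ 0 := fun h => hyP (hPI ▸ (mk_eq_zero_iff _).1 h)
    -- Zorn gives a prime above the preimage of `N` that omits `e`. It is properly above `P` because
    -- `N ≠ ⊥`, so it contains `y`.
    have key : ∀ (N : TwoSidedIdeal (LeavittQuotient (admissibleIdeal K H S)))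
        (e : LeavittQuotient (admissibleIdeal K H S)), e * e = e → N ≠ ⊥ → e ∉ N →
        ∃ Q, N ≤ Q ∧ e ∉ Q ∧ mk _ y ∈ Q := by
      intro N e he hN heN
      obtain ⟨e, rfl⟩ := mk_surjective _ e
      obtain ⟨Q, hQ, hNQ, heQ⟩ := exists_isPrimeIdeal
        (N := N.comap (mk (admissibleIdeal K H S))) (e := e)
        (by
          rw [TwoSidedIdeal.mem_comap, map_sub, map_mul, he, sub_self]
          exact zero_mem _)
        (by rwa [TwoSidedIdeal.mem_comap])
      have hIQ : admissibleIdeal K H S ≤ Q := fun x hx => hNQ <| by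
        rw [TwoSidedIdeal.mem_comap, (mk_eq_zero_iff _).2 hx]
        exact zero_mem _
      obtain ⟨Q', hQ'⟩ := exists_comap_eq hIQ
      refine ⟨Q', fun x hx => ?_, fun h => heQ ((hQ' e).1 h), (hQ' y).2 (hy Q hQ ?_)⟩
      · obtain ⟨x, rfl⟩ := mk_surjective _ x
        exact (hQ' x).2 (hNQ ((TwoSidedIdeal.mem_comap _).2 hx))
      · rw [hPI]
        refine lt_of_le_of_ne hIQ fun hQeq => hN (eq_bot_iff.2 fun x hx => ?_)
        obtain ⟨x, rfl⟩ := mk_surjective _ x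
        rw [TwoSidedIdeal.mem_bot, mk_eq_zero_iff, hQeq]
        exact hNQ ((TwoSidedIdeal.mem_comap _).2 hx)
    have hL : ConditionL (QuotientGraph H S) :=
      CKFamily.conditionL_of_forall_mem hp
        (by
          subst h0
          simpa only [TwoSidedIdeal.mem_bot] using mem_or_mem_of_comap_eq hP' hP)
        (fun a l hl => polyEval_injective h (hPI ▸ hgraded) hl) hy0 key
    exact ⟨CKFamily.strongCSP_of_forall_mem hp hdd hL hy0 key, fun _ => hL⟩
  -- A nonzero `P'` without vertices forces a closed path without exits, and separation follows
  -- without using local closedness.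
  · obtain ⟨a, x, ha, -⟩ := (CKFamily.exists_of_ne_bot hp h0).resolve_left fun ⟨a, ha⟩ =>
      p_notMem_of_comap_eq hP' h hgr a ha
    exact ⟨ha.strongCSP hdd, fun hgraded => (h0 ((eq_bot_iff_of_comap_eq hP' hgr).2 hgraded)).elim⟩

end StronglyPrimitive

/-! ### Order-theoretic equivalences. -/

section Irreducible

variable {R : Type*} [NonUnitalRing R] {P : TwoSidedIdeal R}

/-- Restricting to prime ideals only enlarges the intersection. -/
theorem IsCompletelyIrreducible.isLocallyClosed (h : IsCompletelyIrreducible P) :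
    IsLocallyClosed P := fun heq =>
  h (le_antisymm (le_sInf fun _ hQ => hQ.le)
    ((sInf_le_sInf fun _ hQ => hQ.2).trans heq.ge))

theorem isCompletelyIrreducible_iff_exists_maximal :
    IsCompletelyIrreducible P ↔ ∃ a : R, Maximal (fun J : TwoSidedIdeal R => a ∉ J) P := by
  constructor
  · intro h
    have hle : P ≤ sInf {J | P < J} := le_sInf fun _ hQ => hQ.le
    -- Any element outside `P` common to all larger ideals serves as `a`.
    obtain ⟨a, ha, haP⟩ := SetLike.exists_of_lt (lt_of_le_of_ne hle h)
    refine ⟨a, haP, fun J haJ hPJ => ?_⟩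
    by_contra hJP
    exact haJ ((TwoSidedIdeal.mem_sInf _).1 ha J (lt_of_le_not_ge hPJ hJP))
  · rintro ⟨a, ha⟩ heq
    refine ha.prop ?_
    rw [heq, TwoSidedIdeal.mem_sInf]
    intro J hJ
    by_contra haJ
    exact ha.not_prop_of_gt hJ haJ

end Irreducible

end LPA

end

theorem mainTheorem1 {K : Type w} [Field K] {V : Type u} [Quiver.{v} V]
    (P : TwoSidedIdeal (LPA.LeavittPathAlgebra K V)) (hP : LPA.IsPrimeIdeal P) :
    List.TFAE
      [LPA.IsLocallyClosed P,
       LPA.IsCompletelyIrreducible P,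
       ∃ a : LPA.LeavittPathAlgebra K V, Maximal (fun J : TwoSidedIdeal (LPA.LeavittPathAlgebra K V) => a ∉ J) P,
       LPA.IsStronglyPrimitive P] := by
  tfae_have 2 → 1 := fun h => h.isLocallyClosed
  tfae_have 2 ↔ 3 := LPA.isCompletelyIrreducible_iff_exists_maximal
  tfae_have 1 → 4 := fun h => h.isStronglyPrimitive hP
  tfae_have 4 → 2 := fun h => h.isCompletelyIrreducible hP
  tfae_finish
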